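/- Let $a,b\in\mathbb{R}\setminus\{0\}$ and consider on $\mathbb{R}^3$ (coordinates $x,y,z$; $\partial_1,\partial_2,\partial_3$ the coordinate fields, $\partial_{ij}=\partial_i\wedge\partial_j$, $\partial_{123}=\partial_1\wedge\partial_2\wedge\partial_3$) the quadratic Poisson tensor $$\Lambda_4=ayz\,\partial_{23}+axz\,\partial_{31}+(bxy+z^2)\,\partial_{12}.$$ Let $\mathcal P$ be the space of polyvector fields with coefficients in $\mathbb{R}[[x,y,z]]$, $d=[\Lambda_4,\cdot]$ (Schouten bracket), and $H(\Lambda_4)=\ker d/\operatorname{im} d$ the formal Poisson–Lichnerowicz cohomology (all cochain degrees together). Put $Y_1=x\partial_1$, $Y_2=y\partial_2$, $Y_3=z\partial_3$, $Y_{ij}=Y_i\wedge Y_j$, $Y_{123}=Y_1\wedge Y_2\wedge Y_3$. A sum $\bigoplus_i\mathbb{R}u_i$ over infinitely many homogeneous $u_i$ of increasing degree is understood in the formal sense: it consists of all formal series $\sum_i c_iu_i$, $c_i\in\mathbb{R}$. 1. Suppose $b/a\in\mathbb{Q}$, $b/a>0$, and let $b/a=\beta/\alpha$ with coprime positive integers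 $\alpha,\beta$. Put $$\mathrm{Cas}=\bigoplus_{i\in\mathbb{N}}\mathbb{R}\Big(xy+\tfrac{z^2}{2a+b}\Big)^{\alpha i}z^{\beta i},\qquad \mathrm{Cas}_I=\bigoplus_{i\in\mathbb{N}}\mathbb{R}\,(xy)^{\alpha i}z^{\beta i}.$$ Then the following sum is direct and all its elements are cocycles, and it is a system of representatives of the cohomology, i.e. every class in $H(\Lambda_4)$ contains exactly one element of it: $$\mathrm{Cas}\oplus\mathrm{Cas}\,(Y_1+\tfrac12Y_3)\oplus\mathrm{Cas}\,(Y_2+\tfrac12Y_3)\oplus\mathrm{Cas}_I\,(Y_{23}+Y_{31})\oplus\mathrm{Cas}_I\,Y_{12}\oplus\mathrm{Cas}_I\,Y_{123}$$ $$\oplus\bigoplus_{k\in\mathbb{N}\setminus(\mathbb{N}(2\alpha+\beta)+2)}\mathbb{R}z^k\partial_{12}\ \oplus\bigoplus_{k\in\mathbb{N}\setminus(\mathbb{N}(2\alpha+\beta)+3)}\mathbb{R}z^k\partial_{123}\ \oplus\ R,$$ where $R=\mathbb{R}[[x]]\partial_{23}\oplus\mathbb{R}[[y]]\partial_{31}\oplus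 x\mathbb{R}[[x]]\partial_{123}\oplus y\mathbb{R}[[y]]\partial_{123}$ if $b=a$, and $R=0$ otherwise. 2. Suppose $b/a$ is not a positive rational number. Then the same holds for the sum $$\mathbb{R}\oplus\mathbb{R}(Y_1+\tfrac12Y_3)\oplus\mathbb{R}(Y_2+\tfrac12Y_3)\oplus\mathbb{R}(Y_{23}+Y_{31})\oplus\mathbb{R}Y_{12}\oplus\mathbb{R}Y_{123}\oplus S,$$ where, if $b/a=-1/\alpha$ for a positive integer $\alpha$, with $\mathcal A_\alpha=(xy)^\alpha z^{-1}$, $$S=\mathbb{R}\mathcal A_\alpha(Y_{23}+Y_{31})\oplus\mathbb{R}\mathcal A_\alpha Y_{123}\oplus\bigoplus_{k\in\mathbb{N}\setminus\{2,2\alpha+1\}}\mathbb{R}z^k\partial_{12}\oplus\bigoplus_{k\in\mathbb{N}\setminus\{3,2\alpha+2\}}\mathbb{R}z^k\partial_{123},$$ and otherwise $$S=\bigoplus_{k\in\mathbb{N}\setminus\{2\}}\mathbb{R}z^k\partial_{12}\oplus\bigoplus_{k\in\mathbb{N}\setminus\{3\}}\mathbb{R}z^k\partial_{123}.$$ Moreover,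 in all cases the same summands represent the limit of the following spectral sequence. Writing a term of a cochain of degree $c$ as $\frac{x^{j_1}y^{j_2}z^{j_3}}{xyz}\,\mathbf{Y}$, with $\mathbf{Y}$ a wedge product of $c$ of the $Y_i$, give it the bidegree $(r,s)=(j_1+j_2+c,\,j_3)$; let $K^n$ be the space of the cochains with $r+s=n$ and $K_p$ that of the cochains with $s\ge p$. Let $Z_p^n$ and $B_p^n$ be the cocycles and the coboundaries in $K_p\cap K^n$, and $H_p^n\subset H(\Lambda_4)$ the space of the classes of the elements of $Z_p^n$. For all $p,q\in\mathbb{N}$, both $E_\infty^{pq}=Z_p^{p+q}/(Z_{p+1}^{p+q}+B_p^{p+q})$ and $G^{pq}=H_p^{p+q}/H_{p+1}^{p+q}$ are the direct sums of the images of the spaces $V\cap K_p\cap K^{p+q}$, $V$ running through the above summands, and the kernel of $V\cap K_p\cap K^{p+q}\to E_\infty^{pq}$ (resp. $\to G^{pq}$) is $V\cap K_{p+1}\cap K^{p+q}$. -/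

import Mathlib

/-!
Formal polyvector fields on `ℝ³` with the Schouten bracket, the complex `(P, [Λ, ·])` of the
quadratic tensor `Λ = a yz ∂₂₃ + a xz ∂₃₁ + (b xy + z²) ∂₁₂`, its cohomology, its bigrading and the
limit term of the associated spectral sequence. The coordinates `x, y, z` have the indices `0, 1, 2`.
-/

open MvPowerSeries

noncomputable section

/-- Formal power series in `x, y, z`. -/
abbrev FSeries : Type := MvPowerSeries (Fin 3) ℝ

/-- Formal polyvector fields `∑_I P_I ∂_I` on `ℝ³`; for `I = {i₁ < ⋯ < i_c}` the entry `P I` is the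
coefficient of `∂_I = ∂_{i₁} ∧ ⋯ ∧ ∂_{i_c}`. The cochains of degree `c` are the polyvector fields
that are supported on the sets with `c` elements. -/
abbrev Polyvector : Type := Finset (Fin 3) → FSeries

namespace Polyvector

/-- The sign of the permutation that sorts the concatenation of `I` and `J` (`I`, `J` disjoint):
`∂_I ∧ ∂_J = shuffleSign I J • ∂_{I ∪ J}`. -/
def shuffleSign (I J : Finset (Fin 3)) : ℤ :=
  (-1) ^ ((I ×ˢ J).filter fun ij => ij.2 < ij.1).card

/-- The wedge product. -/
def wedge (P Q : Polyvector) : Polyvector := fun K =>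
  ∑ I ∈ K.powerset, shuffleSign I (K \ I) • (P I * Q (K \ I))

/-- The coefficientwise partial derivative along the `i`-th coordinate. -/
def coordDeriv (i : Fin 3) (P : Polyvector) : Polyvector := fun I => pderiv ℝ i (P I)

/-- The left derivative with respect to the odd variable `∂_i`: `∂_i ∧ ∂_K ↦ ∂_K` for `i ∉ K`. -/
def leftDeriv (i : Fin 3) (P : Polyvector) : Polyvector := fun K =>
  if i ∈ K then 0 else shuffleSign {i} K • P (insert i K)

/-- The right derivative with respect to the odd variable `∂_i`: `∂_K ∧ ∂_i ↦ ∂_K` for `i ∉ K`. -/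
def rightDeriv (i : Fin 3) (P : Polyvector) : Polyvector := fun K =>
  if i ∈ K then 0 else shuffleSign K {i} • P (insert i K)

/-- The Schouten bracket of polyvector fields, as the odd Poisson bracket in the even variables `x_i`
and the odd variables `∂_i`. It extends the Lie bracket of vector fields, and `[X, f] = X(f)`. -/
def schouten (P Q : Polyvector) : Polyvector :=
  ∑ i : Fin 3,
    (wedge (rightDeriv i P) (coordDeriv i Q) - wedge (coordDeriv i P) (leftDeriv i Q))

theorem schouten_add (P Q R : Polyvector) : schouten P (Q + R) = schouten P Q + schouten P R := by
  have hw : ∀ A B C : Polyvector, wedge A (B + C) = wedge A B + wedge A C := by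
    intro A B C
    funext K
    simp only [wedge, Pi.add_apply, mul_add, smul_add, Finset.sum_add_distrib]
  have hc : ∀ i, coordDeriv i (Q + R) = coordDeriv i Q + coordDeriv i R := by
    intro i
    funext K
    simp [coordDeriv]
  have hl : ∀ i, leftDeriv i (Q + R) = leftDeriv i Q + leftDeriv i R := by
    intro i
    funext K
    simp only [leftDeriv, Pi.add_apply]
    split_ifs <;> simp [smul_add]
  simp only [schouten, ← Finset.sum_add_distrib, hc, hl, hw, add_sub_add_comm]

theorem schouten_smul (P : Polyvector) (c : ℝ) (Q : Polyvector) :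
    schouten P (c • Q) = c • schouten P Q := by
  simp only [schouten, Finset.smul_sum]
  refine Finset.sum_congr rfl fun i _ => ?_
  funext K
  simp only [wedge, coordDeriv, leftDeriv, Pi.smul_apply, Pi.sub_apply, Derivation.map_smul,
    smul_sub, Finset.smul_sum]
  congr 1 <;> refine Finset.sum_congr rfl fun I _ => ?_
  · rw [mul_smul_comm, smul_comm]
  · split_ifs
    · simp
    · rw [smul_comm, mul_smul_comm, smul_comm]

/-- The constant function `1`, as a polyvector field of degree `0`. -/
def unit : Polyvector := Pi.single ∅ 1

/-- The coordinate vector field `∂_i`. -/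
def pd (i : Fin 3) : Polyvector := Pi.single {i} 1

/-- `∂₂₃ = ∂_y ∧ ∂_z`. -/
def pd23 : Polyvector := wedge (pd 1) (pd 2)
/-- `∂₃₁ = ∂_z ∧ ∂_x`. -/
def pd31 : Polyvector := wedge (pd 2) (pd 0)
/-- `∂₁₂ = ∂_x ∧ ∂_y`. -/
def pd12 : Polyvector := wedge (pd 0) (pd 1)
/-- `∂₁₂₃ = ∂_x ∧ ∂_y ∧ ∂_z`. -/
def pd123 : Polyvector := wedge pd12 (pd 2)

/-- `Y₁ = x ∂_x`. -/
def Y1 : Polyvector := (X 0 : FSeries) • pd 0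
/-- `Y₂ = y ∂_y`. -/
def Y2 : Polyvector := (X 1 : FSeries) • pd 1
/-- `Y₃ = z ∂_z`. -/
def Y3 : Polyvector := (X 2 : FSeries) • pd 2
/-- `Y₂₃ = Y₂ ∧ Y₃`. -/
def Y23 : Polyvector := wedge Y2 Y3
/-- `Y₃₁ = Y₃ ∧ Y₁`. -/
def Y31 : Polyvector := wedge Y3 Y1
/-- `Y₁₂ = Y₁ ∧ Y₂`. -/
def Y12 : Polyvector := wedge Y1 Y2
/-- `Y₁₂₃ = Y₁ ∧ Y₂ ∧ Y₃`. -/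
def Y123 : Polyvector := wedge Y12 Y3

end Polyvector

open Polyvector

/-! ### The tensor and its complex -/

/-- `Λ = a yz ∂₂₃ + a xz ∂₃₁ + (b xy + z²) ∂₁₂`. -/
def Lambda4 (a b : ℝ) : Polyvector :=
  (a • (X 1 * X 2 : FSeries)) • pd23 + (a • (X 0 * X 2 : FSeries)) • pd31 +
    (b • (X 0 * X 1 : FSeries) + X 2 ^ 2) • pd12

/-- The Lichnerowicz–Poisson coboundary operator `[Λ, ·]`. -/
def dLambda (a b : ℝ) : Polyvector →ₗ[ℝ] Polyvector where
  toFun := schouten (Lambda4 a b)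
  map_add' := schouten_add _
  map_smul' := schouten_smul _

/-- The cocycles. -/
def cocycles (a b : ℝ) : Submodule ℝ Polyvector := LinearMap.ker (dLambda a b)

/-- The coboundaries. -/
def coboundaries (a b : ℝ) : Submodule ℝ Polyvector := LinearMap.range (dLambda a b)

/-! ### Subquotients -/

section Subquotient

variable {M : Type*} [AddCommGroup M] [Module ℝ M]

/-- The subquotient `Z / (W ∩ Z)` (that is `Z / W`, if `W ≤ Z`). -/
abbrev Subquotient (Z W : Submodule ℝ M) : Type _ := Z ⧸ W.submoduleOf Z

/-- The space of the classes in `Z / W` of the elements of `V` (for `V ≤ Z`). -/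
def classes (Z W V : Submodule ℝ M) : Submodule ℝ (Subquotient Z W) :=
  (V.submoduleOf Z).map (W.submoduleOf Z).mkQ

/-- The spaces `V i` consist of elements of `Z`; the classes of the `V i` make up a direct sum
decomposition `Z / W = ⨁ i, [V i]`, and `N i` is the space of the elements of `V i` whose class
vanishes, so that `[V i] ≅ V i / N i`. -/
def DecomposesModulo (Z W : Submodule ℝ M) {ι : Type} [DecidableEq ι]
    (V N : ι → Submodule ℝ M) : Prop :=
  (∀ i, V i ≤ Z) ∧ (∀ i, V i ⊓ W = N i) ∧ DirectSum.IsInternal fun i => classes Z W (V i)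

end Subquotient

/-- The cohomology space `H(Λ)` (of all cochain degrees together). -/
abbrev Cohomology (a b : ℝ) : Type := Subquotient (cocycles a b) (coboundaries a b)

/-! ### The bigrading, the filtration and the limit of the spectral sequence -/

/-- The exponents `(j₁, j₂, j₃)` of `x^m ∂_I`, read in the numerator `x^j` of its expression
`(x^j / (xyz)) Y_I`. -/
def numExp (I : Finset (Fin 3)) (m : Fin 3 →₀ ℕ) (i : Fin 3) : ℕ := m i + if i ∈ I then 0 else 1

/-- The first degree `r = j₁ + j₂ + c` of `x^m ∂_I`, `c` being the cochain degree. -/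
def rDeg (I : Finset (Fin 3)) (m : Fin 3 →₀ ℕ) : ℕ := numExp I m 0 + numExp I m 1 + I.card

/-- The second degree `s = j₃` of `x^m ∂_I`. -/
def sDeg (I : Finset (Fin 3)) (m : Fin 3 →₀ ℕ) : ℕ := numExp I m 2

/-- The polyvector fields all of whose terms `x^m ∂_I` satisfy `p I m`. -/
def termsIn (p : Finset (Fin 3) → (Fin 3 →₀ ℕ) → Prop) : Submodule ℝ Polyvector where
  carrier := {P | ∀ I m, coeff m (P I) ≠ 0 → p I m}
  zero_mem' := by intro I m h; simp at h
  add_mem' := by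
    intro P Q hP hQ I m h
    by_cases h1 : coeff m (P I) = 0
    · refine hQ I m fun h2 => h ?_
      simp [h1, h2]
    · exact hP I m h1
  smul_mem' := by
    intro c P hP I m h
    refine hP I m fun h1 => h ?_
    simp [h1]

/-- The horizontal filtration `K_p = ⨁_{s ≥ p} K^{rs}`. -/
def filt (p : ℕ) : Submodule ℝ Polyvector := termsIn fun I m => p ≤ sDeg I m

/-- The diagonal grading `K^n = ⨁_{r + s = n} K^{rs}`. -/
def diag (n : ℕ) : Submodule ℝ Polyvector := termsIn fun I m => rDeg I m + sDeg I m = n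

/-- `Z_∞`: the cocycles in `K_p ∩ K^n`. -/
def Zinf (a b : ℝ) (p n : ℕ) : Submodule ℝ Polyvector := cocycles a b ⊓ filt p ⊓ diag n

/-- `B_∞`: the coboundaries in `K_p ∩ K^n`. -/
def Binf (a b : ℝ) (p n : ℕ) : Submodule ℝ Polyvector := coboundaries a b ⊓ filt p ⊓ diag n

/-- The filtration `H_p^n` of the term of degree `n` of the cohomology: the classes of the cocycles in
`K_p ∩ K^n`. -/
def Hfilt (a b : ℝ) (p n : ℕ) : Submodule ℝ (Cohomology a b) :=
  classes (cocycles a b) (coboundaries a b) (Zinf a b p n)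

/-- The spaces `V i` of formal cocycles form a system of representatives of the cohomology space
`H(Λ)`, of the limit `E_∞^{pq} = Z_∞^{pq} / (Z_∞^{p+1,q-1} + B_∞^{pq})` of the spectral sequence, and of
the graded space `G^{pq} = H_p^{p+q} / H_{p+1}^{p+q}` of the filtered space `H(Λ)`: these spaces are the
direct sums of the (isomorphic images of the) corresponding pieces of the `V i`. -/
def IsSystemOfRepresentatives (a b : ℝ) {ι : Type} [DecidableEq ι]
    (V : ι → Submodule ℝ Polyvector) : Prop :=
  DecomposesModulo (cocycles a b) (coboundaries a b) V (fun _ => ⊥) ∧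
  (∀ p q : ℕ,
    DecomposesModulo (Zinf a b p (p + q)) (Zinf a b (p + 1) (p + q) ⊔ Binf a b p (p + q))
      (fun i => V i ⊓ filt p ⊓ diag (p + q)) (fun i => V i ⊓ filt (p + 1) ⊓ diag (p + q))) ∧
  (∀ p q : ℕ,
    DecomposesModulo (Hfilt a b p (p + q)) (Hfilt a b (p + 1) (p + q))
      (fun i => classes (cocycles a b) (coboundaries a b) (V i ⊓ filt p ⊓ diag (p + q)))
      (fun i => classes (cocycles a b) (coboundaries a b) (V i ⊓ filt (p + 1) ⊓ diag (p + q))))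

/-! ### The summands -/

/-- The formal sum `∑_i c_i u_i` of power series, for a sequence `u` such that `u_i` has only terms of
total degree at least `i` (so that the terms of degree `d` come from the indices `i ≤ d`). -/
def formalSum (u : ℕ → FSeries) (c : ℕ → ℝ) : FSeries := fun m =>
  ∑ i ∈ Finset.range (m.degree + 1), c i * coeff m (u i)

/-- The (formal, i.e. completed) sum `⨁_{i ∈ K} ℝ u_i`: all `∑_{i ∈ K} c_i u_i` with real
coefficients. -/
def formalSpan (u : ℕ → FSeries) (K : Set ℕ) : Submodule ℝ FSeries where
  carrier := {f | ∃ c : ℕ → ℝ, (∀ i, i ∉ K → c i = 0) ∧ f = formalSum u c}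
  zero_mem' := by
    refine ⟨0, fun _ _ => rfl, ?_⟩
    funext m
    simp only [formalSum, Pi.zero_apply, zero_mul, Finset.sum_const_zero]
    rfl
  add_mem' := by
    rintro f g ⟨c, hc, rfl⟩ ⟨e, he, rfl⟩
    refine ⟨c + e, fun i hi => by simp [hc i hi, he i hi], ?_⟩
    funext m
    simp only [formalSum, Pi.add_apply, add_mul, Finset.sum_add_distrib]
    rfl
  smul_mem' := by
    rintro t f ⟨c, hc, rfl⟩
    refine ⟨t • c, fun i hi => by simp [hc i hi], ?_⟩
    funext m
    simp only [formalSum, Pi.smul_apply, smul_eq_mul, mul_assoc, ← Finset.mul_sum]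
    rfl

/-- The space `U ω` of all `f ω`, `f ∈ U`, for a space `U` of functions and a polyvector field `ω`. -/
def timesField (U : Submodule ℝ FSeries) (ω : Polyvector) : Submodule ℝ Polyvector :=
  U.map ((LinearMap.toSpanSingleton FSeries Polyvector ω).restrictScalars ℝ)

/-- `Cas(Λ) = ⨁_i ℝ (xy + z²/(2a+b))^{αi} z^{βi}`. -/
def Cas4 (a b : ℝ) (α β : ℕ) : Submodule ℝ FSeries :=
  formalSpan (fun i => (X 0 * X 1 + (1 / (2 * a + b)) • X 2 ^ 2) ^ (α * i) * X 2 ^ (β * i)) Set.univ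

/-- `Cas(Λ_I) = ⨁_i ℝ (xy)^{αi} z^{βi}`. -/
def Cas4I (α β : ℕ) : Submodule ℝ FSeries :=
  formalSpan (fun i => (X 0 * X 1) ^ (α * i) * X 2 ^ (β * i)) Set.univ

/-- The constants `ℝ`. -/
def constSeries : Submodule ℝ FSeries := Submodule.span ℝ {1}

/-- `⨁_{k ∈ K} ℝ t^k` for the coordinate `t` with index `i`. -/
def coordPowers (i : Fin 3) (K : Set ℕ) : Submodule ℝ FSeries := formalSpan (fun k => X i ^ k) K

/-- `ℝ A_α (Y₂₃ + Y₃₁) = ℝ (xy)^α (y ∂₂₃ + x ∂₃₁)`, where `A_α = (xy)^α z⁻¹`. -/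
def accidental2 (α : ℕ) : Submodule ℝ Polyvector :=
  Submodule.span ℝ {((X 0 * X 1) ^ α * X 1 : FSeries) • pd23 + ((X 0 * X 1) ^ α * X 0 : FSeries) • pd31}

/-- `ℝ A_α Y₁₂₃ = ℝ (xy)^{α+1} ∂₁₂₃`, where `A_α = (xy)^α z⁻¹`. -/
def accidental3 (α : ℕ) : Submodule ℝ Polyvector :=
  Submodule.span ℝ {((X 0 * X 1) ^ (α + 1) : FSeries) • pd123}

end

open Polyvector

/-!
In the logarithmic frame `x^κ Y_I`, `κ = (κ₁, κ₂, κ₃)` a triple of integers that are at least `-1`, the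
operator `[Λ, ·]` is the sum of two parts. The quadratic part `a Y₂₃ + a Y₃₁ + b Y₁₂` of `Λ` preserves
`κ` and acts as the exterior product by the linear form
`X_κ = (b κ₂ - a κ₃) Y₁ + (a κ₃ - b κ₁) Y₂ + a (κ₁ - κ₂) Y₃`; the term `z² ∂₁₂` maps `κ` to
`κ + (-1, -1, 2)`. Hence `[Λ, ·]` preserves the weight `(M, D) = (κ₁ + κ₂ + κ₃, κ₁ - κ₂)`, and the
complex is the product of its parts (`block`) of fixed weight, each with finitely many positions `κ`.
Within a weight, the positions are ordered by `κ₂`, and an element is reduced from its leading position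
downwards: where `X_κ` has a nonzero component with a nonnegative exponent (`Regular`), contraction
inverts the exterior product by `X_κ` (`exists_lead_eq`), so that the leading term of a cocycle is
removed by a coboundary (`exists_sub_mem_upTo`). What remains are the few positions that are not regular.

* For `D ≠ 0` there are none, unless `a = b`, when they make up the last four summands
  (`blockRep_offDiagonal`, `blockRep_single`).
* For `D = 0`, the bottom position `κ = (-1, -1, M + 2)` only carries multiples of `z^(M+2) ∂₁₂` and
  `z^(M+3) ∂₁₂₃`. These are cocycles, and they are the whole cohomology unless `X_κ = 0` for some
  `κ = (e, e, M - 2e)` with `e ≥ 0`, a resonance (`blockRep_nonresonant`).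
* At a resonance every leading term is possible. Some of these belong to the cocycles of the theorem,
  among them the Casimir `(xy + z² / (2a + b))^n z^m` and its multiples. The others belong to cochains `W`,
  `W'` obtained from a two-term recursion along the positions below the resonance, the coboundaries of
  which are nonzero multiples of `z^(M+2) ∂₁₂` and `z^(M+3) ∂₁₂₃`; so these two classes disappear
  (`blockRep_resonant`, `blockRep_resonantGens`, and `blockRep_boundary` for the exponent `-1` of `z`).

The resonances are `(αn, αn, βn)` if `b / a = β / α > 0` (`resonance_of_pos`), and otherwise the origin and
the position `(α, α, -1)` if `b / a = -1 / α` (`resonance_of_not_pos`).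

The reductions only increase `κ₃`, hence respect the filtration by the degree `s = κ₃ + 1`. A
representative of a cocycle can therefore be chosen in the same filtration degree as the cocycle, and by
uniqueness of the representatives this gives the limit of the spectral sequence and the graded space of
the cohomology along with the cohomology itself (`isSystemOfRepresentatives_of_blockRep`).
-/

set_option linter.unusedSimpArgs false

noncomputable section

/-! ### The exterior algebra in three variables -/

theorem finset_fin_three_cases (I : Finset (Fin 3)) :
    I = ∅ ∨ I = {0} ∨ I = {1} ∨ I = {2} ∨ I = {0, 1} ∨ I = {0, 2} ∨ I = {1, 2} ∨
      I = {0, 1, 2} := by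
  revert I; decide

theorem shuffleSign_values :
    shuffleSign ∅ ∅ = 1 ∧
    shuffleSign ∅ {0} = 1 ∧
    shuffleSign ∅ {1} = 1 ∧
    shuffleSign ∅ {2} = 1 ∧
    shuffleSign ∅ {0, 1} = 1 ∧
    shuffleSign ∅ {0, 2} = 1 ∧
    shuffleSign ∅ {1, 2} = 1 ∧
    shuffleSign ∅ {0, 1, 2} = 1 ∧
    shuffleSign {0} ∅ = 1 ∧
    shuffleSign {0} {1} = 1 ∧
    shuffleSign {0} {2} = 1 ∧
    shuffleSign {0} {1, 2} = 1 ∧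
    shuffleSign {1} ∅ = 1 ∧
    shuffleSign {1} {0} = -1 ∧
    shuffleSign {1} {2} = 1 ∧
    shuffleSign {1} {0, 2} = -1 ∧
    shuffleSign {2} ∅ = 1 ∧
    shuffleSign {2} {0} = -1 ∧
    shuffleSign {2} {1} = -1 ∧
    shuffleSign {2} {0, 1} = 1 ∧
    shuffleSign {0, 1} ∅ = 1 ∧
    shuffleSign {0, 1} {2} = 1 ∧
    shuffleSign {0, 2} ∅ = 1 ∧
    shuffleSign {0, 2} {1} = -1 ∧
    shuffleSign {1, 2} ∅ = 1 ∧
    shuffleSign {1, 2} {0} = 1 ∧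
    shuffleSign {0, 1, 2} ∅ = 1 := by
  decide

theorem wedge_empty (P Q : Polyvector) :
    wedge P Q ∅ = P ∅ * Q ∅ := by
  simp [wedge, shuffleSign]

theorem wedge_0 (P Q : Polyvector) :
    wedge P Q {0} = P ∅ * Q {0} + P {0} * Q ∅ := by
  rw [wedge, show ({0} : Finset (Fin 3)).powerset = {∅, {0}} by decide]
  iterate 1 rw [Finset.sum_insert (by decide)]
  rw [Finset.sum_singleton]
  rw [show ({0} : Finset (Fin 3)) \ ∅ = {0} by decide]
  rw [show ({0} : Finset (Fin 3)) \ {0} = ∅ by decide]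
  simp only [shuffleSign_values, one_smul]

theorem wedge_1 (P Q : Polyvector) :
    wedge P Q {1} = P ∅ * Q {1} + P {1} * Q ∅ := by
  rw [wedge, show ({1} : Finset (Fin 3)).powerset = {∅, {1}} by decide]
  iterate 1 rw [Finset.sum_insert (by decide)]
  rw [Finset.sum_singleton]
  rw [show ({1} : Finset (Fin 3)) \ ∅ = {1} by decide]
  rw [show ({1} : Finset (Fin 3)) \ {1} = ∅ by decide]
  simp only [shuffleSign_values, one_smul]

theorem wedge_2 (P Q : Polyvector) :
    wedge P Q {2} = P ∅ * Q {2} + P {2} * Q ∅ := by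
  rw [wedge, show ({2} : Finset (Fin 3)).powerset = {∅, {2}} by decide]
  iterate 1 rw [Finset.sum_insert (by decide)]
  rw [Finset.sum_singleton]
  rw [show ({2} : Finset (Fin 3)) \ ∅ = {2} by decide]
  rw [show ({2} : Finset (Fin 3)) \ {2} = ∅ by decide]
  simp only [shuffleSign_values, one_smul]

theorem wedge_01 (P Q : Polyvector) :
    wedge P Q {0, 1} = P ∅ * Q {0, 1} + P {0} * Q {1} - P {1} * Q {0} + P {0, 1} * Q ∅ := by
  rw [wedge, show ({0, 1} : Finset (Fin 3)).powerset = {∅, {0}, {1}, {0, 1}} by decide]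
  iterate 3 rw [Finset.sum_insert (by decide)]
  rw [Finset.sum_singleton]
  rw [show ({0, 1} : Finset (Fin 3)) \ ∅ = {0, 1} by decide]
  rw [show ({0, 1} : Finset (Fin 3)) \ {0} = {1} by decide]
  rw [show ({0, 1} : Finset (Fin 3)) \ {1} = {0} by decide]
  rw [show ({0, 1} : Finset (Fin 3)) \ {0, 1} = ∅ by decide]
  simp only [shuffleSign_values, one_smul, neg_smul]
  ring

theorem wedge_02 (P Q : Polyvector) :
    wedge P Q {0, 2} = P ∅ * Q {0, 2} + P {0} * Q {2} - P {2} * Q {0} + P {0, 2} * Q ∅ := by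
  rw [wedge, show ({0, 2} : Finset (Fin 3)).powerset = {∅, {0}, {2}, {0, 2}} by decide]
  iterate 3 rw [Finset.sum_insert (by decide)]
  rw [Finset.sum_singleton]
  rw [show ({0, 2} : Finset (Fin 3)) \ ∅ = {0, 2} by decide]
  rw [show ({0, 2} : Finset (Fin 3)) \ {0} = {2} by decide]
  rw [show ({0, 2} : Finset (Fin 3)) \ {2} = {0} by decide]
  rw [show ({0, 2} : Finset (Fin 3)) \ {0, 2} = ∅ by decide]
  simp only [shuffleSign_values, one_smul, neg_smul]
  ring

theorem wedge_12 (P Q : Polyvector) :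
    wedge P Q {1, 2} = P ∅ * Q {1, 2} + P {1} * Q {2} - P {2} * Q {1} + P {1, 2} * Q ∅ := by
  rw [wedge, show ({1, 2} : Finset (Fin 3)).powerset = {∅, {1}, {2}, {1, 2}} by decide]
  iterate 3 rw [Finset.sum_insert (by decide)]
  rw [Finset.sum_singleton]
  rw [show ({1, 2} : Finset (Fin 3)) \ ∅ = {1, 2} by decide]
  rw [show ({1, 2} : Finset (Fin 3)) \ {1} = {2} by decide]
  rw [show ({1, 2} : Finset (Fin 3)) \ {2} = {1} by decide]
  rw [show ({1, 2} : Finset (Fin 3)) \ {1, 2} = ∅ by decide]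
  simp only [shuffleSign_values, one_smul, neg_smul]
  ring

theorem wedge_012 (P Q : Polyvector) :
    wedge P Q {0, 1, 2} = P ∅ * Q {0, 1, 2} + P {0} * Q {1, 2} - P {1} * Q {0, 2} +
      P {2} * Q {0, 1} + P {0, 1} * Q {2} - P {0, 2} * Q {1} + P {1, 2} * Q {0} +
      P {0, 1, 2} * Q ∅ := by
  rw [wedge, show ({0, 1, 2} : Finset (Fin 3)).powerset =
    {∅, {0}, {1}, {2}, {0, 1}, {0, 2}, {1, 2}, {0, 1, 2}} by decide]
  iterate 7 rw [Finset.sum_insert (by decide)]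
  rw [Finset.sum_singleton]
  rw [show ({0, 1, 2} : Finset (Fin 3)) \ ∅ = {0, 1, 2} by decide]
  rw [show ({0, 1, 2} : Finset (Fin 3)) \ {0} = {1, 2} by decide]
  rw [show ({0, 1, 2} : Finset (Fin 3)) \ {1} = {0, 2} by decide]
  rw [show ({0, 1, 2} : Finset (Fin 3)) \ {2} = {0, 1} by decide]
  rw [show ({0, 1, 2} : Finset (Fin 3)) \ {0, 1} = {2} by decide]
  rw [show ({0, 1, 2} : Finset (Fin 3)) \ {0, 2} = {1} by decide]
  rw [show ({0, 1, 2} : Finset (Fin 3)) \ {1, 2} = {0} by decide]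
  rw [show ({0, 1, 2} : Finset (Fin 3)) \ {0, 1, 2} = ∅ by decide]
  simp only [shuffleSign_values, one_smul, neg_smul]
  ring

theorem Lambda4_values (a b : ℝ) :
    Lambda4 a b ∅ = 0 ∧ Lambda4 a b {0} = 0 ∧ Lambda4 a b {1} = 0 ∧ Lambda4 a b {2} = 0 ∧
    Lambda4 a b {0, 1} = b • (X 0 * X 1 : FSeries) + X 2 ^ 2 ∧
    Lambda4 a b {0, 2} = -(a • (X 0 * X 2 : FSeries)) ∧
    Lambda4 a b {1, 2} = a • (X 1 * X 2 : FSeries) ∧ Lambda4 a b {0, 1, 2} = 0 := by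
  simp (decide := true) [Lambda4, pd23, pd31, pd12, pd, wedge_empty, wedge_0, wedge_1, wedge_2,
    wedge_01, wedge_02, wedge_12, wedge_012]

theorem insert_values : insert 0 ∅ = ({0} : Finset (Fin 3)) ∧ insert 1 ∅ = ({1} : Finset (Fin 3)) ∧
    insert 2 ∅ = ({2} : Finset (Fin 3)) ∧
    insert 1 {0} = ({0, 1} : Finset (Fin 3)) ∧ insert 2 {0} = ({0, 2} : Finset (Fin 3)) ∧
    insert 2 {1} = ({1, 2} : Finset (Fin 3)) ∧ insert 1 {0, 2} = ({0, 1, 2} : Finset (Fin 3)) ∧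
    insert 2 {0, 1} = ({0, 1, 2} : Finset (Fin 3)) := by
  decide

/-! ### The coboundary operator in coordinates -/

theorem dLambda_apply_empty (a b : ℝ) (P : Polyvector) : dLambda a b P ∅ =
      0 := by
  simp (decide := true) [dLambda, schouten, Fin.sum_univ_three, leftDeriv,
    rightDeriv, coordDeriv, wedge_empty, Lambda4_values, shuffleSign_values]

theorem dLambda_apply_0 (a b : ℝ) (P : Polyvector) : dLambda a b P {0} =
      b • (X 0 * (X 1 * pderiv ℝ 1 (P ∅))) + X 2 * (X 2 * pderiv ℝ 1 (P ∅)) -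
      a • (X 0 * (X 2 * pderiv ℝ 2 (P ∅))) := by
  simp (decide := true) [dLambda, schouten, Fin.sum_univ_three, leftDeriv,
    rightDeriv, coordDeriv, wedge_0, Lambda4_values, shuffleSign_values, insert_values,
    Algebra.smul_def]
  ring

theorem dLambda_apply_1 (a b : ℝ) (P : Polyvector) : dLambda a b P {1} =
      a • (X 1 * (X 2 * pderiv ℝ 2 (P ∅))) - b • (X 0 * (X 1 * pderiv ℝ 0 (P ∅))) -
      X 2 * (X 2 * pderiv ℝ 0 (P ∅)) := by
  simp (decide := true) [dLambda, schouten, Fin.sum_univ_three, leftDeriv,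
    rightDeriv, coordDeriv, wedge_1, Lambda4_values, shuffleSign_values, insert_values,
    Algebra.smul_def]
  ring

theorem dLambda_apply_2 (a b : ℝ) (P : Polyvector) : dLambda a b P {2} =
      a • (X 0 * (X 2 * pderiv ℝ 0 (P ∅))) - a • (X 1 * (X 2 * pderiv ℝ 1 (P ∅))) := by
  simp (decide := true) [dLambda, schouten, Fin.sum_univ_three, leftDeriv,
    rightDeriv, coordDeriv, wedge_2, Lambda4_values, shuffleSign_values,
    Algebra.smul_def]
  ring

theorem dLambda_apply_01 (a b : ℝ) (P : Polyvector) : dLambda a b P {0, 1} =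
      b • (X 0 * (X 1 * pderiv ℝ 0 (P {0}))) + X 2 * (X 2 * pderiv ℝ 0 (P {0})) +
      b • (X 0 * (X 1 * pderiv ℝ 1 (P {1}))) + X 2 * (X 2 * pderiv ℝ 1 (P {1})) -
      a • (X 0 * (X 2 * pderiv ℝ 2 (P {1}))) - a • (X 1 * (X 2 * pderiv ℝ 2 (P {0}))) -
      b • (X 1 * P {0}) - b • (X 0 * P {1}) - X 2 * P {2} - X 2 * P {2} := by
  simp (decide := true) [dLambda, schouten, Fin.sum_univ_three, leftDeriv,
    rightDeriv, coordDeriv, wedge_01, Lambda4_values, shuffleSign_values, insert_values,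
    Algebra.smul_def, Derivation.leibniz, Derivation.leibniz_pow]
  ring

theorem dLambda_apply_02 (a b : ℝ) (P : Polyvector) : dLambda a b P {0, 2} =
      a • (X 0 * P {2}) + a • (X 2 * P {0}) + a • (X 1 * (X 2 * pderiv ℝ 1 (P {0}))) +
      b • (X 0 * (X 1 * pderiv ℝ 1 (P {2}))) + X 2 * (X 2 * pderiv ℝ 1 (P {2})) -
      a • (X 0 * (X 2 * pderiv ℝ 0 (P {0}))) - a • (X 0 * (X 2 * pderiv ℝ 2 (P {2}))) := by
  simp (decide := true) [dLambda, schouten, Fin.sum_univ_three, leftDeriv,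
    rightDeriv, coordDeriv, wedge_02, Lambda4_values, shuffleSign_values, insert_values,
    Algebra.smul_def, Derivation.leibniz]
  ring

theorem dLambda_apply_12 (a b : ℝ) (P : Polyvector) : dLambda a b P {1, 2} =
      a • (X 1 * (X 2 * pderiv ℝ 1 (P {1}))) + a • (X 1 * (X 2 * pderiv ℝ 2 (P {2}))) -
      a • (X 0 * (X 2 * pderiv ℝ 0 (P {1}))) - a • (X 2 * P {1}) - a • (X 1 * P {2}) -
      b • (X 0 * (X 1 * pderiv ℝ 0 (P {2}))) - X 2 * (X 2 * pderiv ℝ 0 (P {2})) := by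
  simp (decide := true) [dLambda, schouten, Fin.sum_univ_three, leftDeriv,
    rightDeriv, coordDeriv, wedge_12, Lambda4_values, shuffleSign_values, insert_values,
    Algebra.smul_def, Derivation.leibniz]
  ring

theorem dLambda_apply_012 (a b : ℝ) (P : Polyvector) : dLambda a b P {0, 1, 2} =
      a • (X 0 * (X 2 * pderiv ℝ 0 (P {0, 1}))) + b • (X 0 * (X 1 * pderiv ℝ 0 (P {0, 2}))) +
      X 2 * (X 2 * pderiv ℝ 0 (P {0, 2})) + b • (X 0 * (X 1 * pderiv ℝ 1 (P {1, 2}))) +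
      X 2 * (X 2 * pderiv ℝ 1 (P {1, 2})) + a • (X 0 * P {1, 2}) + a • (X 1 * P {0, 2}) -
      a • (X 0 * (X 2 * pderiv ℝ 2 (P {1, 2}))) -
      a • (X 1 * (X 2 * pderiv ℝ 1 (P {0, 1}))) -
      a • (X 1 * (X 2 * pderiv ℝ 2 (P {0, 2}))) - b • (X 0 * P {1, 2}) -
      b • (X 1 * P {0, 2}) := by
  simp (decide := true) [dLambda, schouten, Fin.sum_univ_three, leftDeriv,
    rightDeriv, coordDeriv, wedge_012, Lambda4_values, shuffleSign_values, insert_values,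
    Algebra.smul_def, Derivation.leibniz, Derivation.leibniz_pow]
  ring

/-! ### Coefficients with integer exponents -/

/-- The exponent of `x^i y^j z^k`. -/
def expo (i j k : ℕ) : Fin 3 →₀ ℕ := Finsupp.equivFunOnFinite.symm ![i, j, k]

theorem expo_eq (m : Fin 3 →₀ ℕ) : expo (m 0) (m 1) (m 2) = m := by
  ext i; fin_cases i <;> rfl

theorem expo_apply (i j k : ℕ) : expo i j k 0 = i ∧ expo i j k 1 = j ∧ expo i j k 2 = k :=
  ⟨rfl, rfl, rfl⟩

theorem expo_add_single (i j k : ℕ) :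
    expo i j k + Finsupp.single 0 1 = expo (i + 1) j k ∧
    expo i j k + Finsupp.single 1 1 = expo i (j + 1) k ∧
    expo i j k + Finsupp.single 2 1 = expo i j (k + 1) := by
  refine ⟨?_, ?_, ?_⟩ <;> ext s <;> fin_cases s <;> simp [expo]

/-- The coefficient of `x^i y^j z^k` for integers `i, j, k`: it vanishes if an exponent is negative.
With this convention, the rules for products and derivatives hold for all integers. -/
def cf (i j k : ℤ) : FSeries →ₗ[ℝ] ℝ :=
  if 0 ≤ i ∧ 0 ≤ j ∧ 0 ≤ k then coeff (expo i.toNat j.toNat k.toNat) else 0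

theorem cf_natCast (i j k : ℕ) (f : FSeries) : cf i j k f = coeff (expo i j k) f := by
  simp [cf]

theorem cf_eq_coeff (m : Fin 3 →₀ ℕ) (f : FSeries) : cf (m 0) (m 1) (m 2) f = coeff m f := by
  rw [cf_natCast, expo_eq]

theorem nonneg_of_cf_ne_zero {i j k : ℤ} {f : FSeries} (h : cf i j k f ≠ 0) :
    0 ≤ i ∧ 0 ≤ j ∧ 0 ≤ k := by
  by_contra h1
  simp [cf, h1] at h

theorem cf_eq_zero {i j k : ℤ} {f : FSeries} (h : i < 0 ∨ j < 0 ∨ k < 0) : cf i j k f = 0 := by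
  by_contra h1
  have := nonneg_of_cf_ne_zero h1
  omega

theorem ext_of_cf {f g : FSeries} (h : ∀ i j k, cf i j k f = cf i j k g) : f = g := by
  ext m
  rw [← cf_eq_coeff, ← cf_eq_coeff, h]

theorem coeff_X_mul_of_eq_zero {s : Fin 3} {m : Fin 3 →₀ ℕ} (h : m s = 0) (f : FSeries) :
    coeff m (X s * f) = 0 := by
  rw [X, coeff_monomial_mul, if_neg]
  intro h1
  have := h1 s
  simp [h] at this

theorem cf_X_mul (s : Fin 3) (i j k : ℤ) (f : FSeries) : cf i j k (X s * f) =
    cf (i - if s = 0 then 1 else 0) (j - if s = 1 then 1 else 0) (k - if s = 2 then 1 else 0) f := by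
  by_cases h : 0 ≤ i ∧ 0 ≤ j ∧ 0 ≤ k
  · obtain ⟨hi, hj, hk⟩ := h
    lift i to ℕ using hi
    lift j to ℕ using hj
    lift k to ℕ using hk
    have key : ∀ m : Fin 3 →₀ ℕ, coeff (m + Finsupp.single s 1) (X s * f) = coeff m f := by
      intro m
      rw [add_comm, X, coeff_add_monomial_mul, one_mul]
    fin_cases s
    · rcases i with _ | i
      · rw [cf_natCast, coeff_X_mul_of_eq_zero rfl, cf_eq_zero (by simp)]
      · rw [cf_natCast, ← (expo_add_single i j k).1]
        simpa [← cf_natCast] using key (expo i j k)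
    · rcases j with _ | j
      · rw [cf_natCast, coeff_X_mul_of_eq_zero rfl, cf_eq_zero (by simp)]
      · rw [cf_natCast, ← (expo_add_single i j k).2.1]
        simpa [← cf_natCast] using key (expo i j k)
    · rcases k with _ | k
      · rw [cf_natCast, coeff_X_mul_of_eq_zero rfl, cf_eq_zero (by simp)]
      · rw [cf_natCast, ← (expo_add_single i j k).2.2]
        simpa [← cf_natCast] using key (expo i j k)
  · rw [cf_eq_zero (by omega), cf_eq_zero]
    split_ifs <;> omega

theorem cf_X0_mul (i j k : ℤ) (f : FSeries) : cf i j k (X 0 * f) = cf (i - 1) j k f := by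
  simp [cf_X_mul]

theorem cf_X1_mul (i j k : ℤ) (f : FSeries) : cf i j k (X 1 * f) = cf i (j - 1) k f := by
  simp [cf_X_mul]

theorem cf_X2_mul (i j k : ℤ) (f : FSeries) : cf i j k (X 2 * f) = cf i j (k - 1) f := by
  simp [cf_X_mul]

theorem cf_pderiv0 (i j k : ℤ) (f : FSeries) :
    cf i j k (pderiv ℝ 0 f) = (i + 1) * cf (i + 1) j k f := by
  by_cases h : 0 ≤ i ∧ 0 ≤ j ∧ 0 ≤ k
  · obtain ⟨hi, hj, hk⟩ := h
    lift i to ℕ using hi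
    lift j to ℕ using hj
    lift k to ℕ using hk
    rw [cf_natCast, coeff_pderiv, (expo_add_single i j k).1, ← cf_natCast, mul_comm]
    simp [expo_apply]
  · rw [cf_eq_zero (by omega)]
    rcases eq_or_ne i (-1) with rfl | h1
    · simp
    · rw [cf_eq_zero (by omega), mul_zero]

theorem cf_pderiv1 (i j k : ℤ) (f : FSeries) :
    cf i j k (pderiv ℝ 1 f) = (j + 1) * cf i (j + 1) k f := by
  by_cases h : 0 ≤ i ∧ 0 ≤ j ∧ 0 ≤ k
  · obtain ⟨hi, hj, hk⟩ := h
    lift i to ℕ using hi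
    lift j to ℕ using hj
    lift k to ℕ using hk
    rw [cf_natCast, coeff_pderiv, (expo_add_single i j k).2.1, ← cf_natCast, mul_comm]
    simp [expo_apply]
  · rw [cf_eq_zero (by omega)]
    rcases eq_or_ne j (-1) with rfl | h1
    · simp
    · rw [cf_eq_zero (by omega), mul_zero]

theorem cf_pderiv2 (i j k : ℤ) (f : FSeries) :
    cf i j k (pderiv ℝ 2 f) = (k + 1) * cf i j (k + 1) f := by
  by_cases h : 0 ≤ i ∧ 0 ≤ j ∧ 0 ≤ k
  · obtain ⟨hi, hj, hk⟩ := h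
    lift i to ℕ using hi
    lift j to ℕ using hj
    lift k to ℕ using hk
    rw [cf_natCast, coeff_pderiv, (expo_add_single i j k).2.2, ← cf_natCast, mul_comm]
    simp [expo_apply]
  · rw [cf_eq_zero (by omega)]
    rcases eq_or_ne k (-1) with rfl | h1
    · simp
    · rw [cf_eq_zero (by omega), mul_zero]

/-! ### Logarithmic coefficients -/

/-- The indicator function of `I`, with integer values. -/
def ind (I : Finset (Fin 3)) (s : Fin 3) : ℤ := if s ∈ I then 1 else 0

/-- The logarithmic coefficients of a polyvector field: `lc i j k I P` is the coefficient of
`x^i y^j z^k Y_I`, for integers `i, j, k ≥ -1`. -/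
def lc (i j k : ℤ) (I : Finset (Fin 3)) : Polyvector →ₗ[ℝ] ℝ :=
  (cf (i + ind I 0) (j + ind I 1) (k + ind I 2)).comp (LinearMap.proj I)

theorem lc_apply (i j k : ℤ) (I : Finset (Fin 3)) (P : Polyvector) :
    lc i j k I P = cf (i + ind I 0) (j + ind I 1) (k + ind I 2) (P I) := rfl

theorem ext_of_lc {P Q : Polyvector} (h : ∀ i j k I, lc i j k I P = lc i j k I Q) : P = Q := by
  funext I
  refine ext_of_cf fun i j k => ?_
  simpa [lc_apply] using h (i - ind I 0) (j - ind I 1) (k - ind I 2) I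

theorem ind_values :
    ind ∅ 0 = 0 ∧ ind ∅ 1 = 0 ∧ ind ∅ 2 = 0 ∧ ind {0} 0 = 1 ∧ ind {0} 1 = 0 ∧ ind {0} 2 = 0 ∧
    ind {1} 0 = 0 ∧ ind {1} 1 = 1 ∧ ind {1} 2 = 0 ∧ ind {2} 0 = 0 ∧ ind {2} 1 = 0 ∧ ind {2} 2 = 1 ∧
    ind {0, 1} 0 = 1 ∧ ind {0, 1} 1 = 1 ∧ ind {0, 1} 2 = 0 ∧
    ind {0, 2} 0 = 1 ∧ ind {0, 2} 1 = 0 ∧ ind {0, 2} 2 = 1 ∧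
    ind {1, 2} 0 = 0 ∧ ind {1, 2} 1 = 1 ∧ ind {1, 2} 2 = 1 ∧
    ind {0, 1, 2} 0 = 1 ∧ ind {0, 1, 2} 1 = 1 ∧ ind {0, 1, 2} 2 = 1 := by
  decide

/- The formulas for the coefficients of `[Λ, P]` have two parts: at the exponent `κ = (i, j, k)`, the
exterior product of the coefficient of `P` by `X_κ = (b j - a k) Y₁ + (a k - b i) Y₂ + a (i - j) Y₃`,
which comes from the quadratic part `a Y₂₃ + a Y₃₁ + b Y₁₂` of `Λ`, and a contribution of the
coefficient of `P` at `κ + (1, 1, -2)`, which comes from the remaining term `z² ∂₁₂`. -/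
theorem lc_dLambda_empty (a b : ℝ) (P : Polyvector) (i j k : ℤ) :
    lc i j k ∅ (dLambda a b P) = 0 := by
  rw [lc_apply, dLambda_apply_empty, map_zero]

theorem lc_dLambda_0 (a b : ℝ) (P : Polyvector) (i j k : ℤ) :
    lc i j k {0} (dLambda a b P) =
      (b * j - a * k) * lc i j k ∅ P + (j + 1) * lc (i + 1) (j + 1) (k - 2) ∅ P := by
  simp only [lc_apply, dLambda_apply_0, ind_values, map_add, map_sub, map_smul, cf_X0_mul,
    cf_X1_mul, cf_X2_mul, cf_pderiv0, cf_pderiv1, cf_pderiv2, smul_eq_mul, add_zero, sub_add_cancel]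
  push_cast
  ring_nf

theorem lc_dLambda_1 (a b : ℝ) (P : Polyvector) (i j k : ℤ) :
    lc i j k {1} (dLambda a b P) =
      (a * k - b * i) * lc i j k ∅ P - (i + 1) * lc (i + 1) (j + 1) (k - 2) ∅ P := by
  simp only [lc_apply, dLambda_apply_1, ind_values, map_add, map_sub, map_smul, cf_X0_mul,
    cf_X1_mul, cf_X2_mul, cf_pderiv0, cf_pderiv1, cf_pderiv2, smul_eq_mul, add_zero, sub_add_cancel]
  push_cast
  ring_nf

theorem lc_dLambda_2 (a b : ℝ) (P : Polyvector) (i j k : ℤ) :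
    lc i j k {2} (dLambda a b P) =
      (a * (i - j)) * lc i j k ∅ P := by
  simp only [lc_apply, dLambda_apply_2, ind_values, map_add, map_sub, map_smul, cf_X0_mul,
    cf_X1_mul, cf_X2_mul, cf_pderiv0, cf_pderiv1, cf_pderiv2, smul_eq_mul, add_zero, sub_add_cancel]
  push_cast
  ring_nf

theorem lc_dLambda_01 (a b : ℝ) (P : Polyvector) (i j k : ℤ) :
    lc i j k {0, 1} (dLambda a b P) =
      (b * j - a * k) * lc i j k {1} P - (a * k - b * i) * lc i j k {0} P +
      ((j + 2) * lc (i + 1) (j + 1) (k - 2) {1} P + (i + 2) * lc (i + 1) (j + 1) (k - 2) {0} P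
        - 2 * lc (i + 1) (j + 1) (k - 2) {2} P) := by
  simp only [lc_apply, dLambda_apply_01, ind_values, map_add, map_sub, map_smul, cf_X0_mul,
    cf_X1_mul, cf_X2_mul, cf_pderiv0, cf_pderiv1, cf_pderiv2, smul_eq_mul, add_zero, sub_add_cancel]
  push_cast
  ring_nf

theorem lc_dLambda_02 (a b : ℝ) (P : Polyvector) (i j k : ℤ) :
    lc i j k {0, 2} (dLambda a b P) =
      (b * j - a * k) * lc i j k {2} P - (a * (i - j)) * lc i j k {0} P +
      (j + 1) * lc (i + 1) (j + 1) (k - 2) {2} P := by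
  simp only [lc_apply, dLambda_apply_02, ind_values, map_add, map_sub, map_smul, cf_X0_mul,
    cf_X1_mul, cf_X2_mul, cf_pderiv0, cf_pderiv1, cf_pderiv2, smul_eq_mul, add_zero, sub_add_cancel]
  push_cast
  ring_nf

theorem lc_dLambda_12 (a b : ℝ) (P : Polyvector) (i j k : ℤ) :
    lc i j k {1, 2} (dLambda a b P) =
      (a * k - b * i) * lc i j k {2} P - (a * (i - j)) * lc i j k {1} P -
      (i + 1) * lc (i + 1) (j + 1) (k - 2) {2} P := by
  simp only [lc_apply, dLambda_apply_12, ind_values, map_add, map_sub, map_smul, cf_X0_mul,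
    cf_X1_mul, cf_X2_mul, cf_pderiv0, cf_pderiv1, cf_pderiv2, smul_eq_mul, add_zero, sub_add_cancel]
  push_cast
  ring_nf

theorem lc_dLambda_012 (a b : ℝ) (P : Polyvector) (i j k : ℤ) :
    lc i j k {0, 1, 2} (dLambda a b P) =
      (b * j - a * k) * lc i j k {1, 2} P - (a * k - b * i) * lc i j k {0, 2} P +
      (a * (i - j)) * lc i j k {0, 1} P + ((j + 2) * lc (i + 1) (j + 1) (k - 2) {1, 2} P +
        (i + 2) * lc (i + 1) (j + 1) (k - 2) {0, 2} P) := by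
  simp only [lc_apply, dLambda_apply_012, ind_values, map_add, map_sub, map_smul, cf_X0_mul,
    cf_X1_mul, cf_X2_mul, cf_pderiv0, cf_pderiv1, cf_pderiv2, smul_eq_mul, add_zero, sub_add_cancel]
  push_cast
  ring_nf

theorem dLambda_dLambda (a b : ℝ) (P : Polyvector) : dLambda a b (dLambda a b P) = 0 := by
  refine ext_of_lc fun i j k I => ?_
  rcases finset_fin_three_cases I with rfl | rfl | rfl | rfl | rfl | rfl | rfl | rfl <;>
  simp only [lc_dLambda_empty, lc_dLambda_0, lc_dLambda_1, lc_dLambda_2, lc_dLambda_01,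
    lc_dLambda_02, lc_dLambda_12, lc_dLambda_012, map_zero] <;>
  push_cast <;> ring

/-! ### Gradings by the logarithmic terms -/

/-- The indices `i, j, k, I` for which `x^i y^j z^k Y_I` has no negative exponent. -/
def Adm (i j k : ℤ) (I : Finset (Fin 3)) : Prop :=
  0 ≤ i + ind I 0 ∧ 0 ≤ j + ind I 1 ∧ 0 ≤ k + ind I 2

theorem adm_of_lc_ne_zero {i j k : ℤ} {I : Finset (Fin 3)} {P : Polyvector}
    (h : lc i j k I P ≠ 0) : Adm i j k I :=
  nonneg_of_cf_ne_zero h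

theorem ind_le_one (I : Finset (Fin 3)) (s : Fin 3) : ind I s ≤ 1 := by
  unfold ind; split_ifs <;> simp

theorem ind_nonneg (I : Finset (Fin 3)) (s : Fin 3) : 0 ≤ ind I s := by
  unfold ind; split_ifs <;> simp

theorem Adm.neg_one_le {i j k : ℤ} {I : Finset (Fin 3)} (h : Adm i j k I) :
    -1 ≤ i ∧ -1 ≤ j ∧ -1 ≤ k := by
  obtain ⟨h0, h1, h2⟩ := h
  have := ind_le_one I 0
  have := ind_le_one I 1
  have := ind_le_one I 2
  omega

/-- The polyvector field with the given logarithmic coefficients. -/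
def ofLc (F : ℤ → ℤ → ℤ → Finset (Fin 3) → ℝ) : Polyvector := fun I m =>
  F (m 0 - ind I 0) (m 1 - ind I 1) (m 2 - ind I 2) I

open Classical in
theorem lc_ofLc (F : ℤ → ℤ → ℤ → Finset (Fin 3) → ℝ) (i j k : ℤ) (I : Finset (Fin 3)) :
    lc i j k I (ofLc F) = if Adm i j k I then F i j k I else 0 := by
  split_ifs with h
  · obtain ⟨h0, h1, h2⟩ := h
    rw [lc_apply]
    obtain ⟨n0, e0⟩ := Int.eq_ofNat_of_zero_le h0
    obtain ⟨n1, e1⟩ := Int.eq_ofNat_of_zero_le h1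
    obtain ⟨n2, e2⟩ := Int.eq_ofNat_of_zero_le h2
    rw [e0, e1, e2, cf_natCast]
    change F (n0 - ind I 0) (n1 - ind I 1) (n2 - ind I 2) I = _
    rw [← e0, ← e1, ← e2]
    simp
  · by_contra h1
    exact h (adm_of_lc_ne_zero h1)

theorem lc_ofLc_of_adm {F : ℤ → ℤ → ℤ → Finset (Fin 3) → ℝ}
    (hF : ∀ i j k I, F i j k I ≠ 0 → Adm i j k I) (i j k : ℤ) (I : Finset (Fin 3)) :
    lc i j k I (ofLc F) = F i j k I := by
  classical
  rw [lc_ofLc]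
  split_ifs with h
  · rfl
  · by_contra h1
    exact h (hF _ _ _ _ (Ne.symm h1))

/-- The polyvector fields whose terms `x^i y^j z^k Y_I` all satisfy `S`. -/
def lcIn (S : ℤ → ℤ → ℤ → Finset (Fin 3) → Prop) : Submodule ℝ Polyvector where
  carrier := {P | ∀ i j k I, lc i j k I P ≠ 0 → S i j k I}
  zero_mem' := by intro i j k I h; simp at h
  add_mem' := by
    intro P Q hP hQ i j k I h
    by_cases h1 : lc i j k I P = 0
    · refine hQ i j k I fun h2 => h ?_
      simp [h1, h2]
    · exact hP i j k I h1
  smul_mem' := by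
    intro c P hP i j k I h
    refine hP i j k I fun h1 => h ?_
    simp [h1]

theorem lc_eq_zero_of_mem {S : ℤ → ℤ → ℤ → Finset (Fin 3) → Prop} {P : Polyvector}
    (h : P ∈ lcIn S) {i j k : ℤ} {I : Finset (Fin 3)} (hS : ¬ S i j k I) : lc i j k I P = 0 := by
  by_contra h1
  exact hS (h _ _ _ _ h1)

theorem termsIn_eq_lcIn {p : Finset (Fin 3) → (Fin 3 →₀ ℕ) → Prop}
    {S : ℤ → ℤ → ℤ → Finset (Fin 3) → Prop}
    (h : ∀ I m, p I m ↔ S (m 0 - ind I 0) (m 1 - ind I 1) (m 2 - ind I 2) I) :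
    termsIn p = lcIn S := by
  ext P
  constructor
  · intro hP i j k I h1
    obtain ⟨h0', h1', h2'⟩ := adm_of_lc_ne_zero h1
    obtain ⟨n0, e0⟩ := Int.eq_ofNat_of_zero_le h0'
    obtain ⟨n1, e1⟩ := Int.eq_ofNat_of_zero_le h1'
    obtain ⟨n2, e2⟩ := Int.eq_ofNat_of_zero_le h2'
    rw [lc_apply, e0, e1, e2, cf_natCast] at h1
    have h3 := (h _ _).1 (hP _ _ h1)
    simp only [expo_apply, ← e0, ← e1, ← e2] at h3
    simpa using h3
  · intro hP I m h1
    refine (h I m).2 (hP _ _ _ _ ?_)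
    rw [lc_apply]
    simpa [cf_eq_coeff] using h1

theorem numExp_eq (I : Finset (Fin 3)) (m : Fin 3 →₀ ℕ) (s : Fin 3) :
    (numExp I m s : ℤ) = m s - ind I s + 1 := by
  unfold numExp ind
  split_ifs <;> simp

theorem filt_eq (p : ℕ) : filt p = lcIn fun _ _ k _ => (p : ℤ) ≤ k + 1 := by
  refine termsIn_eq_lcIn fun I m => ?_
  rw [← Int.ofNat_le, sDeg, numExp_eq]

theorem diag_eq (n : ℕ) : diag n = lcIn fun i j k I => i + j + k + 3 + I.card = n := by
  refine termsIn_eq_lcIn fun I m => ?_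
  rw [← Int.natCast_inj, rDeg, sDeg]
  push_cast
  simp only [numExp_eq]
  constructor <;> intro h <;> linarith

open Classical in
/-- The part of a polyvector field that consists of its terms `x^i y^j z^k Y_I` with `S i j k I`. -/
def restrict (S : ℤ → ℤ → ℤ → Finset (Fin 3) → Prop) : Polyvector →ₗ[ℝ] Polyvector where
  toFun P := ofLc fun i j k I => if S i j k I then lc i j k I P else 0
  map_add' P Q := by
    refine ext_of_lc fun i j k I => ?_
    simp only [lc_ofLc, map_add]
    split_ifs <;> simp
  map_smul' c P := by
    refine ext_of_lc fun i j k I => ?_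
    simp only [lc_ofLc, map_smul]
    split_ifs <;> simp

open Classical in
theorem lc_restrict (S : ℤ → ℤ → ℤ → Finset (Fin 3) → Prop) (P : Polyvector) (i j k : ℤ)
    (I : Finset (Fin 3)) : lc i j k I (restrict S P) = if S i j k I then lc i j k I P else 0 := by
  refine lc_ofLc_of_adm (F := fun i j k I => if S i j k I then lc i j k I P else 0)
    (fun i j k I h => adm_of_lc_ne_zero (P := P) fun h1 => h ?_) i j k I
  simp [h1]

theorem restrict_mem (S : ℤ → ℤ → ℤ → Finset (Fin 3) → Prop) (P : Polyvector) :
    restrict S P ∈ lcIn S := by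
  intro i j k I h
  by_contra h1
  simp [lc_restrict, h1] at h

theorem restrict_mem_of_mem (S : ℤ → ℤ → ℤ → Finset (Fin 3) → Prop)
    {T : ℤ → ℤ → ℤ → Finset (Fin 3) → Prop} {P : Polyvector} (hP : P ∈ lcIn T) :
    restrict S P ∈ lcIn T := by
  intro i j k I h
  refine hP i j k I fun h1 => h ?_
  simp [lc_restrict, h1]

theorem restrict_of_mem {S : ℤ → ℤ → ℤ → Finset (Fin 3) → Prop} {P : Polyvector}
    (hP : P ∈ lcIn S) : restrict S P = P := by
  refine ext_of_lc fun i j k I => ?_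
  rw [lc_restrict]
  split_ifs with h
  · rfl
  · exact (lc_eq_zero_of_mem hP h).symm

theorem restrict_of_disjoint {S T : ℤ → ℤ → ℤ → Finset (Fin 3) → Prop} {P : Polyvector}
    (hP : P ∈ lcIn T) (h : ∀ i j k I, T i j k I → ¬ S i j k I) : restrict S P = 0 := by
  refine ext_of_lc fun i j k I => ?_
  rw [lc_restrict, map_zero]
  split_ifs with h1
  · exact lc_eq_zero_of_mem hP fun h2 => h _ _ _ _ h2 h1
  · rfl

/-- Membership of `x^i y^j z^k Y_I` in the block of the weight `(M, D)`. -/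
def BlockTerm (M D : ℤ) (i j k : ℤ) (_ : Finset (Fin 3)) : Prop := i + j + k = M ∧ i - j = D

theorem dLambda_restrict_block (a b : ℝ) (M D : ℤ) (P : Polyvector) :
    dLambda a b (restrict (BlockTerm M D) P) = restrict (BlockTerm M D) (dLambda a b P) := by
  refine ext_of_lc fun i j k I => ?_
  have h : ∀ I', BlockTerm M D (i + 1) (j + 1) (k - 2) I' ↔ BlockTerm M D i j k I := by
    intro I'
    unfold BlockTerm
    constructor <;> rintro ⟨h1, h2⟩ <;> constructor <;> omega
  have h' : ∀ I', BlockTerm M D i j k I' ↔ BlockTerm M D i j k I := fun I' => Iff.rfl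
  rw [lc_restrict]
  rcases finset_fin_three_cases I with rfl | rfl | rfl | rfl | rfl | rfl | rfl | rfl <;>
  simp only [lc_dLambda_empty, lc_dLambda_0, lc_dLambda_1, lc_dLambda_2, lc_dLambda_01,
    lc_dLambda_02, lc_dLambda_12, lc_dLambda_012, lc_restrict, h, h'] <;>
  split_ifs <;> simp_all

/-- The terms of cochain degree `c`. -/
def CochainTerm (c : ℤ) (_ _ _ : ℤ) (I : Finset (Fin 3)) : Prop := (I.card : ℤ) = c

theorem dLambda_restrict_cochain (a b : ℝ) (c : ℤ) (P : Polyvector) :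
    dLambda a b (restrict (CochainTerm c) P) =
      restrict (CochainTerm (c + 1)) (dLambda a b P) := by
  refine ext_of_lc fun i j k I => ?_
  rw [lc_restrict]
  by_cases h0 : c = 0
  · subst h0
    rcases finset_fin_three_cases I with rfl | rfl | rfl | rfl | rfl | rfl | rfl | rfl <;>
    simp [lc_dLambda_empty, lc_dLambda_0, lc_dLambda_1, lc_dLambda_2, lc_dLambda_01,
      lc_dLambda_02, lc_dLambda_12, lc_dLambda_012, lc_restrict, CochainTerm]
  by_cases h1 : c = 1
  · subst h1
    rcases finset_fin_three_cases I with rfl | rfl | rfl | rfl | rfl | rfl | rfl | rfl <;>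
    simp [lc_dLambda_empty, lc_dLambda_0, lc_dLambda_1, lc_dLambda_2, lc_dLambda_01,
      lc_dLambda_02, lc_dLambda_12, lc_dLambda_012, lc_restrict, CochainTerm]
  by_cases h2 : c = 2
  · subst h2
    rcases finset_fin_three_cases I with rfl | rfl | rfl | rfl | rfl | rfl | rfl | rfl <;>
    simp [lc_dLambda_empty, lc_dLambda_0, lc_dLambda_1, lc_dLambda_2, lc_dLambda_01,
      lc_dLambda_02, lc_dLambda_12, lc_dLambda_012, lc_restrict, CochainTerm]
  have h3 : (0 : ℤ) ≠ c := Ne.symm h0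
  have h4 : (1 : ℤ) ≠ c := Ne.symm h1
  have h5 : (2 : ℤ) ≠ c := Ne.symm h2
  have h6 : (1 : ℤ) ≠ c + 1 := by omega
  have h7 : (2 : ℤ) ≠ c + 1 := by omega
  have h8 : (3 : ℤ) ≠ c + 1 := by omega
  rcases finset_fin_three_cases I with rfl | rfl | rfl | rfl | rfl | rfl | rfl | rfl <;>
  simp [lc_dLambda_empty, lc_dLambda_0, lc_dLambda_1, lc_dLambda_2, lc_dLambda_01,
    lc_dLambda_02, lc_dLambda_12, lc_dLambda_012, lc_restrict, CochainTerm, h3, h4, h5, h6, h7, h8]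

/-! ### Exactness at the regular exponents -/

/-- The element of the exterior algebra of `⟨Y₁, Y₂, Y₃⟩` with the given coordinates with respect to
`1, Y₁, Y₂, Y₃, Y₁ ∧ Y₂, Y₁ ∧ Y₃, Y₂ ∧ Y₃, Y₁ ∧ Y₂ ∧ Y₃`. -/
def ext8 (g g0 g1 g2 g01 g02 g12 g012 : ℝ) (I : Finset (Fin 3)) : ℝ :=
  if I = ∅ then g else if I = {0} then g0 else if I = {1} then g1 else if I = {2} then g2 else
  if I = {0, 1} then g01 else if I = {0, 2} then g02 else if I = {1, 2} then g12 else g012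

theorem ext8_values (g g0 g1 g2 g01 g02 g12 g012 : ℝ) :
    ext8 g g0 g1 g2 g01 g02 g12 g012 ∅ = g ∧ ext8 g g0 g1 g2 g01 g02 g12 g012 {0} = g0 ∧
    ext8 g g0 g1 g2 g01 g02 g12 g012 {1} = g1 ∧ ext8 g g0 g1 g2 g01 g02 g12 g012 {2} = g2 ∧
    ext8 g g0 g1 g2 g01 g02 g12 g012 {0, 1} = g01 ∧
    ext8 g g0 g1 g2 g01 g02 g12 g012 {0, 2} = g02 ∧
    ext8 g g0 g1 g2 g01 g02 g12 g012 {1, 2} = g12 ∧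
    ext8 g g0 g1 g2 g01 g02 g12 g012 {0, 1, 2} = g012 := by
  simp (decide := true) [ext8]

/-- The polyvector field `x^i y^j z^k G`, `G` in the exterior algebra of `⟨Y₁, Y₂, Y₃⟩`. -/
def mon (i j k : ℤ) (G : Finset (Fin 3) → ℝ) : Polyvector :=
  ofLc fun i' j' k' I => if i' = i ∧ j' = j ∧ k' = k then G I else 0

theorem lc_mon {i j k : ℤ} {G : Finset (Fin 3) → ℝ} (hG : ∀ I, G I ≠ 0 → Adm i j k I)
    (i' j' k' : ℤ) (I : Finset (Fin 3)) :
    lc i' j' k' I (mon i j k G) = if i' = i ∧ j' = j ∧ k' = k then G I else 0 := by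
  refine lc_ofLc_of_adm (F := fun i' j' k' I => if i' = i ∧ j' = j ∧ k' = k then G I else 0)
    (fun i' j' k' I h => ?_) i' j' k' I
  split_ifs at h with h1
  · obtain ⟨rfl, rfl, rfl⟩ := h1
    exact hG I h
  · exact absurd rfl h

/-- Some component of the linear form `X_κ`, `κ = (i, j, k)`, with which the quadratic part
`a Y₂₃ + a Y₃₁ + b Y₁₂` acts on the multiples of `x^i y^j z^k` is nonzero, and belongs to an index
for which the exponent is nonnegative. Contraction by this index inverts the exterior product
by `X_κ`. -/
def Regular (a b : ℝ) (i j k : ℤ) : Prop :=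
  (a * (i - j) ≠ 0 ∧ 0 ≤ k) ∨ (b * j - a * k ≠ 0 ∧ 0 ≤ i) ∨ (a * k - b * i ≠ 0 ∧ 0 ≤ j)

/-- Exactness of the Koszul complex of the exterior product by `X_κ` at a regular exponent `κ`. The
condition on the sign of the exponent in `Regular` ensures that the contracted polyvector has no
pole. -/
theorem exists_lead_eq {a b : ℝ} {i j k : ℤ} (hreg : Regular a b i j k) {P : Polyvector}
    (h1 : ∀ I, lc i j k I (dLambda a b P) = 0) (h2 : ∀ I, lc (i + 1) (j + 1) (k - 2) I P = 0) :
    ∃ Q ∈ lcIn (fun i' j' k' _ => i' = i ∧ j' = j ∧ k' = k),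
      ∀ I, lc i j k I (dLambda a b Q) = lc i j k I P := by
  have e0 := h1 {0}
  have e1 := h1 {1}
  have e2 := h1 {2}
  have e01 := h1 {0, 1}
  have e02 := h1 {0, 2}
  have e12 := h1 {1, 2}
  have e012 := h1 {0, 1, 2}
  simp only [lc_dLambda_0, lc_dLambda_1, lc_dLambda_2, lc_dLambda_01, lc_dLambda_02, lc_dLambda_12,
    lc_dLambda_012, h2, mul_zero, add_zero, sub_zero] at e0 e1 e2 e01 e02 e12 e012
  have build : ∀ G : Finset (Fin 3) → ℝ, (∀ I, G I ≠ 0 → Adm i j k I) →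
      (∀ I, lc i j k I (dLambda a b (mon i j k G)) = lc i j k I P) →
      ∃ Q ∈ lcIn (fun i' j' k' _ => i' = i ∧ j' = j ∧ k' = k),
      ∀ I, lc i j k I (dLambda a b Q) = lc i j k I P := by
    intro G hG h
    refine ⟨mon i j k G, ?_, h⟩
    intro i' j' k' I h'
    rw [lc_mon hG] at h'
    by_contra h''
    exact h' (if_neg h'')
  have adm : ∀ I, lc i j k I P ≠ 0 → Adm i j k I := fun I => adm_of_lc_ne_zero
  have hn : ¬ (i + 1 = i ∧ j + 1 = j ∧ k - 2 = k) := by omega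
  rcases hreg with ⟨hX, hk⟩ | ⟨hX, hi⟩ | ⟨hX, hj⟩
  · have hG : ∀ I, ext8 (lc i j k {2} P / (a * (i - j))) (-lc i j k {0, 2} P / (a * (i - j))) (-lc i j k {1, 2} P / (a * (i - j)))
        0 (lc i j k {0, 1, 2} P / (a * (i - j))) 0 0 0 I ≠ 0 →
        Adm i j k I := by
      intro I hI
      rcases finset_fin_three_cases I with rfl | rfl | rfl | rfl | rfl | rfl | rfl | rfl <;>
      simp only [ext8_values, ne_eq, not_true_eq_false, div_eq_zero_iff, neg_eq_zero, hX,
        or_false] at hI <;>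
      have := adm _ hI <;>
      simp only [Adm, ind_values, add_zero] at this ⊢ <;>
      omega
    have hempty := (mul_eq_zero.1 e2).resolve_left hX
    refine build _ hG fun I => ?_
    rcases finset_fin_three_cases I with rfl | rfl | rfl | rfl | rfl | rfl | rfl | rfl <;>
    simp only [lc_dLambda_empty, lc_dLambda_0, lc_dLambda_1, lc_dLambda_2, lc_dLambda_01,
      lc_dLambda_02, lc_dLambda_12, lc_dLambda_012, lc_mon hG, ext8_values, hn, if_false,
      and_self, if_true] <;>
    generalize a * ((i : ℝ) - j) = x3 at * <;>
    generalize b * (j : ℝ) - a * k = x1 at * <;>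
    generalize a * (k : ℝ) - b * i = x2 at * <;>
    (try field_simp) <;>
    linarith
  · have hG : ∀ I, ext8 (lc i j k {0} P / (b * j - a * k)) 0 (lc i j k {0, 1} P / (b * j - a * k))
        (lc i j k {0, 2} P / (b * j - a * k)) 0 0 (lc i j k {0, 1, 2} P / (b * j - a * k)) 0 I ≠ 0 →
        Adm i j k I := by
      intro I hI
      rcases finset_fin_three_cases I with rfl | rfl | rfl | rfl | rfl | rfl | rfl | rfl <;>
      simp only [ext8_values, ne_eq, not_true_eq_false, div_eq_zero_iff, neg_eq_zero, hX,
        or_false] at hI <;>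
      have := adm _ hI <;>
      simp only [Adm, ind_values, add_zero] at this ⊢ <;>
      omega
    have hempty := (mul_eq_zero.1 e0).resolve_left hX
    refine build _ hG fun I => ?_
    rcases finset_fin_three_cases I with rfl | rfl | rfl | rfl | rfl | rfl | rfl | rfl <;>
    simp only [lc_dLambda_empty, lc_dLambda_0, lc_dLambda_1, lc_dLambda_2, lc_dLambda_01,
      lc_dLambda_02, lc_dLambda_12, lc_dLambda_012, lc_mon hG, ext8_values, hn, if_false,
      and_self, if_true] <;>
    generalize a * ((i : ℝ) - j) = x3 at * <;>
    generalize b * (j : ℝ) - a * k = x1 at * <;>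
    generalize a * (k : ℝ) - b * i = x2 at * <;>
    (try field_simp) <;>
    linarith
  · have hG : ∀ I, ext8 (lc i j k {1} P / (a * k - b * i)) (-lc i j k {0, 1} P / (a * k - b * i)) 0
        (lc i j k {1, 2} P / (a * k - b * i)) 0 (-lc i j k {0, 1, 2} P / (a * k - b * i)) 0 0 I ≠ 0 →
        Adm i j k I := by
      intro I hI
      rcases finset_fin_three_cases I with rfl | rfl | rfl | rfl | rfl | rfl | rfl | rfl <;>
      simp only [ext8_values, ne_eq, not_true_eq_false, div_eq_zero_iff, neg_eq_zero, hX,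
        or_false] at hI <;>
      have := adm _ hI <;>
      simp only [Adm, ind_values, add_zero] at this ⊢ <;>
      omega
    have hempty := (mul_eq_zero.1 e1).resolve_left hX
    refine build _ hG fun I => ?_
    rcases finset_fin_three_cases I with rfl | rfl | rfl | rfl | rfl | rfl | rfl | rfl <;>
    simp only [lc_dLambda_empty, lc_dLambda_0, lc_dLambda_1, lc_dLambda_2, lc_dLambda_01,
      lc_dLambda_02, lc_dLambda_12, lc_dLambda_012, lc_mon hG, ext8_values, hn, if_false,
      and_self, if_true] <;>
    generalize a * ((i : ℝ) - j) = x3 at * <;>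
    generalize b * (j : ℝ) - a * k = x1 at * <;>
    generalize a * (k : ℝ) - b * i = x2 at * <;>
    (try field_simp) <;>
    linarith

/-! ### Representatives in a single weight -/

/-- The polyvector fields of weight `(M, D)`, that is, with terms `x^i y^j z^k Y_I` such that
`i + j + k = M` and `i - j = D`. The coboundary operator preserves this weight. -/
def block (M D : ℤ) : Submodule ℝ Polyvector := lcIn (BlockTerm M D)

/-- The polyvector fields with terms `x^i y^j z^k Y_I` such that `j ≤ E`. -/
def upTo (E : ℤ) : Submodule ℝ Polyvector := lcIn fun _ j _ _ => j ≤ E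

theorem dLambda_mem_block (a b : ℝ) {M D : ℤ} {P : Polyvector} (hP : P ∈ block M D) :
    dLambda a b P ∈ block M D := by
  have h := dLambda_restrict_block a b M D P
  rw [restrict_of_mem hP] at h
  rw [h]
  exact restrict_mem _ _

theorem lc_dLambda_eq_zero (a b : ℝ) {P : Polyvector} {i j k : ℤ} (h1 : ∀ I, lc i j k I P = 0)
    (h2 : ∀ I, lc (i + 1) (j + 1) (k - 2) I P = 0) (I : Finset (Fin 3)) :
    lc i j k I (dLambda a b P) = 0 := by
  rcases finset_fin_three_cases I with rfl | rfl | rfl | rfl | rfl | rfl | rfl | rfl <;>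
  simp only [lc_dLambda_empty, lc_dLambda_0, lc_dLambda_1, lc_dLambda_2, lc_dLambda_01,
    lc_dLambda_02, lc_dLambda_12, lc_dLambda_012, h1, h2, mul_zero, add_zero, sub_zero]

theorem dLambda_mem_upTo (a b : ℝ) {E : ℤ} {P : Polyvector} (hP : P ∈ upTo E) :
    dLambda a b P ∈ upTo E := by
  intro i j k I h
  by_contra hj
  exact h (lc_dLambda_eq_zero a b (fun I => lc_eq_zero_of_mem hP hj)
    (fun I => lc_eq_zero_of_mem hP (by omega)) I)

theorem mem_upTo_of_mem_block {M D : ℤ} {P : Polyvector} (hP : P ∈ block M D) :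
    P ∈ upTo (M + 2) := by
  intro i j k I h
  have h1 := (adm_of_lc_ne_zero h).neg_one_le
  have h2 := (hP i j k I h).1
  omega

theorem exists_sub_mem_upTo_aux {a b : ℝ} {M D E : ℤ} (n : ℕ)
    (hreg : ∀ i j k : ℤ, i + j + k = M → i - j = D → E < j → j ≤ E + n → -1 ≤ i → -1 ≤ j →
      -1 ≤ k → Regular a b i j k) (P : Polyvector) (hP : P ∈ block M D) (hn : P ∈ upTo (E + n))
    (hd : dLambda a b P ∈ upTo E) :
    ∃ Q, P - dLambda a b Q ∈ block M D ⊓ upTo E := by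
  induction n generalizing P with
  | zero => exact ⟨0, by simpa using ⟨hP, by simpa using hn⟩⟩
  | succ n ih =>
    set j := E + n + 1 with hj
    set i := j + D with hi
    set k := M - i - j with hk
    have huniq : ∀ i' k' : ℤ, i' + j + k' = M → i' - j = D → i' = i ∧ k' = k := by
      intro i' k' h1 h2
      omega
    have hreg' : ∀ i j k : ℤ, i + j + k = M → i - j = D → E < j → j ≤ E + n → -1 ≤ i → -1 ≤ j →
        -1 ≤ k → Regular a b i j k := fun i j k h1 h2 h3 h4 =>
      hreg i j k h1 h2 h3 (by push_cast; omega)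
    by_cases hadm : -1 ≤ i ∧ -1 ≤ j ∧ -1 ≤ k
    · obtain ⟨Q, hQ, hlead⟩ := exists_lead_eq (P := P)
        (hreg i j k (by omega) (by omega) (by omega) (by push_cast; omega) hadm.1 hadm.2.1 hadm.2.2)
        (fun I => lc_eq_zero_of_mem hd (by omega))
        (fun I => lc_eq_zero_of_mem hn (by push_cast; omega))
      have hQb : Q ∈ block M D := by
        intro i' j' k' I h
        obtain ⟨rfl, rfl, rfl⟩ := hQ i' j' k' I h
        constructor <;> omega
      have hQu : Q ∈ upTo j := fun i' j' k' I h => (hQ i' j' k' I h).2.1.le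
      have hb := sub_mem hP (dLambda_mem_block a b hQb)
      obtain ⟨Q', hQ'⟩ := ih hreg' (P - dLambda a b Q) hb (by
        intro i' j' k' I h
        have h1 := hb i' j' k' I h
        have h2 : P - dLambda a b Q ∈ upTo j := by
          refine sub_mem ?_ (dLambda_mem_upTo a b hQu)
          convert hn using 2
          push_cast; omega
        have h3 : j' ≤ j := h2 i' j' k' I h
        rcases h3.lt_or_eq with h4 | rfl
        · omega
        · obtain ⟨rfl, rfl⟩ := huniq _ _ h1.1 h1.2
          rw [map_sub, hlead, sub_self] at h
          exact absurd rfl h) (by rwa [map_sub, dLambda_dLambda, sub_zero])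
      exact ⟨Q + Q', by rwa [map_add, ← sub_sub]⟩
    · refine ih hreg' P hP ?_ hd
      intro i' j' k' I h
      have h1 := hP i' j' k' I h
      have h2 := hn i' j' k' I h
      have h3 := (adm_of_lc_ne_zero h).neg_one_le
      push_cast at h2
      by_contra h4
      have h5 : j' = j := by omega
      subst h5
      obtain ⟨rfl, rfl⟩ := huniq _ _ h1.1 h1.2
      exact hadm h3

/-- Descending induction on the exponent of `y`: if all positions with `E < j ≤ F` are regular, then a
polyvector field with vanishing coboundary in these positions can be moved by a coboundary into the
positions with `j ≤ E`. -/
theorem exists_sub_mem_upTo {a b : ℝ} {M D E : ℤ} (F : ℤ)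
    (hreg : ∀ i j k : ℤ, i + j + k = M → i - j = D → E < j → j ≤ F → -1 ≤ i → -1 ≤ j →
      -1 ≤ k → Regular a b i j k) {P : Polyvector} (hP : P ∈ block M D) (hF : P ∈ upTo F)
    (hd : dLambda a b P ∈ upTo E) : ∃ Q, P - dLambda a b Q ∈ block M D ⊓ upTo E := by
  rcases le_or_gt F E with h | h
  · exact ⟨0, by simpa using ⟨hP, fun i j k I hI => (hF i j k I hI).trans h⟩⟩
  · have hn : E + (F - E).toNat = F := by omega
    exact exists_sub_mem_upTo_aux (F - E).toNat (by rwa [hn]) P hP (by rwa [hn]) hd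

theorem exists_block_preimage {a b : ℝ} {M D : ℤ} {P : Polyvector} (hP : P ∈ block M D)
    (h : P ∈ coboundaries a b) : ∃ Q ∈ block M D, dLambda a b Q = P := by
  obtain ⟨Q, rfl⟩ := h
  exact ⟨restrict (BlockTerm M D) Q, restrict_mem _ _, by
    rw [dLambda_restrict_block, restrict_of_mem hP]⟩

theorem dLambda_mem_coboundaries (a b : ℝ) (P : Polyvector) :
    dLambda a b P ∈ coboundaries a b := ⟨P, rfl⟩

theorem mem_cocycles {a b : ℝ} {P : Polyvector} : P ∈ cocycles a b ↔ dLambda a b P = 0 :=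
  LinearMap.mem_ker

/-- The polyvector fields `g i` of weight `(M, D)` represent the cohomology in this weight,
compatibly with the cochain degree and with the filtration `filt`. -/
structure BlockRep (a b : ℝ) (M D : ℤ) {ι : Type} [Fintype ι] (g : ι → Polyvector) : Prop where
  mem_block : ∀ i, g i ∈ block M D
  cochain : ∀ i, ∃ c, g i ∈ lcIn (CochainTerm c)
  cocycle : ∀ i, g i ∈ cocycles a b
  exists_rep : ∀ P ∈ block M D, P ∈ cocycles a b → ∃ c : ι → ℝ,
    P - ∑ i, c i • g i ∈ coboundaries a b ∧ ∀ p, P ∈ filt p → ∀ i, c i • g i ∈ filt p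
  unique : ∀ c : ι → ℝ, ∑ i, c i • g i ∈ coboundaries a b → ∀ i, c i • g i = 0

/-- Vanishing polyvector fields can be added to a system of representatives. -/
theorem BlockRep.extend {a b : ℝ} {M D : ℤ} {ι κ : Type} [Fintype ι] [Fintype κ]
    {g : ι → Polyvector} (hg : BlockRep a b M D g) {g' : κ → Polyvector} (σ : ι → κ)
    (hσ : Function.Injective σ) (h : ∀ i, g' (σ i) = g i) (h0 : ∀ j, (∀ i, σ i ≠ j) → g' j = 0) :
    BlockRep a b M D g' := by
  classical
  have cases : ∀ j, (∃ i, σ i = j) ∨ g' j = 0 := by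
    intro j
    by_cases hj : ∃ i, σ i = j
    · exact Or.inl hj
    · exact Or.inr (h0 j fun i hi => hj ⟨i, hi⟩)
  have sum_eq : ∀ c : κ → ℝ, ∑ j, c j • g' j = ∑ i, c (σ i) • g i := by
    intro c
    have h1 : ∑ i, c (σ i) • g i = ∑ j ∈ Finset.univ.map ⟨σ, hσ⟩, c j • g' j := by
      rw [Finset.sum_map]
      exact Finset.sum_congr rfl fun i _ => by simp [h]
    rw [h1]
    refine (Finset.sum_subset (Finset.subset_univ _) fun j _ hj => ?_).symm
    rw [h0 j fun i hi => hj (Finset.mem_map.2 ⟨i, Finset.mem_univ _, hi⟩), smul_zero]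
  refine ⟨?_, ?_, ?_, ?_, ?_⟩
  · intro j
    rcases cases j with ⟨i, rfl⟩ | hj
    · exact h i ▸ hg.mem_block i
    · exact hj ▸ zero_mem _
  · intro j
    rcases cases j with ⟨i, rfl⟩ | hj
    · exact h i ▸ hg.cochain i
    · exact ⟨0, hj ▸ zero_mem _⟩
  · intro j
    rcases cases j with ⟨i, rfl⟩ | hj
    · exact h i ▸ hg.cocycle i
    · exact hj ▸ zero_mem _
  · intro P hP hPc
    obtain ⟨c, hc, hf⟩ := hg.exists_rep P hP hPc
    refine ⟨Function.extend σ c 0, ?_, ?_⟩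
    · rw [sum_eq]
      simpa only [hσ.extend_apply] using hc
    · intro p hp j
      rcases cases j with ⟨i, rfl⟩ | hj
      · rw [hσ.extend_apply, h]
        exact hf p hp i
      · rw [hj, smul_zero]
        exact zero_mem _
  · intro c hc j
    rcases cases j with ⟨i, rfl⟩ | hj
    · rw [h]
      exact hg.unique (fun i => c (σ i)) (by rwa [← sum_eq]) i
    · rw [hj, smul_zero]

/-- A weight all of whose positions are regular has no cohomology. -/
theorem blockRep_of_regular {a b : ℝ} {M D : ℤ}
    (hreg : ∀ i j k : ℤ, i + j + k = M → i - j = D → -1 ≤ i → -1 ≤ j → -1 ≤ k →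
      Regular a b i j k) : BlockRep a b M D (fun i : Fin 0 => i.elim0) := by
  refine ⟨fun i => i.elim0, fun i => i.elim0, fun i => i.elim0, ?_, fun _ _ i => i.elim0⟩
  intro P hP hPc
  refine ⟨0, ?_, fun _ _ i => i.elim0⟩
  obtain ⟨Q, hQ⟩ := exists_sub_mem_upTo (E := -2) (M + 2)
    (fun i j k h1 h2 _ _ => hreg i j k h1 h2) hP (mem_upTo_of_mem_block hP)
    (by rw [mem_cocycles.1 hPc]; exact zero_mem _)
  have h0 : P - dLambda a b Q = 0 := by
    refine ext_of_lc fun i j k I => ?_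
    by_contra h
    rw [map_zero] at h
    have h1 : j ≤ -2 := hQ.2 i j k I h
    have := (adm_of_lc_ne_zero h).neg_one_le
    omega
  rw [sub_eq_zero] at h0
  simpa using h0 ▸ dLambda_mem_coboundaries a b Q

/-! ### Diagonal weights without resonance -/

/-- The bivector field `z^(M+2) ∂₁₂ = z^(M+2) (xy)⁻¹ Y₁₂` of weight `(M, 0)` (`0`, if `M < -2`). -/
def bottom2 (M : ℤ) : Polyvector :=
  ofLc fun i j k I => if i = -1 ∧ j = -1 ∧ k = M + 2 then ext8 0 0 0 0 1 0 0 0 I else 0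

/-- The trivector field `z^(M+3) ∂₁₂₃ = z^(M+2) (xy)⁻¹ Y₁₂₃` of weight `(M, 0)`
(`0`, if `M < -3`). -/
def bottom3 (M : ℤ) : Polyvector :=
  ofLc fun i j k I => if i = -1 ∧ j = -1 ∧ k = M + 2 then ext8 0 0 0 0 0 0 0 1 I else 0

theorem bottom2_mem (M : ℤ) : bottom2 M ∈ block M 0 ⊓ upTo (-1) := by
  classical
  have h : ∀ i j k I, lc i j k I (bottom2 M) ≠ 0 → i = -1 ∧ j = -1 ∧ k = M + 2 := by
    intro i j k I h
    by_contra h1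
    simp [bottom2, lc_ofLc, h1] at h
  constructor <;> intro i j k I h1 <;> obtain ⟨rfl, rfl, rfl⟩ := h i j k I h1
  · constructor <;> omega
  · exact le_rfl

theorem bottom3_mem (M : ℤ) : bottom3 M ∈ block M 0 ⊓ upTo (-1) := by
  classical
  have h : ∀ i j k I, lc i j k I (bottom3 M) ≠ 0 → i = -1 ∧ j = -1 ∧ k = M + 2 := by
    intro i j k I h
    by_contra h1
    simp [bottom3, lc_ofLc, h1] at h
  constructor <;> intro i j k I h1 <;> obtain ⟨rfl, rfl, rfl⟩ := h i j k I h1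
  · constructor <;> omega
  · exact le_rfl

theorem bottom2_mem_cochain (M : ℤ) : bottom2 M ∈ lcIn (CochainTerm 2) := by
  classical
  intro i j k I h
  rcases finset_fin_three_cases I with rfl | rfl | rfl | rfl | rfl | rfl | rfl | rfl <;>
  simp [bottom2, lc_ofLc, ext8_values] at h
  simp [CochainTerm]

theorem bottom3_mem_cochain (M : ℤ) : bottom3 M ∈ lcIn (CochainTerm 3) := by
  classical
  intro i j k I h
  rcases finset_fin_three_cases I with rfl | rfl | rfl | rfl | rfl | rfl | rfl | rfl <;>
  simp [bottom3, lc_ofLc, ext8_values] at h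
  simp [CochainTerm]

theorem bottom_smul_eq_zero {M : ℤ} {s t : ℝ} (h : s • bottom2 M + t • bottom3 M = 0) :
    s • bottom2 M = 0 ∧ t • bottom3 M = 0 := by
  have h1 := congrArg (restrict (CochainTerm 2)) h
  rw [map_add, map_smul, map_smul, restrict_of_mem (bottom2_mem_cochain M),
    restrict_of_disjoint (bottom3_mem_cochain M)
      (fun i j k I h2 h3 => by unfold CochainTerm at h2 h3; omega), smul_zero, add_zero,
    map_zero] at h1
  exact ⟨h1, by rwa [h1, zero_add] at h⟩

theorem eq_bottom {M : ℤ} {P : Polyvector} (hP : P ∈ block M 0 ⊓ upTo (-1)) :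
    P = lc (-1) (-1) (M + 2) {0, 1} P • bottom2 M +
      lc (-1) (-1) (M + 2) {0, 1, 2} P • bottom3 M := by
  classical
  have h : ∀ i j k I, lc i j k I P ≠ 0 → i = -1 ∧ j = -1 ∧ k = M + 2 := by
    intro i j k I h
    have h1 : j ≤ -1 := hP.2 i j k I h
    have h2 := hP.1 i j k I h
    have h3 := (adm_of_lc_ne_zero h).neg_one_le
    unfold BlockTerm at h2
    omega
  refine ext_of_lc fun i j k I => ?_
  by_cases hc : i = -1 ∧ j = -1 ∧ k = M + 2
  · obtain ⟨rfl, rfl, rfl⟩ := hc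
    have hz : ∀ I, ¬ Adm (-1) (-1) (M + 2) I → lc (-1) (-1) (M + 2) I P = 0 := by
      intro I hI
      by_contra h1
      exact hI (adm_of_lc_ne_zero h1)
    rcases finset_fin_three_cases I with rfl | rfl | rfl | rfl | rfl | rfl | rfl | rfl <;>
    simp only [map_add, map_smul, bottom2, bottom3, lc_ofLc, ext8_values, and_self, if_true,
      ite_self, smul_eq_mul, mul_zero, mul_one, add_zero, zero_add, mul_ite]
    all_goals first | exact hz _ (by simp [Adm, ind_values]) | skip
    all_goals
      split_ifs with h1
      · rfl
      · exact hz _ h1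
  · have h1 : lc i j k I P = 0 := by
      by_contra h1
      exact hc (h _ _ _ _ h1)
    rw [h1]
    simp [bottom2, bottom3, lc_ofLc, hc]

theorem dLambda_bottom (a b : ℝ) {M : ℤ} {P : Polyvector} (hP : P ∈ block M 0 ⊓ upTo (-1)) :
    dLambda a b P = 0 := by
  refine ext_of_lc fun i j k I => ?_
  rw [map_zero]
  by_contra h
  have h1 : j ≤ -1 := dLambda_mem_upTo a b hP.2 i j k I h
  have h2 := dLambda_mem_block a b hP.1 i j k I h
  have h3 := (adm_of_lc_ne_zero h).neg_one_le
  unfold BlockTerm at h2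
  obtain rfl : j = -1 := by omega
  obtain rfl : i = -1 := by omega
  have hn : ∀ I, lc (-1 + 1) (-1 + 1) (k - 2) I P = 0 := fun I =>
    lc_eq_zero_of_mem hP.2 (by omega)
  have hz : ∀ I, ¬ Adm (-1) (-1) k I → lc (-1) (-1) k I P = 0 := by
    intro I hI
    by_contra h1
    exact hI (adm_of_lc_ne_zero h1)
  have z := hz ∅ (by simp [Adm, ind_values])
  have z0 := hz {0} (by simp [Adm, ind_values])
  have z1 := hz {1} (by simp [Adm, ind_values])
  have z2 := hz {2} (by simp [Adm, ind_values])
  have z02 := hz {0, 2} (by simp [Adm, ind_values])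
  have z12 := hz {1, 2} (by simp [Adm, ind_values])
  refine h ?_
  rcases finset_fin_three_cases I with rfl | rfl | rfl | rfl | rfl | rfl | rfl | rfl <;>
  simp only [lc_dLambda_empty, lc_dLambda_0, lc_dLambda_1, lc_dLambda_2, lc_dLambda_01,
    lc_dLambda_02, lc_dLambda_12, lc_dLambda_012, hn, z, z0, z1, z2, z02, z12] <;> ring

theorem regular_diag {a b : ℝ} {M i j k : ℤ} (h1 : i + j + k = M) (h2 : i - j = 0) (h3 : 0 ≤ j)
    (h : b * j ≠ a * (M - 2 * j)) : Regular a b i j k := by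
  obtain rfl : i = j := by omega
  refine Or.inr (Or.inl ⟨fun h4 => h ?_, h3⟩)
  have h5 : (k : ℝ) = M - 2 * i := by
    rw [← h1]; push_cast; ring
  rw [← h5]; linarith

/-- In a weight of the diagonal a smaller exponent of `y` means a larger exponent of `z`, so that
replacing a cocycle by a representative in lower positions respects the filtration. -/
theorem mem_filt_of_upTo {M E : ℤ} {P g : Polyvector} {p : ℕ} (hP : P ∈ block M 0)
    (hPE : P ∉ upTo (E - 1)) (hp : P ∈ filt p) (hg : g ∈ block M 0 ⊓ upTo E) : g ∈ filt p := by
  rw [filt_eq] at hp ⊢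
  intro i j k I h
  have h1 := hg.1 i j k I h
  have h2 : j ≤ E := hg.2 i j k I h
  have h3 : ∃ i j k I, lc i j k I P ≠ 0 ∧ E ≤ j := by
    by_contra h4
    refine hPE fun i j k I h5 => ?_
    by_contra h6
    exact h4 ⟨i, j, k, I, h5, by omega⟩
  obtain ⟨i', j', k', I', h4, h5⟩ := h3
  have h6 := hP i' j' k' I' h4
  have h7 := hp i' j' k' I' h4
  unfold BlockTerm at h1 h6
  dsimp only at h7 ⊢
  omega

/-- Without resonance, the cohomology of weight `(M, 0)` is spanned by `z^(M+2) ∂₁₂` and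
`z^(M+3) ∂₁₂₃`. -/
theorem blockRep_nonresonant {a b : ℝ} {M : ℤ}
    (hreg : ∀ e : ℤ, 0 ≤ e → -1 ≤ M - 2 * e → b * e ≠ a * (M - 2 * e)) :
    BlockRep a b M 0 ![bottom2 M, bottom3 M] := by
  have hregular : ∀ i j k : ℤ, i + j + k = M → i - j = 0 → -1 < j → j ≤ M + 2 → -1 ≤ i → -1 ≤ j →
      -1 ≤ k → Regular a b i j k := fun i j k h1 h2 h3 _ _ _ h4 =>
    regular_diag h1 h2 (by omega) (hreg j (by omega) (by omega))
  have hmem : ∀ i, (![bottom2 M, bottom3 M] : Fin 2 → Polyvector) i ∈ block M 0 ⊓ upTo (-1) := by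
    intro i
    fin_cases i
    · exact bottom2_mem M
    · exact bottom3_mem M
  refine ⟨fun i => (hmem i).1, ?_, fun i => dLambda_bottom a b (hmem i), ?_, ?_⟩
  · intro i
    fin_cases i
    · exact ⟨2, bottom2_mem_cochain M⟩
    · exact ⟨3, bottom3_mem_cochain M⟩
  · intro P hP hPc
    obtain ⟨Q, hQ⟩ := exists_sub_mem_upTo (E := -1) (M + 2) hregular hP
      (mem_upTo_of_mem_block hP) (by rw [mem_cocycles.1 hPc]; exact zero_mem _)
    by_cases hP0 : P ∈ upTo (-1 - 1)
    · have h0 : P = 0 := by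
        refine ext_of_lc fun i j k I => ?_
        by_contra h
        rw [map_zero] at h
        have h1 : j ≤ -1 - 1 := hP0 i j k I h
        have := (adm_of_lc_ne_zero h).neg_one_le
        omega
      exact ⟨0, by simp [h0], fun p _ i => by simp⟩
    · refine ⟨![lc (-1) (-1) (M + 2) {0, 1} (P - dLambda a b Q),
        lc (-1) (-1) (M + 2) {0, 1, 2} (P - dLambda a b Q)], ?_, ?_⟩
      · have h := eq_bottom hQ
        rw [Fin.sum_univ_two]
        simp only [Matrix.cons_val_zero, Matrix.cons_val_one]
        rw [← h, sub_sub_cancel]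
        exact dLambda_mem_coboundaries a b Q
      · intro p hp i
        exact Submodule.smul_mem _ _ (mem_filt_of_upTo (E := -1) hP hP0 hp (hmem i))
  · intro c hc
    have hmem' : ∑ i, c i • (![bottom2 M, bottom3 M] : Fin 2 → Polyvector) i ∈
        block M 0 ⊓ upTo (-1) :=
      Submodule.sum_mem _ fun i _ => Submodule.smul_mem _ _ (hmem i)
    obtain ⟨Q, hQ, hQd⟩ := exists_block_preimage hmem'.1 hc
    obtain ⟨Q', hQ'⟩ := exists_sub_mem_upTo (E := -1) (M + 2) hregular hQ
      (mem_upTo_of_mem_block hQ) (by rw [hQd]; exact hmem'.2)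
    have h0 : ∑ i, c i • (![bottom2 M, bottom3 M] : Fin 2 → Polyvector) i = 0 := by
      have := dLambda_bottom a b hQ'
      rwa [map_sub, dLambda_dLambda, sub_zero, hQd] at this
    rw [Fin.sum_univ_two] at h0
    obtain ⟨h1, h2⟩ := bottom_smul_eq_zero h0
    intro i
    fin_cases i
    · exact h1
    · exact h2

/-! ### Diagonal weights with a resonance -/

/-- The cohomology of weight `(M, 0)` in the presence of a resonance, a position `(e, e, M - 2e)`
where the quadratic part of the tensor acts by zero. The cocycles `g i` and the cochains `W`, `W'`
have leading terms in this position that form a basis of all possible leading terms; the coboundaries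
of `W` and `W'` kill the two bottom classes. -/
theorem blockRep_resonant {a b : ℝ} {M e : ℤ} (he : 0 ≤ e) (hk : -1 ≤ M - 2 * e)
    (hres : b * e = a * (M - 2 * e))
    (hreg : ∀ e' : ℤ, 0 ≤ e' → -1 ≤ M - 2 * e' → e' ≠ e → b * e' ≠ a * (M - 2 * e'))
    {ι : Type} [Fintype ι] {g : ι → Polyvector} (hg : ∀ i, g i ∈ block M 0 ⊓ upTo e)
    (hgc : ∀ i, ∃ c, g i ∈ lcIn (CochainTerm c)) (hgd : ∀ i, dLambda a b (g i) = 0)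
    {W W' : Polyvector} (hW : W ∈ block M 0 ⊓ upTo e) (hW' : W' ∈ block M 0 ⊓ upTo e)
    {w w' : ℝ} (hw : w ≠ 0) (hw' : w' ≠ 0) (hdW : dLambda a b W = w • bottom2 M)
    (hdW' : dLambda a b W' = w' • bottom3 M)
    (hspan : ∀ P : Polyvector, ∃ (c : ι → ℝ) (t t' : ℝ), ∀ I,
      lc e e (M - 2 * e) I (P - ∑ i, c i • g i - t • W - t' • W') = 0)
    (hind : ∀ c : ι → ℝ, (∀ I, lc e e (M - 2 * e) I (∑ i, c i • g i) = 0) → ∀ i, c i = 0) :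
    BlockRep a b M 0 g := by
  have hsum : ∀ c : ι → ℝ, ∑ i, c i • g i ∈ block M 0 ⊓ upTo e := fun c =>
    Submodule.sum_mem _ fun i _ => Submodule.smul_mem _ _ (hg i)
  have hsumd : ∀ c : ι → ℝ, dLambda a b (∑ i, c i • g i) = 0 := fun c => by
    simp [map_sum, hgd]
  have hbot : ∀ s t : ℝ, s • bottom2 M + t • bottom3 M ∈ coboundaries a b := by
    intro s t
    refine ⟨(s / w) • W + (t / w') • W', ?_⟩
    rw [map_add, map_smul, map_smul, hdW, hdW', smul_smul, smul_smul, div_mul_cancel₀ _ hw,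
      div_mul_cancel₀ _ hw']
  -- below the resonance, the leading terms can be removed as in the absence of a resonance
  have hlow : ∀ P ∈ block M 0 ⊓ upTo (e - 1), dLambda a b P ∈ upTo (-1) →
      dLambda a b P = 0 ∧ P ∈ coboundaries a b := by
    intro P hP hPd
    obtain ⟨Q, hQ⟩ := exists_sub_mem_upTo (E := -1) (e - 1)
      (fun i j k h1 h2 h3 h4 _ _ h5 => regular_diag h1 h2 (by omega)
        (hreg j (by omega) (by omega) (by omega))) hP.1 hP.2 hPd
    have h1 := dLambda_bottom a b hQ
    rw [map_sub, dLambda_dLambda, sub_zero] at h1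
    refine ⟨h1, ?_⟩
    have h2 : P - dLambda a b Q ∈ coboundaries a b := by
      rw [eq_bottom hQ]
      exact hbot _ _
    have h3 := add_mem h2 (dLambda_mem_coboundaries a b Q)
    rwa [sub_add_cancel] at h3
  have hhigh : ∀ P ∈ block M 0, dLambda a b P ∈ upTo e →
      ∃ Q, P - dLambda a b Q ∈ block M 0 ⊓ upTo e := by
    intro P hP hPd
    exact exists_sub_mem_upTo (M + 2)
      (fun i j k h1 h2 h3 h4 _ _ h5 => regular_diag h1 h2 (by omega)
        (hreg j (by omega) (by omega) (by omega))) hP (mem_upTo_of_mem_block hP) hPd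
  have hpos : ∀ P ∈ block M 0 ⊓ upTo e, (∀ I, lc e e (M - 2 * e) I P = 0) →
      P ∈ block M 0 ⊓ upTo (e - 1) := by
    intro P hP h0
    refine ⟨hP.1, fun i j k I h => ?_⟩
    have h1 := hP.1 i j k I h
    have h2 : j ≤ e := hP.2 i j k I h
    unfold BlockTerm at h1
    by_contra h3
    obtain rfl : j = e := by omega
    obtain rfl : i = j := by omega
    obtain rfl : k = M - 2 * i := by omega
    exact h (h0 I)
  refine ⟨fun i => (hg i).1, hgc, hgd, ?_, ?_⟩
  · intro P hP hPc
    rw [mem_cocycles] at hPc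
    by_cases hPe : P ∈ upTo (e - 1)
    · refine ⟨0, ?_, fun p _ i => by simp⟩
      simpa using (hlow P ⟨hP, hPe⟩ (by rw [hPc]; exact zero_mem _)).2
    · obtain ⟨Q, hQ⟩ := hhigh P hP (by rw [hPc]; exact zero_mem _)
      obtain ⟨c, t, t', hc⟩ := hspan (P - dLambda a b Q)
      refine ⟨c, ?_, fun p hp i =>
        Submodule.smul_mem _ _ (mem_filt_of_upTo hP hPe hp (hg i))⟩
      set R := P - dLambda a b Q - ∑ i, c i • g i - t • W - t' • W' with hR
      have hRm : R ∈ block M 0 ⊓ upTo (e - 1) :=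
        hpos R (sub_mem (sub_mem (sub_mem hQ (hsum c)) (Submodule.smul_mem _ _ hW))
          (Submodule.smul_mem _ _ hW')) hc
      have hRd : dLambda a b R = -((t * w) • bottom2 M + (t' * w') • bottom3 M) := by
        rw [hR, map_sub, map_sub, map_sub, map_sub, hPc, dLambda_dLambda, hsumd, map_smul,
          map_smul, hdW, hdW', smul_smul, smul_smul]
        abel
      obtain ⟨h1, h2⟩ := hlow R hRm (by
        rw [hRd]
        exact neg_mem (add_mem (Submodule.smul_mem _ _ (bottom2_mem M).2)
          (Submodule.smul_mem _ _ (bottom3_mem M).2)))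
      rw [hRd, neg_eq_zero] at h1
      obtain ⟨h3, h4⟩ := bottom_smul_eq_zero h1
      classical
      have ht : t = 0 := by
        have h5 := congrArg (lc (-1) (-1) (M + 2) {0, 1}) h3
        have h6 : Adm (-1) (-1) (M + 2) {0, 1} := by
          refine ⟨?_, ?_, ?_⟩ <;> simp only [ind_values] <;> omega
        rw [map_smul, bottom2, lc_ofLc, if_pos h6] at h5
        simpa [ext8_values, hw] using h5
      have ht' : t' = 0 := by
        have h5 := congrArg (lc (-1) (-1) (M + 2) {0, 1, 2}) h4
        have h6 : Adm (-1) (-1) (M + 2) {0, 1, 2} := by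
          refine ⟨?_, ?_, ?_⟩ <;> simp only [ind_values] <;> omega
        rw [map_smul, bottom3, lc_ofLc, if_pos h6] at h5
        simpa [ext8_values, hw'] using h5
      have h5 := add_mem h2 (dLambda_mem_coboundaries a b Q)
      rw [hR, ht, ht', zero_smul, zero_smul, sub_zero, sub_zero] at h5
      convert h5 using 1
      abel
  · intro c hc
    obtain ⟨Q, hQ, hQd⟩ := exists_block_preimage (hsum c).1 hc
    obtain ⟨Q', hQ'⟩ := hhigh Q hQ (by rw [hQd]; exact (hsum c).2)
    have h0 : dLambda a b (Q - dLambda a b Q') = ∑ i, c i • g i := by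
      rw [map_sub, dLambda_dLambda, sub_zero, hQd]
    have h1 := hind c fun I => by
      rw [← h0]
      set R := Q - dLambda a b Q'
      have hn : ∀ I, lc (e + 1) (e + 1) (M - 2 * e - 2) I R = 0 := fun I =>
        lc_eq_zero_of_mem hQ'.2 (by omega)
      have hX : b * e - a * ((M - 2 * e : ℤ) : ℝ) = 0 := by
        push_cast; linarith
      have hX' : a * ((M - 2 * e : ℤ) : ℝ) - b * e = 0 := by
        linarith
      rcases finset_fin_three_cases I with rfl | rfl | rfl | rfl | rfl | rfl | rfl | rfl <;>
      simp only [lc_dLambda_empty, lc_dLambda_0, lc_dLambda_1, lc_dLambda_2, lc_dLambda_01,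
        lc_dLambda_02, lc_dLambda_12, lc_dLambda_012, hn, hX, hX', sub_self] <;> ring
    intro i
    rw [h1 i, zero_smul]

/-! ### Chains along a resonant line -/

/-- Solutions of two-term recursions, with the final value `1` at `e` and no zero between `0` and
`e`. -/
theorem exists_chain (e : ℤ) (l r : ℤ → ℝ) (hl : ∀ j, 0 ≤ j → j < e → l j ≠ 0)
    (hr : ∀ j, 0 ≤ j → r j ≠ 0) : ∃ w : ℤ → ℝ, w e = 1 ∧ (∀ j, 0 ≤ j → j ≤ e → w j ≠ 0) ∧
      ∀ j, 0 ≤ j → j < e → l j * w j + r j * w (j + 1) = 0 := by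
  let v : ℕ → ℝ := fun n => Nat.rec 1 (fun n x => -(r (e - n - 1) / l (e - n - 1)) * x) n
  have hv0 : v 0 = 1 := rfl
  have hv : ∀ n : ℕ, v (n + 1) = -(r (e - n - 1) / l (e - n - 1)) * v n := fun n => rfl
  have hvn : ∀ n : ℕ, (n : ℤ) ≤ e → v n ≠ 0 := by
    intro n
    induction n with
    | zero => intro _; rw [hv0]; exact one_ne_zero
    | succ n ih =>
      intro h
      push_cast at h
      rw [hv]
      exact mul_ne_zero (neg_ne_zero.2 (div_ne_zero (hr _ (by omega))
        (hl _ (by omega) (by omega)))) (ih (by omega))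
  refine ⟨fun j => v (e - j).toNat, by simp [hv0], fun j h1 h2 => hvn _ (by omega), ?_⟩
  intro j h1 h2
  obtain ⟨n, hn⟩ := Int.eq_ofNat_of_zero_le (show 0 ≤ e - (j + 1) by omega)
  have h3 : (e - j).toNat = n + 1 := by omega
  have h4 : (e - (j + 1)).toNat = n := by omega
  have h5 : e - n - 1 = j := by omega
  dsimp only
  rw [h3, h4, hv, h5]
  field_simp [hl j h1 h2]
  ring

/-- The polyvector field `∑ x^j y^j z^(M-2j) F_j`, `0 ≤ j ≤ e`. -/
def chain (M e : ℤ) (F : ℤ → Finset (Fin 3) → ℝ) : Polyvector :=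
  ofLc fun i j k I => if i = j ∧ k = M - 2 * j ∧ 0 ≤ j ∧ j ≤ e then F j I else 0

theorem lc_chain {M e : ℤ} {F : ℤ → Finset (Fin 3) → ℝ}
    (hF : ∀ j I, 0 ≤ j → j ≤ e → F j I ≠ 0 → Adm j j (M - 2 * j) I) (i j k : ℤ)
    (I : Finset (Fin 3)) :
    lc i j k I (chain M e F) = if i = j ∧ k = M - 2 * j ∧ 0 ≤ j ∧ j ≤ e then F j I else 0 := by
  refine lc_ofLc_of_adm (F := fun i j k I =>
    if i = j ∧ k = M - 2 * j ∧ 0 ≤ j ∧ j ≤ e then F j I else 0) (fun i j k I h => ?_) i j k I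
  split_ifs at h with h1
  · obtain ⟨rfl, rfl, h2, h3⟩ := h1
    exact hF _ _ h2 h3 h
  · exact absurd rfl h

theorem chain_mem {M e : ℤ} {F : ℤ → Finset (Fin 3) → ℝ}
    (hF : ∀ j I, 0 ≤ j → j ≤ e → F j I ≠ 0 → Adm j j (M - 2 * j) I) :
    chain M e F ∈ block M 0 ⊓ upTo e := by
  constructor <;> intro i j k I h <;> rw [lc_chain hF] at h <;> split_ifs at h with h1
  · constructor <;> omega
  · exact absurd rfl h
  · exact h1.2.2.2
  · exact absurd rfl h

/-- If the coefficients `F` satisfy the recursions that express the vanishing of the coboundary in the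
positions `(j, j, M - 2j)`, `0 ≤ j < e`, then the coboundary of the chain is concentrated in the bottom
position `j = -1`; in the resonant position `j = e` it vanishes by `hres`. -/
theorem dLambda_chain_eq_bottom {a b : ℝ} {M e : ℤ} (he : 0 ≤ e) (hk : -1 ≤ M - 2 * e)
    (hres : b * e = a * (M - 2 * e)) {F : ℤ → Finset (Fin 3) → ℝ}
    (hF : ∀ j I, 0 ≤ j → j ≤ e → F j I ≠ 0 → Adm j j (M - 2 * j) I)
    {s t : ℝ}
    (h0 : ∀ j, 0 ≤ j → j ≤ e → F j ∅ = 0 ∧ F j {1} = 0 ∧ F j {0, 1} = 0 ∧ F j {1, 2} = 0)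
    (hrec0 : ∀ j, 0 ≤ j → j < e → (b * j - a * (M - 2 * j)) * F j {0} +
      ((j + 2) * F (j + 1) {0} - 2 * F (j + 1) {2}) = 0)
    (hrec2 : ∀ j, 0 ≤ j → j < e → (b * j - a * (M - 2 * j)) * F j {2} +
      (j + 1) * F (j + 1) {2} = 0)
    (hrec02 : ∀ j, 0 ≤ j → j < e → (b * j - a * (M - 2 * j)) * F j {0, 2} +
      (j + 2) * F (j + 1) {0, 2} = 0)
    (hs : F 0 {0} - 2 * F 0 {2} = s) (ht : F 0 {0, 2} = t) :
    dLambda a b (chain M e F) = s • bottom2 M + t • bottom3 M := by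
  classical
  refine ext_of_lc fun i j k I => ?_
  by_cases hc : i = j ∧ k = M - 2 * j ∧ -1 ≤ j ∧ j ≤ e
  · obtain ⟨rfl, rfl, h1, h2⟩ := hc
    rcases h1.eq_or_lt with rfl | h1
    · obtain ⟨z0, z1, z2, z3⟩ := h0 0 le_rfl he
      have hA : ∀ I, {0, 1} ⊆ I → Adm (-1) (-1) (M + 2) I := by
        intro I hI
        have e0 : ind I 0 = 1 := if_pos (hI (by decide))
        have e1 : ind I 1 = 1 := if_pos (hI (by decide))
        have e2 := ind_nonneg I 2
        refine ⟨?_, ?_, ?_⟩ <;> omega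
      have hA1 := hA {0, 1} (by decide)
      have hA2 := hA {0, 1, 2} (by decide)
      rcases finset_fin_three_cases I with rfl | rfl | rfl | rfl | rfl | rfl | rfl | rfl <;>
      simp only [lc_dLambda_empty, lc_dLambda_0, lc_dLambda_1, lc_dLambda_2, lc_dLambda_01,
        lc_dLambda_02, lc_dLambda_12, lc_dLambda_012, lc_chain hF, bottom2, bottom3, lc_ofLc,
        map_add, map_smul, ext8_values, smul_eq_mul] <;>
      norm_num [z0, z1, z2, z3, he, ← hs, ← ht, hA1, hA2]
    · have hj : 0 ≤ i := by omega
      obtain ⟨z0, z1, z2, z3⟩ := h0 i hj h2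
      have hi : i ≠ -1 := by omega
      rcases h2.eq_or_lt with rfl | h2
      · have hX : b * i - a * ((M : ℝ) - 2 * i) = 0 := by linarith
        have hX' : a * ((M : ℝ) - 2 * i) - b * i = 0 := by linarith
        rcases finset_fin_three_cases I with rfl | rfl | rfl | rfl | rfl | rfl | rfl | rfl <;>
        simp [lc_dLambda_empty, lc_dLambda_0, lc_dLambda_1, lc_dLambda_2, lc_dLambda_01,
          lc_dLambda_02, lc_dLambda_12, lc_dLambda_012, lc_chain hF, bottom2, bottom3, lc_ofLc,
          ext8_values, hi, hX, hX']
      · obtain ⟨y0, y1, y2, y3⟩ := h0 (i + 1) (by omega) (by omega)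
        have r0 := hrec0 i hj h2
        have r2 := hrec2 i hj h2
        have r02 := hrec02 i hj h2
        have c1 : M - 2 * i - 2 = M - 2 * (i + 1) := by ring
        have c2 : 0 ≤ i + 1 := by omega
        have c3 : i + 1 ≤ e := by omega
        rcases finset_fin_three_cases I with rfl | rfl | rfl | rfl | rfl | rfl | rfl | rfl <;>
        simp only [lc_dLambda_empty, lc_dLambda_0, lc_dLambda_1, lc_dLambda_2, lc_dLambda_01,
          lc_dLambda_02, lc_dLambda_12, lc_dLambda_012, lc_chain hF, bottom2, bottom3, lc_ofLc,
          ext8_values, hi, map_add, map_smul, c1, c2, c3, hj, h2.le, and_self, if_true, if_false,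
          z0, z1, z2, z3, y0, y1, y2, y3, false_and, ite_self, smul_zero, add_zero] <;>
        push_cast <;>
        linarith
  · have h1 : ∀ I, lc i j k I (chain M e F) = 0 := by
      intro I
      rw [lc_chain hF, if_neg (by omega)]
    have h2 : ∀ I, lc (i + 1) (j + 1) (k - 2) I (chain M e F) = 0 := by
      intro I
      rw [lc_chain hF, if_neg (by omega)]
    rw [lc_dLambda_eq_zero a b h1 h2]
    have h3 : ¬ (i = -1 ∧ j = -1 ∧ k = M + 2) := by omega
    simp [bottom2, bottom3, lc_ofLc, h3]

/-! ### The fields that generate the summands -/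

/-- `ω = x^(-s) y^(-t) z^(-u) Ω`, with `Ω` in the exterior algebra of `⟨Y₁, Y₂, Y₃⟩`. -/
def HasFrame (ω : Polyvector) (s t u : ℤ) (Ω : Finset (Fin 3) → ℝ) : Prop :=
  ∀ (f : FSeries) (i j k : ℤ) (I : Finset (Fin 3)),
    lc i j k I (f • ω) = cf (i + s) (j + t) (k + u) f * Ω I

theorem hasFrame_unit : HasFrame unit 0 0 0 (ext8 1 0 0 0 0 0 0 0) := by
  intro f i j k I
  rcases finset_fin_three_cases I with rfl | rfl | rfl | rfl | rfl | rfl | rfl | rfl <;>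
  simp (decide := true) [lc_apply, ext8_values, ind_values, unit]

theorem mul_X_eq (s : Fin 3) (f : FSeries) : f * X s = X s * f := mul_comm _ _

theorem hasFrame_Y1Y3 : HasFrame (Y1 + (1 / 2 : ℝ) • Y3) 0 0 0 (ext8 0 1 0 (1 / 2) 0 0 0 0) := by
  intro f i j k I
  rcases finset_fin_three_cases I with rfl | rfl | rfl | rfl | rfl | rfl | rfl | rfl <;>
  simp (decide := true) [lc_apply, ext8_values, ind_values, Y1, Y3, pd, mul_X_eq, cf_X_mul,
    mul_comm (cf _ _ _ f)]

theorem hasFrame_Y2Y3 : HasFrame (Y2 + (1 / 2 : ℝ) • Y3) 0 0 0 (ext8 0 0 1 (1 / 2) 0 0 0 0) := by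
  intro f i j k I
  rcases finset_fin_three_cases I with rfl | rfl | rfl | rfl | rfl | rfl | rfl | rfl <;>
  simp (decide := true) [lc_apply, ext8_values, ind_values, Y2, Y3, pd, mul_X_eq, cf_X_mul,
    mul_comm (cf _ _ _ f)]

theorem mul_X_mul_X (s t : Fin 3) (f : FSeries) : f * (X s * X t) = X s * (X t * f) := by ring

theorem mul_X_mul_X_mul_X (r s t : Fin 3) (f : FSeries) :
    f * (X r * X s * X t) = X r * (X s * (X t * f)) := by ring

theorem hasFrame_Y23Y31 : HasFrame (Y23 + Y31) 0 0 0 (ext8 0 0 0 0 0 (-1) 1 0) := by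
  intro f i j k I
  rcases finset_fin_three_cases I with rfl | rfl | rfl | rfl | rfl | rfl | rfl | rfl <;>
  simp (decide := true) [lc_apply, ext8_values, ind_values, Y23, Y31, Y1, Y2, Y3, pd, wedge_empty,
    wedge_0, wedge_1, wedge_2, wedge_01, wedge_02, wedge_12, wedge_012, mul_X_mul_X, cf_X_mul]

theorem hasFrame_Y12 : HasFrame Y12 0 0 0 (ext8 0 0 0 0 1 0 0 0) := by
  intro f i j k I
  rcases finset_fin_three_cases I with rfl | rfl | rfl | rfl | rfl | rfl | rfl | rfl <;>
  simp (decide := true) [lc_apply, ext8_values, ind_values, Y12, Y1, Y2, pd, wedge_empty,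
    wedge_0, wedge_1, wedge_2, wedge_01, wedge_02, wedge_12, wedge_012, mul_X_mul_X, cf_X_mul]

theorem hasFrame_Y123 : HasFrame Y123 0 0 0 (ext8 0 0 0 0 0 0 0 1) := by
  intro f i j k I
  rcases finset_fin_three_cases I with rfl | rfl | rfl | rfl | rfl | rfl | rfl | rfl <;>
  simp (decide := true) [lc_apply, ext8_values, ind_values, Y123, Y12, Y1, Y2, Y3, pd, wedge_empty,
    wedge_0, wedge_1, wedge_2, wedge_01, wedge_02, wedge_12, wedge_012, mul_X_mul_X_mul_X, cf_X_mul]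

theorem hasFrame_pd12 : HasFrame pd12 1 1 0 (ext8 0 0 0 0 1 0 0 0) := by
  intro f i j k I
  rcases finset_fin_three_cases I with rfl | rfl | rfl | rfl | rfl | rfl | rfl | rfl <;>
  simp (decide := true) [lc_apply, ext8_values, ind_values, pd12, pd, wedge_empty,
    wedge_0, wedge_1, wedge_2, wedge_01, wedge_02, wedge_12, wedge_012]

theorem hasFrame_pd23 : HasFrame pd23 0 1 1 (ext8 0 0 0 0 0 0 1 0) := by
  intro f i j k I
  rcases finset_fin_three_cases I with rfl | rfl | rfl | rfl | rfl | rfl | rfl | rfl <;>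
  simp (decide := true) [lc_apply, ext8_values, ind_values, pd23, pd, wedge_empty,
    wedge_0, wedge_1, wedge_2, wedge_01, wedge_02, wedge_12, wedge_012]

theorem hasFrame_pd31 : HasFrame pd31 1 0 1 (ext8 0 0 0 0 0 (-1) 0 0) := by
  intro f i j k I
  rcases finset_fin_three_cases I with rfl | rfl | rfl | rfl | rfl | rfl | rfl | rfl <;>
  simp (decide := true) [lc_apply, ext8_values, ind_values, pd31, pd, wedge_empty,
    wedge_0, wedge_1, wedge_2, wedge_01, wedge_02, wedge_12, wedge_012]

theorem hasFrame_pd123 : HasFrame pd123 1 1 1 (ext8 0 0 0 0 0 0 0 1) := by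
  intro f i j k I
  rcases finset_fin_three_cases I with rfl | rfl | rfl | rfl | rfl | rfl | rfl | rfl <;>
  simp (decide := true) [lc_apply, ext8_values, ind_values, pd123, pd12, pd, wedge_empty,
    wedge_0, wedge_1, wedge_2, wedge_01, wedge_02, wedge_12, wedge_012]

theorem HasFrame.mem_cochain {ω : Polyvector} {s t u : ℤ} {Ω : Finset (Fin 3) → ℝ}
    (h : HasFrame ω s t u Ω) {c : ℤ} (hΩ : ∀ I, Ω I ≠ 0 → (I.card : ℤ) = c) (f : FSeries) :
    f • ω ∈ lcIn (CochainTerm c) := by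
  intro i j k I hI
  rw [h] at hI
  exact hΩ I (right_ne_zero_of_mul hI)

theorem HasFrame.mem_block {ω : Polyvector} {Ω : Finset (Fin 3) → ℝ} (h : HasFrame ω 0 0 0 Ω)
    {M e : ℤ} {f : FSeries} (hf : ∀ i j k, cf i j k f ≠ 0 → i = j ∧ k = M - 2 * j ∧ j ≤ e) :
    f • ω ∈ block M 0 ⊓ upTo e := by
  constructor <;> intro i j k I hI <;> rw [h] at hI <;>
  have h1 := hf _ _ _ (left_ne_zero_of_mul hI) <;> simp only [add_zero] at h1
  · constructor <;> omega
  · exact h1.2.2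

theorem lc_dLambda_unit {a b : ℝ} {f : FSeries} (hf : dLambda a b (f • unit) = 0) (i j k : ℤ) :
    ((b * j - a * k) * cf i j k f + (j + 1) * cf (i + 1) (j + 1) (k - 2) f = 0) ∧
    ((a * k - b * i) * cf i j k f - (i + 1) * cf (i + 1) (j + 1) (k - 2) f = 0) ∧
    (a * (i - j)) * cf i j k f = 0 := by
  have h0 := lc_dLambda_0 a b (f • unit) i j k
  have h1 := lc_dLambda_1 a b (f • unit) i j k
  have h2 := lc_dLambda_2 a b (f • unit) i j k
  rw [hf, map_zero] at h0 h1 h2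
  simp only [hasFrame_unit f, ext8_values, add_zero, mul_one] at h0 h1 h2
  exact ⟨h0.symm, h1.symm, h2.symm⟩

theorem dLambda_smul_Y1Y3 {a b : ℝ} {f : FSeries} (hf : dLambda a b (f • unit) = 0) :
    dLambda a b (f • (Y1 + (1 / 2 : ℝ) • Y3)) = 0 := by
  refine ext_of_lc fun i j k I => ?_
  obtain ⟨h0, h1, h2⟩ := lc_dLambda_unit hf i j k
  rcases finset_fin_three_cases I with rfl | rfl | rfl | rfl | rfl | rfl | rfl | rfl <;>
  simp only [lc_dLambda_empty, lc_dLambda_0, lc_dLambda_1, lc_dLambda_2, lc_dLambda_01,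
    lc_dLambda_02, lc_dLambda_12, lc_dLambda_012, hasFrame_Y1Y3 f, ext8_values, add_zero, map_zero]
  all_goals try ring1
  · linear_combination -h1
  · linear_combination (1 / 2) * h0 - h2
  · linear_combination (1 / 2) * h1

theorem dLambda_smul_Y2Y3 {a b : ℝ} {f : FSeries} (hf : dLambda a b (f • unit) = 0) :
    dLambda a b (f • (Y2 + (1 / 2 : ℝ) • Y3)) = 0 := by
  refine ext_of_lc fun i j k I => ?_
  obtain ⟨h0, h1, h2⟩ := lc_dLambda_unit hf i j k
  rcases finset_fin_three_cases I with rfl | rfl | rfl | rfl | rfl | rfl | rfl | rfl <;>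
  simp only [lc_dLambda_empty, lc_dLambda_0, lc_dLambda_1, lc_dLambda_2, lc_dLambda_01,
    lc_dLambda_02, lc_dLambda_12, lc_dLambda_012, hasFrame_Y2Y3 f, ext8_values, add_zero, map_zero]
  all_goals try ring1
  · linear_combination h0
  · linear_combination (1 / 2) * h0
  · linear_combination (1 / 2) * h1 - h2

/-- A bivector field `f (Y₂₃ + Y₃₁) / (x^s y^t z^u)` is a cocycle if all its terms have equal exponents
of `x` and `y`. -/
theorem dLambda_eq_zero_of_Y23Y31 (a b : ℝ) {P : Polyvector} {c : ℤ → ℤ → ℤ → ℝ}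
    (hP : ∀ i j k I, lc i j k I P = c i j k * ext8 0 0 0 0 0 (-1) 1 0 I)
    (hc : ∀ i j k, c i j k ≠ 0 → i = j) : dLambda a b P = 0 := by
  refine ext_of_lc fun i j k I => ?_
  rcases finset_fin_three_cases I with rfl | rfl | rfl | rfl | rfl | rfl | rfl | rfl <;>
  simp only [lc_dLambda_empty, lc_dLambda_0, lc_dLambda_1, lc_dLambda_2, lc_dLambda_01,
    lc_dLambda_02, lc_dLambda_12, lc_dLambda_012, hP, ext8_values, map_zero]
  all_goals try ring1
  rcases eq_or_ne i j with rfl | h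
  · ring
  · have h1 : c i j k = 0 := by by_contra h1; exact h (hc _ _ _ h1)
    have h2 : c (i + 1) (j + 1) (k - 2) = 0 := by
      by_contra h2
      have := hc _ _ _ h2
      omega
    rw [h1, h2]; ring

theorem dLambda_smul_Y12 (a b : ℝ) {f : FSeries} (hf : ∀ i j k, cf i j k f ≠ 0 → i = j) :
    dLambda a b (f • Y12) = 0 := by
  refine ext_of_lc fun i j k I => ?_
  rcases finset_fin_three_cases I with rfl | rfl | rfl | rfl | rfl | rfl | rfl | rfl <;>
  simp only [lc_dLambda_empty, lc_dLambda_0, lc_dLambda_1, lc_dLambda_2, lc_dLambda_01,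
    lc_dLambda_02, lc_dLambda_12, lc_dLambda_012, hasFrame_Y12 f, ext8_values, add_zero, map_zero]
  all_goals try ring1
  rcases eq_or_ne i j with rfl | h
  · ring
  · have h1 : cf i j k f = 0 := by by_contra h1; exact h (hf _ _ _ h1)
    rw [h1]; ring

/-- Polyvector fields of degree `3` are cocycles. -/
theorem dLambda_eq_zero_of_degree_three (a b : ℝ) {P : Polyvector}
    (hP : P ∈ lcIn (CochainTerm 3)) : dLambda a b P = 0 := by
  have h1 := dLambda_restrict_cochain a b 3 P
  rw [restrict_of_mem hP] at h1
  rw [h1]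
  refine ext_of_lc fun i j k I => ?_
  rw [lc_restrict, if_neg, map_zero]
  have := Finset.card_le_univ I
  unfold CochainTerm
  simp only [Fintype.card_fin] at this
  omega

/-! ### The generators in a resonant weight -/

theorem card_of_ext8_ne_zero (x y z : ℝ) (I : Finset (Fin 3)) :
    (ext8 x 0 0 0 0 0 0 0 I ≠ 0 → (I.card : ℤ) = 0) ∧
    (ext8 0 x y z 0 0 0 0 I ≠ 0 → (I.card : ℤ) = 1) ∧
    (ext8 0 0 0 0 x y z 0 I ≠ 0 → (I.card : ℤ) = 2) ∧
    (ext8 0 0 0 0 0 0 0 x I ≠ 0 → (I.card : ℤ) = 3) := by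
  rcases finset_fin_three_cases I with rfl | rfl | rfl | rfl | rfl | rfl | rfl | rfl <;>
  simp only [ext8_values, ne_eq, not_true_eq_false, false_imp_iff, true_and, and_true] <;>
  intro _ <;> rfl

/-- The coefficients of the cochains `W`: see `exists_chain`. -/
theorem exists_resonant_chain {a b : ℝ} {M e : ℤ} (hk : -1 ≤ M - 2 * e)
    (hreg : ∀ e' : ℤ, 0 ≤ e' → -1 ≤ M - 2 * e' → e' ≠ e → b * e' ≠ a * (M - 2 * e')) (n : ℕ)
    (hn : 0 < n) : ∃ w : ℤ → ℝ, w e = 1 ∧ (∀ j, 0 ≤ j → j ≤ e → w j ≠ 0) ∧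
      ∀ j, 0 ≤ j → j < e → (b * j - a * (M - 2 * j)) * w j + (j + n) * w (j + 1) = 0 := by
  refine exists_chain e (fun j => b * j - a * (M - 2 * j)) (fun j => j + n) ?_ ?_
  · intro j h1 h2
    exact sub_ne_zero.2 (hreg j h1 (by omega) h2.ne)
  · intro j h1
    have h2 : (0 : ℝ) ≤ j := by exact_mod_cast h1
    have h3 : (0 : ℝ) < n := by exact_mod_cast hn
    positivity

/-- The cochain `W'` in degree `2`, with leading term `Y₁ ∧ Y₃`. -/
theorem exists_cochain_two {a b : ℝ} {M e : ℤ} (he : 0 ≤ e) (hk : -1 ≤ M - 2 * e)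
    (hres : b * e = a * (M - 2 * e))
    (hreg : ∀ e' : ℤ, 0 ≤ e' → -1 ≤ M - 2 * e' → e' ≠ e → b * e' ≠ a * (M - 2 * e')) :
    ∃ W ∈ block M 0 ⊓ upTo e, ∃ w : ℝ, w ≠ 0 ∧ dLambda a b W = w • bottom3 M ∧
      ∀ I, lc e e (M - 2 * e) I W = ext8 0 0 0 0 0 1 0 0 I := by
  obtain ⟨w, hwe, hw0, hw⟩ := exists_resonant_chain hk hreg 2 (by norm_num)
  have hF : ∀ j I, 0 ≤ j → j ≤ e → ext8 0 0 0 0 0 (w j) 0 0 I ≠ 0 →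
      Adm j j (M - 2 * j) I := by
    intro j I h1 h2 h3
    rcases finset_fin_three_cases I with rfl | rfl | rfl | rfl | rfl | rfl | rfl | rfl <;>
    simp only [ext8_values, ne_eq, not_true_eq_false] at h3
    simp only [Adm, ind_values]
    omega
  refine ⟨chain M e fun j => ext8 0 0 0 0 0 (w j) 0 0, chain_mem hF, w 0, hw0 0 le_rfl he, ?_, ?_⟩
  · rw [dLambda_chain_eq_bottom he hk hres hF (s := 0) (t := w 0)]
    · simp
    · simp [ext8_values]
    · simp [ext8_values]
    · simp [ext8_values]
    · intro j h1 h2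
      simpa only [ext8_values, Nat.cast_ofNat] using hw j h1 h2
    · simp [ext8_values]
    · simp [ext8_values]
  · intro I
    rw [lc_chain hF, if_pos ⟨rfl, rfl, he, le_rfl⟩, hwe]

/-- The cochain `W` in degree `1`, with leading term `Y₁`. -/
theorem exists_cochain_one {a b : ℝ} {M e : ℤ} (he : 0 ≤ e) (hk : 0 ≤ M - 2 * e)
    (hres : b * e = a * (M - 2 * e))
    (hreg : ∀ e' : ℤ, 0 ≤ e' → -1 ≤ M - 2 * e' → e' ≠ e → b * e' ≠ a * (M - 2 * e')) :
    ∃ W ∈ block M 0 ⊓ upTo e, ∃ w : ℝ, w ≠ 0 ∧ dLambda a b W = w • bottom2 M ∧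
      ∀ I, lc e e (M - 2 * e) I W = ext8 0 1 0 0 0 0 0 0 I := by
  obtain ⟨w, hwe, hw0, hw⟩ := exists_resonant_chain (by omega) hreg 2 (by norm_num)
  have hF : ∀ j I, 0 ≤ j → j ≤ e → ext8 0 (w j) 0 0 0 0 0 0 I ≠ 0 →
      Adm j j (M - 2 * j) I := by
    intro j I h1 h2 h3
    rcases finset_fin_three_cases I with rfl | rfl | rfl | rfl | rfl | rfl | rfl | rfl <;>
    simp only [ext8_values, ne_eq, not_true_eq_false] at h3
    simp only [Adm, ind_values]
    omega
  refine ⟨chain M e fun j => ext8 0 (w j) 0 0 0 0 0 0, chain_mem hF, w 0, hw0 0 le_rfl he, ?_, ?_⟩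
  · rw [dLambda_chain_eq_bottom he (by omega) hres hF (s := w 0) (t := 0)]
    · simp
    · simp [ext8_values]
    · intro j h1 h2
      simpa only [ext8_values, mul_zero, sub_zero, Nat.cast_ofNat] using hw j h1 h2
    · simp [ext8_values]
    · simp [ext8_values]
    · simp [ext8_values]
    · simp [ext8_values]
  · intro I
    rw [lc_chain hF, if_pos ⟨rfl, rfl, he, le_rfl⟩, hwe]

/-- The cochain `W` in degree `1` for a resonance with the exponent `-1` of `z`, where only the leading
term `Y₃` is possible. It combines the chains through `Y₁ + Y₃ / 2` and `Y₁`. -/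
theorem exists_cochain_one_boundary {a b : ℝ} {M e : ℤ} (he : 0 ≤ e) (hk : M - 2 * e = -1)
    (hres : b * e = a * (M - 2 * e))
    (hreg : ∀ e' : ℤ, 0 ≤ e' → -1 ≤ M - 2 * e' → e' ≠ e → b * e' ≠ a * (M - 2 * e')) :
    ∃ W ∈ block M 0 ⊓ upTo e, ∃ w : ℝ, w ≠ 0 ∧ dLambda a b W = w • bottom2 M ∧
      ∀ I, lc e e (M - 2 * e) I W = ext8 0 0 0 1 0 0 0 0 I := by
  obtain ⟨w, hwe, hw0, hw⟩ := exists_resonant_chain (by omega) hreg 2 (by norm_num)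
  obtain ⟨v, hve, -, hv⟩ := exists_resonant_chain (by omega) hreg 1 (by norm_num)
  have hF : ∀ j I, 0 ≤ j → j ≤ e → ext8 0 (2 * v j - 2 * w j) 0 (v j) 0 0 0 0 I ≠ 0 →
      Adm j j (M - 2 * j) I := by
    intro j I h1 h2 h3
    have h4 : j = e → 2 * v j - 2 * w j = 0 := by
      rintro rfl
      rw [hve, hwe, sub_self]
    rcases finset_fin_three_cases I with rfl | rfl | rfl | rfl | rfl | rfl | rfl | rfl <;>
    simp only [ext8_values, ne_eq, not_true_eq_false] at h3
    · have h5 : j ≠ e := fun h => h3 (h4 h)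
      simp only [Adm, ind_values]
      omega
    · simp only [Adm, ind_values]
      omega
  refine ⟨chain M e fun j => ext8 0 (2 * v j - 2 * w j) 0 (v j) 0 0 0 0, chain_mem hF, -2 * w 0,
    mul_ne_zero (by norm_num) (hw0 0 le_rfl he), ?_, ?_⟩
  · rw [dLambda_chain_eq_bottom he (by omega) hres hF (s := -2 * w 0) (t := 0)]
    · simp
    · simp [ext8_values]
    · intro j h1 h2
      have h3 := hw j h1 h2
      have h4 := hv j h1 h2
      push_cast at h3 h4
      simp only [ext8_values]
      linear_combination 2 * h4 - 2 * h3
    · intro j h1 h2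
      simpa only [ext8_values, Nat.cast_one] using hv j h1 h2
    · simp [ext8_values]
    · simp only [ext8_values]; ring
    · simp [ext8_values]
  · intro I
    rw [lc_chain hF, if_pos ⟨rfl, rfl, he, le_rfl⟩, hwe, hve, sub_self]

/-- The generators of the cohomology in a resonant weight: `F` is a Casimir of the tensor and `G` its
leading monomial. -/
def resonantGens (F G : FSeries) : Fin 6 → Polyvector :=
  ![F • unit, F • (Y1 + (1 / 2 : ℝ) • Y3), F • (Y2 + (1 / 2 : ℝ) • Y3), G • (Y23 + Y31), G • Y12,
    G • Y123]

theorem blockRep_resonantGens {a b : ℝ} {M e : ℤ} (he : 0 ≤ e) (hk : 0 ≤ M - 2 * e)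
    (hres : b * e = a * (M - 2 * e))
    (hreg : ∀ e' : ℤ, 0 ≤ e' → -1 ≤ M - 2 * e' → e' ≠ e → b * e' ≠ a * (M - 2 * e'))
    {F G : FSeries} (hF : ∀ i j k, cf i j k F ≠ 0 → i = j ∧ k = M - 2 * j ∧ j ≤ e)
    (hG : ∀ i j k, cf i j k G ≠ 0 → i = j ∧ k = M - 2 * j ∧ j ≤ e)
    (hF1 : cf e e (M - 2 * e) F = 1) (hG1 : cf e e (M - 2 * e) G = 1)
    (hFd : dLambda a b (F • unit) = 0) : BlockRep a b M 0 (resonantGens F G) := by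
  obtain ⟨W, hW, w, hw, hdW, hlW⟩ := exists_cochain_one he hk hres hreg
  obtain ⟨W', hW', w', hw', hdW', hlW'⟩ := exists_cochain_two he (by omega) hres hreg
  have hsum : ∀ (c : Fin 6 → ℝ) I, lc e e (M - 2 * e) I (∑ i, c i • resonantGens F G i) =
      ext8 (c 0) (c 1) (c 2) (c 1 / 2 + c 2 / 2) (c 4) (-c 3) (c 3) (c 5) I := by
    intro c I
    simp only [Fin.sum_univ_six, resonantGens, map_add, map_smul, Matrix.cons_val, hasFrame_unit F,
      hasFrame_Y1Y3 F, hasFrame_Y2Y3 F, hasFrame_Y23Y31 G, hasFrame_Y12 G, hasFrame_Y123 G,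
      add_zero, hF1, hG1, smul_eq_mul]
    rcases finset_fin_three_cases I with rfl | rfl | rfl | rfl | rfl | rfl | rfl | rfl <;>
    simp only [ext8_values] <;> ring
  refine blockRep_resonant he (by omega) hres hreg ?_ ?_ ?_ hW hW' hw hw' hdW hdW' ?_ ?_
  · intro i
    fin_cases i
    · exact hasFrame_unit.mem_block hF
    · exact hasFrame_Y1Y3.mem_block hF
    · exact hasFrame_Y2Y3.mem_block hF
    · exact hasFrame_Y23Y31.mem_block hG
    · exact hasFrame_Y12.mem_block hG
    · exact hasFrame_Y123.mem_block hG
  · intro i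
    fin_cases i
    · exact ⟨0, hasFrame_unit.mem_cochain (fun I => (card_of_ext8_ne_zero _ 0 0 I).1) F⟩
    · exact ⟨1, hasFrame_Y1Y3.mem_cochain (fun I => (card_of_ext8_ne_zero _ _ _ I).2.1) F⟩
    · exact ⟨1, hasFrame_Y2Y3.mem_cochain (fun I => (card_of_ext8_ne_zero _ _ _ I).2.1) F⟩
    · exact ⟨2, hasFrame_Y23Y31.mem_cochain (fun I => (card_of_ext8_ne_zero _ _ _ I).2.2.1) G⟩
    · exact ⟨2, hasFrame_Y12.mem_cochain (fun I => (card_of_ext8_ne_zero _ _ _ I).2.2.1) G⟩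
    · exact ⟨3, hasFrame_Y123.mem_cochain (fun I => (card_of_ext8_ne_zero _ 0 0 I).2.2.2) G⟩
  · intro i
    fin_cases i
    · exact hFd
    · exact dLambda_smul_Y1Y3 hFd
    · exact dLambda_smul_Y2Y3 hFd
    · exact dLambda_eq_zero_of_Y23Y31 a b (c := fun i j k => cf i j k G)
        (fun i j k I => by
          have := hasFrame_Y23Y31 G i j k I
          rwa [add_zero, add_zero, add_zero] at this) fun i j k h => (hG i j k h).1
    · exact dLambda_smul_Y12 a b fun i j k h => (hG i j k h).1
    · refine dLambda_eq_zero_of_degree_three a b (hasFrame_Y123.mem_cochain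
        (fun I => (card_of_ext8_ne_zero _ 0 0 I).2.2.2) G)
  · intro P
    set p := fun I => lc e e (M - 2 * e) I P with hp
    refine ⟨![p ∅, 2 * p {2} - p {1}, p {1}, p {1, 2}, p {0, 1}, p {0, 1, 2}],
      p {0} - 2 * p {2} + p {1}, p {0, 2} + p {1, 2}, fun I => ?_⟩
    rw [map_sub, map_sub, map_sub, hsum, map_smul, map_smul, hlW, hlW']
    change p I - _ - _ - _ = 0
    rcases finset_fin_three_cases I with rfl | rfl | rfl | rfl | rfl | rfl | rfl | rfl <;>
    simp only [ext8_values, Matrix.cons_val, smul_eq_mul] <;> ring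
  · intro c hc i
    simp only [hsum] at hc
    have h0 := hc ∅
    have h1 := hc {0}
    have h2 := hc {1}
    have h3 := hc {1, 2}
    have h4 := hc {0, 1}
    have h5 := hc {0, 1, 2}
    simp only [ext8_values] at h0 h1 h2 h3 h4 h5
    fin_cases i
    · exact h0
    · exact h1
    · exact h2
    · exact h3
    · exact h4
    · exact h5

/-- The cohomology in a weight with a resonance at the exponent `-1` of `z`. -/
theorem blockRep_boundary {a b : ℝ} {M e : ℤ} (he : 0 ≤ e) (hk : M - 2 * e = -1)
    (hres : b * e = a * (M - 2 * e))
    (hreg : ∀ e' : ℤ, 0 ≤ e' → -1 ≤ M - 2 * e' → e' ≠ e → b * e' ≠ a * (M - 2 * e'))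
    {g2 g3 : Polyvector}
    (h2 : ∀ i j k I, lc i j k I g2 =
      (if i = e ∧ j = e ∧ k = -1 then 1 else 0) * ext8 0 0 0 0 0 (-1) 1 0 I)
    (h3 : ∀ i j k I, lc i j k I g3 =
      (if i = e ∧ j = e ∧ k = -1 then 1 else 0) * ext8 0 0 0 0 0 0 0 1 I) :
    BlockRep a b M 0 ![g2, g3] := by
  obtain ⟨W, hW, w, hw, hdW, hlW⟩ := exists_cochain_one_boundary he hk hres hreg
  obtain ⟨W', hW', w', hw', hdW', hlW'⟩ := exists_cochain_two he (by omega) hres hreg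
  have hsum : ∀ (c : Fin 2 → ℝ) I,
      lc e e (M - 2 * e) I (∑ i, c i • (![g2, g3] : Fin 2 → Polyvector) i) =
      ext8 0 0 0 0 0 (-c 0) (c 0) (c 1) I := by
    intro c I
    simp only [Fin.sum_univ_two, map_add, map_smul, Matrix.cons_val, h2, h3, hk, and_self, if_true,
      smul_eq_mul]
    rcases finset_fin_three_cases I with rfl | rfl | rfl | rfl | rfl | rfl | rfl | rfl <;>
    simp only [ext8_values] <;> ring
  have hm : ∀ (g : Polyvector) (Ω : Finset (Fin 3) → ℝ), (∀ i j k I, lc i j k I g =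
      (if i = e ∧ j = e ∧ k = -1 then 1 else 0) * Ω I) → g ∈ block M 0 ⊓ upTo e := by
    intro g Ω hg
    have h : ∀ i j k I, lc i j k I g ≠ 0 → i = e ∧ j = e ∧ k = -1 := by
      intro i j k I h
      by_contra h1
      simp [hg, h1] at h
    constructor <;> intro i j k I hI <;> obtain ⟨rfl, rfl, rfl⟩ := h i j k I hI
    · constructor <;> omega
    · exact le_rfl
  have hc2 : g2 ∈ lcIn (CochainTerm 2) := by
    intro i j k I hI
    rw [h2] at hI
    exact (card_of_ext8_ne_zero _ _ _ I).2.2.1 (right_ne_zero_of_mul hI)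
  have hc3 : g3 ∈ lcIn (CochainTerm 3) := by
    intro i j k I hI
    rw [h3] at hI
    exact (card_of_ext8_ne_zero _ 0 0 I).2.2.2 (right_ne_zero_of_mul hI)
  refine blockRep_resonant he (by omega) hres hreg ?_ ?_ ?_ hW hW' hw hw' hdW hdW' ?_ ?_
  · intro i
    fin_cases i
    · exact hm _ _ h2
    · exact hm _ _ h3
  · intro i
    fin_cases i
    · exact ⟨2, hc2⟩
    · exact ⟨3, hc3⟩
  · intro i
    fin_cases i
    · refine dLambda_eq_zero_of_Y23Y31 a b h2 fun i j k h => ?_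
      by_contra h1
      exact h (if_neg (by omega))
    · exact dLambda_eq_zero_of_degree_three a b hc3
  · intro P
    set p := fun I => lc e e (M - 2 * e) I P with hp
    have hz : ∀ I, ind I 2 = 0 → p I = 0 := by
      intro I hI
      by_contra h
      have h1 := (adm_of_lc_ne_zero h).2.2
      omega
    have z := hz ∅ (by simp only [ind_values])
    have z0 := hz {0} (by simp only [ind_values])
    have z1 := hz {1} (by simp only [ind_values])
    have z01 := hz {0, 1} (by simp only [ind_values])
    refine ⟨![p {1, 2}, p {0, 1, 2}], p {2}, p {0, 2} + p {1, 2}, fun I => ?_⟩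
    rw [map_sub, map_sub, map_sub, hsum, map_smul, map_smul, hlW, hlW']
    change p I - _ - _ - _ = 0
    rcases finset_fin_three_cases I with rfl | rfl | rfl | rfl | rfl | rfl | rfl | rfl <;>
    simp only [ext8_values, Matrix.cons_val, smul_eq_mul, z, z0, z1, z01] <;> ring
  · intro c hc i
    simp only [hsum] at hc
    have h0 := hc {1, 2}
    have h1 := hc {0, 1, 2}
    simp only [ext8_values] at h0 h1
    fin_cases i
    · exact h0
    · exact h1

/-! ### Weights off the diagonal -/

/-- Off the diagonal the third component `a (i - j)` of `X_κ` is nonzero, so that only exponents with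
`k = -1` may fail to be regular. This happens for `a = b` in the weights of `x^n ∂₂₃`, `x^(n+1) ∂₁₂₃`
and of `y^n ∂₃₁`, `y^(n+1) ∂₁₂₃`, which the hypothesis excludes. -/
theorem blockRep_offDiagonal {a b : ℝ} (ha : a ≠ 0) (hb : b ≠ 0) {M D : ℤ} (hD : D ≠ 0)
    (h : b = a → (0 < D → M + 3 ≠ D) ∧ (D < 0 → M + 3 ≠ -D)) :
    BlockRep a b M D (fun i : Fin 0 => i.elim0) := by
  refine blockRep_of_regular fun i j k h1 h2 hi hj hk => ?_
  have hij : (i : ℝ) - j ≠ 0 := by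
    intro h3
    have : ((i - j : ℤ) : ℝ) = 0 := by push_cast; exact h3
    rw [h2] at this
    exact hD (by exact_mod_cast this)
  by_cases hk0 : 0 ≤ k
  · exact Or.inl ⟨mul_ne_zero ha hij, hk0⟩
  obtain rfl : k = -1 := by omega
  rcases hi.eq_or_lt with rfl | hi
  · refine Or.inr (Or.inr ⟨fun h3 => ?_, by omega⟩)
    push_cast at h3
    exact (h (by linarith)).2 (by omega) (by omega)
  rcases hj.eq_or_lt with rfl | hj
  · refine Or.inr (Or.inl ⟨fun h3 => ?_, by omega⟩)
    push_cast at h3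
    exact (h (by linarith)).1 (by omega) (by omega)
  by_cases h3 : b * j - a * ((-1 : ℤ) : ℝ) = 0
  · refine Or.inr (Or.inr ⟨fun h4 => mul_ne_zero hb hij ?_, by omega⟩)
    linarith
  · exact Or.inr (Or.inl ⟨h3, by omega⟩)

/-- The cohomology of a weight that consists of a single position, where the tensor acts by zero. -/
theorem blockRep_single {a b : ℝ} {M D i₀ j₀ : ℤ}
    (hpos : ∀ i j k : ℤ, i + j + k = M → i - j = D → -1 ≤ i → -1 ≤ j → -1 ≤ k →
      i = i₀ ∧ j = j₀ ∧ k = -1)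
    (hM : i₀ + j₀ - 1 = M) (hD : i₀ - j₀ = D) {g2 g3 : Polyvector} {J : Finset (Fin 3)} {ε : ℝ}
    (hε : ε ≠ 0) (hJ : J.card = 2) (hadm : ∀ I, Adm i₀ j₀ (-1) I → I = J ∨ I = {0, 1, 2})
    (h2 : ∀ i j k I, lc i j k I g2 = if (i = i₀ ∧ j = j₀ ∧ k = -1) ∧ I = J then ε else 0)
    (h3 : ∀ i j k I, lc i j k I g3 = if (i = i₀ ∧ j = j₀ ∧ k = -1) ∧ I = {0, 1, 2} then 1 else 0)
    (hd : dLambda a b g2 = 0) : BlockRep a b M D ![g2, g3] := by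
  have hJ3 : J ≠ {0, 1, 2} := by
    rintro rfl
    revert hJ; decide
  have hm2 : g2 ∈ block M D := by
    intro i j k I h
    rw [h2] at h
    split_ifs at h with h1
    · obtain ⟨⟨rfl, rfl, rfl⟩, -⟩ := h1
      constructor <;> omega
    · exact absurd rfl h
  have hm3 : g3 ∈ block M D := by
    intro i j k I h
    rw [h3] at h
    split_ifs at h with h1
    · obtain ⟨⟨rfl, rfl, rfl⟩, -⟩ := h1
      constructor <;> omega
    · exact absurd rfl h
  have hc2 : g2 ∈ lcIn (CochainTerm 2) := by
    intro i j k I h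
    rw [h2] at h
    split_ifs at h with h1
    · rw [h1.2, CochainTerm, hJ]; rfl
    · exact absurd rfl h
  have hc3 : g3 ∈ lcIn (CochainTerm 3) := by
    intro i j k I h
    rw [h3] at h
    split_ifs at h with h1
    · rw [h1.2]; rfl
    · exact absurd rfl h
  have hd3 : dLambda a b g3 = 0 := dLambda_eq_zero_of_degree_three a b hc3
  have heq : ∀ P ∈ block M D, P = (lc i₀ j₀ (-1) J P / ε) • g2 +
      lc i₀ j₀ (-1) {0, 1, 2} P • g3 := by
    intro P hP
    refine ext_of_lc fun i j k I => ?_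
    rw [map_add, map_smul, map_smul, h2, h3, smul_eq_mul, smul_eq_mul]
    by_cases h : lc i j k I P = 0
    · rw [h]
      by_cases h1 : (i = i₀ ∧ j = j₀ ∧ k = -1) ∧ I = J
      · obtain ⟨⟨rfl, rfl, rfl⟩, rfl⟩ := h1
        simp [h, hJ3]
      · by_cases h4 : (i = i₀ ∧ j = j₀ ∧ k = -1) ∧ I = {0, 1, 2}
        · obtain ⟨⟨rfl, rfl, rfl⟩, rfl⟩ := h4
          simp [h, Ne.symm hJ3]
        · simp [h1, h4]
    · have h1 := hP i j k I h
      have h4 := adm_of_lc_ne_zero h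
      have h5 := h4.neg_one_le
      obtain ⟨rfl, rfl, rfl⟩ := hpos i j k h1.1 h1.2 h5.1 h5.2.1 h5.2.2
      rcases hadm I h4 with rfl | rfl
      · simp [hJ3, div_mul_cancel₀ _ hε]
      · simp [Ne.symm hJ3]
  have hd0 : ∀ P ∈ block M D, dLambda a b P = 0 := by
    intro P hP
    rw [heq P hP, map_add, map_smul, map_smul, hd, hd3, smul_zero, smul_zero, add_zero]
  refine ⟨?_, ?_, ?_, ?_, ?_⟩
  · intro i
    fin_cases i
    · exact hm2
    · exact hm3
  · intro i
    fin_cases i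
    · exact ⟨2, hc2⟩
    · exact ⟨3, hc3⟩
  · intro i
    fin_cases i
    · exact hd
    · exact hd3
  · intro P hP _
    by_cases hP0 : P = 0
    · exact ⟨0, by simp [hP0], fun p _ i => by simp⟩
    refine ⟨![lc i₀ j₀ (-1) J P / ε, lc i₀ j₀ (-1) {0, 1, 2} P], ?_, ?_⟩
    · rw [Fin.sum_univ_two]
      simp only [Matrix.cons_val_zero, Matrix.cons_val_one]
      rw [← heq P hP, sub_self]
      exact zero_mem _
    · intro p hp i
      have hp0 : (p : ℤ) ≤ -1 + 1 := by
        rw [filt_eq] at hp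
        by_contra h
        refine hP0 (ext_of_lc fun i j k I => ?_)
        rw [map_zero]
        by_contra h1
        have h4 := (adm_of_lc_ne_zero h1).neg_one_le
        have h5 := hP i j k I h1
        obtain ⟨rfl, rfl, rfl⟩ := hpos i j k h5.1 h5.2 h4.1 h4.2.1 h4.2.2
        exact h (hp _ _ _ _ h1)
      rw [filt_eq]
      refine Submodule.smul_mem _ _ fun i j k I h => ?_
      have := (adm_of_lc_ne_zero h).neg_one_le
      dsimp only
      omega
  · intro c hc
    have hmem : ∑ i, c i • (![g2, g3] : Fin 2 → Polyvector) i ∈ block M D := by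
      rw [Fin.sum_univ_two]
      exact add_mem (Submodule.smul_mem _ _ hm2) (Submodule.smul_mem _ _ hm3)
    obtain ⟨Q, hQ, hQd⟩ := exists_block_preimage hmem hc
    rw [hd0 Q hQ, Fin.sum_univ_two] at hQd
    simp only [Matrix.cons_val_zero, Matrix.cons_val_one] at hQd
    have e2 := congrArg (lc i₀ j₀ (-1) J) hQd
    have e3 := congrArg (lc i₀ j₀ (-1) {0, 1, 2}) hQd
    rw [map_zero, map_add, map_smul, map_smul, h2, h3] at e2 e3
    simp [hJ3, hε] at e2
    simp [Ne.symm hJ3] at e3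
    intro i
    fin_cases i
    · simp [← e2]
    · simp [← e3]

theorem cf_X_pow_mul (s : Fin 3) (n : ℕ) (i j k : ℤ) (f : FSeries) : cf i j k (X s ^ n * f) =
    cf (i - if s = 0 then (n : ℤ) else 0) (j - if s = 1 then (n : ℤ) else 0)
      (k - if s = 2 then (n : ℤ) else 0) f := by
  induction n generalizing i j k with
  | zero => simp
  | succ n ih =>
    rw [pow_succ', mul_assoc, cf_X_mul, ih]
    congr 2 <;> push_cast <;> split_ifs <;> ring

theorem cf_one (i j k : ℤ) : cf i j k (1 : FSeries) = if i = 0 ∧ j = 0 ∧ k = 0 then 1 else 0 := by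
  by_cases h : 0 ≤ i ∧ 0 ≤ j ∧ 0 ≤ k
  · obtain ⟨hi, hj, hk⟩ := h
    lift i to ℕ using hi
    lift j to ℕ using hj
    lift k to ℕ using hk
    rw [cf_natCast, coeff_one]
    refine if_congr ?_ rfl rfl
    constructor
    · intro h
      have h0 := DFunLike.congr_fun h 0
      have h1 := DFunLike.congr_fun h 1
      have h2 := DFunLike.congr_fun h 2
      simp only [expo_apply, Finsupp.coe_zero, Pi.zero_apply] at h0 h1 h2
      simp [h0, h1, h2]
    · rintro ⟨h0, h1, h2⟩
      norm_cast at h0 h1 h2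
      subst h0 h1 h2
      exact expo_eq 0
  · rw [cf_eq_zero (by omega), if_neg (by omega)]

theorem cf_monomial (p q r : ℕ) (i j k : ℤ) : cf i j k (X 0 ^ p * (X 1 ^ q * (X 2 ^ r * 1))) =
    if i = p ∧ j = q ∧ k = r then 1 else 0 := by
  simp only [cf_X_pow_mul, cf_one]
  refine if_congr ?_ rfl rfl
  simp only [if_true, Fin.isValue, one_ne_zero, Fin.reduceEq, if_false, zero_ne_one]
  omega

theorem cf_X0_pow (n : ℕ) (i j k : ℤ) : cf i j k (X 0 ^ n : FSeries) =
    if i = n ∧ j = 0 ∧ k = 0 then 1 else 0 := by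
  simpa using cf_monomial n 0 0 i j k

theorem cf_X1_pow (n : ℕ) (i j k : ℤ) : cf i j k (X 1 ^ n : FSeries) =
    if i = 0 ∧ j = n ∧ k = 0 then 1 else 0 := by
  simpa using cf_monomial 0 n 0 i j k

theorem cf_X2_pow (n : ℕ) (i j k : ℤ) : cf i j k (X 2 ^ n : FSeries) =
    if i = 0 ∧ j = 0 ∧ k = n then 1 else 0 := by
  simpa using cf_monomial 0 0 n i j k

theorem dLambda_X0_pow_pd23 (a : ℝ) (n : ℕ) : dLambda a a ((X 0 ^ n : FSeries) • pd23) = 0 := by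
  refine ext_of_lc fun i j k I => ?_
  rcases finset_fin_three_cases I with rfl | rfl | rfl | rfl | rfl | rfl | rfl | rfl <;>
  simp only [lc_dLambda_empty, lc_dLambda_0, lc_dLambda_1, lc_dLambda_2, lc_dLambda_01,
    lc_dLambda_02, lc_dLambda_12, lc_dLambda_012, hasFrame_pd23 (X 0 ^ n), ext8_values, map_zero]
  all_goals try ring1
  simp only [cf_X0_pow, mul_one, mul_zero, sub_zero, add_zero]
  split_ifs with h1 h2 h2
  · omega
  · obtain ⟨-, h3, h4⟩ := h1
    obtain rfl : j = -1 := by omega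
    obtain rfl : k = -1 := by omega
    push_cast; ring
  · obtain ⟨-, h3, h4⟩ := h2
    obtain rfl : j = -2 := by omega
    push_cast; ring
  · ring

theorem dLambda_X1_pow_pd31 (a : ℝ) (n : ℕ) : dLambda a a ((X 1 ^ n : FSeries) • pd31) = 0 := by
  refine ext_of_lc fun i j k I => ?_
  rcases finset_fin_three_cases I with rfl | rfl | rfl | rfl | rfl | rfl | rfl | rfl <;>
  simp only [lc_dLambda_empty, lc_dLambda_0, lc_dLambda_1, lc_dLambda_2, lc_dLambda_01,
    lc_dLambda_02, lc_dLambda_12, lc_dLambda_012, hasFrame_pd31 (X 1 ^ n), ext8_values, map_zero]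
  all_goals try ring1
  simp only [cf_X1_pow, mul_one, mul_zero, sub_zero, add_zero]
  split_ifs with h1 h2 h2
  · omega
  · obtain ⟨h3, -, h4⟩ := h1
    obtain rfl : i = -1 := by omega
    obtain rfl : k = -1 := by omega
    push_cast; ring
  · obtain ⟨h3, -, h4⟩ := h2
    obtain rfl : i = -2 := by omega
    push_cast; ring
  · ring

theorem blockRep_X0 (a : ℝ) (n : ℕ) : BlockRep a a ((n : ℤ) - 2) (n + 1)
    ![(X 0 ^ n : FSeries) • pd23, (X 0 ^ (n + 1) : FSeries) • pd123] := by
  refine blockRep_single (i₀ := n) (j₀ := -1) (J := {1, 2}) (ε := 1) (fun i j k => by omega)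
    (by omega) (by omega) one_ne_zero (by decide) ?_ ?_ ?_ (dLambda_X0_pow_pd23 a n)
  · intro I hI
    rcases finset_fin_three_cases I with rfl | rfl | rfl | rfl | rfl | rfl | rfl | rfl <;>
    simp_all [Adm, ind_values]
  · intro i j k I
    rw [hasFrame_pd23, cf_X0_pow]
    rcases finset_fin_three_cases I with rfl | rfl | rfl | rfl | rfl | rfl | rfl | rfl <;>
    simp (decide := true) only [ext8_values, and_true, and_false, if_false, mul_zero, mul_one]
    exact if_congr (by omega) rfl rfl
  · intro i j k I
    rw [hasFrame_pd123, cf_X0_pow]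
    rcases finset_fin_three_cases I with rfl | rfl | rfl | rfl | rfl | rfl | rfl | rfl <;>
    simp (decide := true) only [ext8_values, and_true, and_false, if_false, mul_zero, mul_one]
    exact if_congr (by push_cast; omega) rfl rfl

theorem blockRep_X1 (a : ℝ) (n : ℕ) : BlockRep a a ((n : ℤ) - 2) (-(n + 1))
    ![(X 1 ^ n : FSeries) • pd31, (X 1 ^ (n + 1) : FSeries) • pd123] := by
  refine blockRep_single (i₀ := -1) (j₀ := n) (J := {0, 2}) (ε := -1) (fun i j k => by omega)
    (by omega) (by omega) (by norm_num) (by decide) ?_ ?_ ?_ (dLambda_X1_pow_pd31 a n)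
  · intro I hI
    rcases finset_fin_three_cases I with rfl | rfl | rfl | rfl | rfl | rfl | rfl | rfl <;>
    simp_all [Adm, ind_values]
  · intro i j k I
    rw [hasFrame_pd31, cf_X1_pow]
    rcases finset_fin_three_cases I with rfl | rfl | rfl | rfl | rfl | rfl | rfl | rfl <;>
    simp (decide := true) only [ext8_values, and_true, and_false, if_false, mul_zero]
    rw [ite_mul, one_mul, zero_mul]
    exact if_congr (by omega) rfl rfl
  · intro i j k I
    rw [hasFrame_pd123, cf_X1_pow]
    rcases finset_fin_three_cases I with rfl | rfl | rfl | rfl | rfl | rfl | rfl | rfl <;>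
    simp (decide := true) only [ext8_values, and_true, and_false, if_false, mul_zero, mul_one]
    exact if_congr (by push_cast; omega) rfl rfl

/-! ### Casimirs and powers of `z` -/

theorem bottom2_eq (n : ℕ) : (X 2 ^ n : FSeries) • pd12 = bottom2 ((n : ℤ) - 2) := by
  classical
  refine ext_of_lc fun i j k I => ?_
  rw [hasFrame_pd12, cf_X2_pow, bottom2, lc_ofLc]
  rcases finset_fin_three_cases I with rfl | rfl | rfl | rfl | rfl | rfl | rfl | rfl <;>
  simp only [ext8_values, ite_self, mul_zero, mul_one]
  rw [← ite_and]
  refine if_congr ?_ rfl rfl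
  simp only [Adm, ind_values]
  omega

theorem bottom3_eq (n : ℕ) : (X 2 ^ n : FSeries) • pd123 = bottom3 ((n : ℤ) - 3) := by
  classical
  refine ext_of_lc fun i j k I => ?_
  rw [hasFrame_pd123, cf_X2_pow, bottom3, lc_ofLc]
  rcases finset_fin_three_cases I with rfl | rfl | rfl | rfl | rfl | rfl | rfl | rfl <;>
  simp only [ext8_values, ite_self, mul_zero, mul_one]
  rw [← ite_and]
  refine if_congr ?_ rfl rfl
  simp only [Adm, ind_values]
  omega

theorem bottom2_eq_zero {M : ℤ} (h : M + 2 < 0) : bottom2 M = 0 := by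
  classical
  refine ext_of_lc fun i j k I => ?_
  rw [bottom2, lc_ofLc]
  rcases finset_fin_three_cases I with rfl | rfl | rfl | rfl | rfl | rfl | rfl | rfl <;>
  simp only [ext8_values, ite_self, map_zero]
  rw [← ite_and, if_neg]
  simp only [Adm, ind_values]
  omega

theorem bottom3_eq_zero {M : ℤ} (h : M + 3 < 0) : bottom3 M = 0 := by
  classical
  refine ext_of_lc fun i j k I => ?_
  rw [bottom3, lc_ofLc]
  rcases finset_fin_three_cases I with rfl | rfl | rfl | rfl | rfl | rfl | rfl | rfl <;>
  simp only [ext8_values, ite_self, map_zero]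
  rw [← ite_and, if_neg]
  simp only [Adm, ind_values]
  omega

/-- The quadratic factor `xy + z² / (2a + b)` of the Casimirs. -/
def casFactor (a b : ℝ) : FSeries := X 0 * X 1 + (1 / (2 * a + b)) • X 2 ^ 2

theorem cf_casFactor_mul (a b : ℝ) (f : FSeries) (i j k : ℤ) : cf i j k (casFactor a b * f) =
    cf (i - 1) (j - 1) k f + 1 / (2 * a + b) * cf i j (k - 2) f := by
  rw [casFactor, add_mul, smul_mul_assoc, map_add, map_smul, mul_assoc, cf_X0_mul, cf_X1_mul,
    cf_X_pow_mul]
  simp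

theorem cf_casFactor_pow_mul_ne_zero {a b : ℝ} (n m : ℕ) {i j k : ℤ}
    (h : cf i j k (casFactor a b ^ n * X 2 ^ m) ≠ 0) : i = j ∧ k = 2 * n + m - 2 * j ∧ j ≤ n := by
  induction n generalizing i j k with
  | zero =>
    rw [pow_zero, one_mul, cf_X2_pow] at h
    split_ifs at h with h1
    · omega
    · exact absurd rfl h
  | succ n ih =>
    rw [pow_succ', mul_assoc, cf_casFactor_mul] at h
    by_cases h1 : cf (i - 1) (j - 1) k (casFactor a b ^ n * X 2 ^ m) = 0
    · rw [h1, zero_add] at h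
      have := ih (right_ne_zero_of_mul h)
      push_cast
      omega
    · have := ih h1
      push_cast
      omega

theorem cf_casFactor_pow_mul_lead (a b : ℝ) (n m : ℕ) :
    cf n n m (casFactor a b ^ n * X 2 ^ m) = 1 := by
  induction n with
  | zero => rw [pow_zero, one_mul, cf_X2_pow]; simp
  | succ n ih =>
    have h : cf ((n : ℤ) + 1) (n + 1) (m - 2) (casFactor a b ^ n * X 2 ^ m) = 0 := by
      by_contra h
      have := cf_casFactor_pow_mul_ne_zero n m h
      omega
    rw [pow_succ', mul_assoc, cf_casFactor_mul]
    push_cast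
    rw [h, add_sub_cancel_right, ih]
    simp

theorem cf_XY_pow_mul (n m : ℕ) (i j k : ℤ) :
    cf i j k ((X 0 * X 1) ^ n * X 2 ^ m : FSeries) = if i = n ∧ j = n ∧ k = m then 1 else 0 := by
  rw [← cf_monomial n n m]
  congr 1
  ring

theorem dLambda_smul_unit_eq_zero {a b : ℝ} {f : FSeries}
    (h0 : b • (X 0 * (X 1 * pderiv ℝ 1 f)) + X 2 * (X 2 * pderiv ℝ 1 f) -
      a • (X 0 * (X 2 * pderiv ℝ 2 f)) = 0)
    (h1 : a • (X 1 * (X 2 * pderiv ℝ 2 f)) - b • (X 0 * (X 1 * pderiv ℝ 0 f)) -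
      X 2 * (X 2 * pderiv ℝ 0 f) = 0)
    (h2 : a • (X 0 * (X 2 * pderiv ℝ 0 f)) - a • (X 1 * (X 2 * pderiv ℝ 1 f)) = 0) :
    dLambda a b (f • unit) = 0 := by
  have hI : ∀ I, (f • unit : Polyvector) I = if I = ∅ then f else 0 := by
    intro I
    rw [Pi.smul_apply, unit, Pi.single_apply]
    split_ifs <;> simp
  funext I
  rcases finset_fin_three_cases I with rfl | rfl | rfl | rfl | rfl | rfl | rfl | rfl <;>
  simp (decide := true) only [dLambda_apply_empty, dLambda_apply_0, dLambda_apply_1,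
    dLambda_apply_2, dLambda_apply_01, dLambda_apply_02, dLambda_apply_12, dLambda_apply_012, hI,
    if_true, if_false, map_zero, mul_zero, smul_zero, add_zero, sub_zero, h0, h1, h2] <;> rfl

theorem dLambda_one (a b : ℝ) : dLambda a b ((1 : FSeries) • unit) = 0 :=
  dLambda_smul_unit_eq_zero (by simp) (by simp) (by simp)

/-- `(xy + z² / (2a + b))^n z^m` is a Casimir if `b n = a m`. -/
theorem dLambda_cas {a b : ℝ} (hab : 2 * a + b ≠ 0) {n m : ℕ} (hn : 0 < n) (hm : 0 < m)
    (h : b * n = a * m) : dLambda a b ((casFactor a b ^ n * X 2 ^ m) • unit) = 0 := by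
  obtain ⟨n, rfl⟩ := Nat.exists_eq_succ_of_ne_zero hn.ne'
  obtain ⟨m, rfl⟩ := Nat.exists_eq_succ_of_ne_zero hm.ne'
  have h1 : algebraMap ℝ FSeries b * ((n : FSeries) + 1) =
      algebraMap ℝ FSeries a * ((m : FSeries) + 1) := by
    have := congrArg (algebraMap ℝ FSeries) h
    simpa using this
  have h2 : (2 * algebraMap ℝ FSeries a + algebraMap ℝ FSeries b) *
      algebraMap ℝ FSeries (1 / (2 * a + b)) = 1 := by
    have := congrArg (algebraMap ℝ FSeries) (mul_one_div_cancel hab)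
    rwa [map_mul, map_add, map_mul, map_one, map_ofNat] at this
  have hg : casFactor a b = X 0 * X 1 + algebraMap ℝ FSeries (1 / (2 * a + b)) * X 2 ^ 2 := by
    rw [casFactor, Algebra.smul_def]
  have hc : ∀ s, pderiv ℝ s (algebraMap ℝ FSeries (1 / (2 * a + b))) = 0 := fun s =>
    Derivation.map_algebraMap _ _
  generalize algebraMap ℝ FSeries (1 / (2 * a + b)) = c at h2 hg hc
  have d0 : pderiv ℝ 0 (casFactor a b) = X 1 := by
    simp [hg, Derivation.leibniz, Derivation.leibniz_pow, hc]
  have d1 : pderiv ℝ 1 (casFactor a b) = X 0 := by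
    simp [hg, Derivation.leibniz, Derivation.leibniz_pow, hc]
  have d2 : pderiv ℝ 2 (casFactor a b) = c * (2 * X 2) := by
    simp [hg, Derivation.leibniz, Derivation.leibniz_pow, hc]
  refine dLambda_smul_unit_eq_zero ?_ ?_ ?_ <;>
  simp [Algebra.smul_def, Derivation.leibniz, Derivation.leibniz_pow, d0, d1, d2] <;>
  generalize casFactor a b = g at * <;>
  subst hg
  · linear_combination (X 0 * X 1 + c * X 2 ^ 2) ^ n * X 2 ^ (m + 1) * X 0 *
      ((X 0 * X 1 + c * X 2 ^ 2) * h1 - (n + 1) * X 2 ^ 2 * h2)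
  · linear_combination -(X 0 * X 1 + c * X 2 ^ 2) ^ n * X 2 ^ (m + 1) * X 1 *
      ((X 0 * X 1 + c * X 2 ^ 2) * h1 - (n + 1) * X 2 ^ 2 * h2)
  · ring

/-! ### Direct sum decompositions of subquotients -/

section

variable {M : Type*} [AddCommGroup M] [Module ℝ M]

theorem mem_classes {Z W V : Submodule ℝ M} {x : Subquotient Z W} :
    x ∈ classes Z W V ↔ ∃ v : Z, (v : M) ∈ V ∧ (W.submoduleOf Z).mkQ v = x := by
  rw [classes, Submodule.mem_map]
  rfl

theorem mkQ_eq_zero_iff {Z W : Submodule ℝ M} {v : Z} :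
    (W.submoduleOf Z).mkQ v = 0 ↔ (v : M) ∈ W := by
  rw [Submodule.mkQ_apply, Submodule.Quotient.mk_eq_zero]
  rfl

/-- A criterion for decompositions modulo a subspace in terms of representatives. -/
theorem decomposesModulo_of {Z W : Submodule ℝ M} {ι : Type} [Fintype ι] [DecidableEq ι]
    {V N : ι → Submodule ℝ M} (hVZ : ∀ i, V i ≤ Z) (hN : ∀ i, V i ⊓ W = N i)
    (hspan : ∀ z ∈ Z, ∃ v : ι → M, (∀ i, v i ∈ V i) ∧ z - ∑ i, v i ∈ W)
    (hind : ∀ v : ι → M, (∀ i, v i ∈ V i) → ∑ i, v i ∈ W → ∀ i, v i ∈ W) :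
    DecomposesModulo Z W V N := by
  refine ⟨hVZ, hN, ?_⟩
  refine DirectSum.isInternal_submodule_of_iSupIndep_of_iSup_eq_top ?_ ?_
  · rw [iSupIndep_iff_finsetSum_eq_zero_imp_eq_zero]
    intro s x hx h0
    have h1 : ∀ i, ∃ v : Z, (v : M) ∈ V i ∧
        (i ∈ s → (W.submoduleOf Z).mkQ v = x i) ∧ (i ∉ s → v = 0) := by
      intro i
      by_cases hi : i ∈ s
      · obtain ⟨v, hv, hvx⟩ := mem_classes.1 (hx i hi)
        exact ⟨v, hv, fun _ => hvx, fun h => absurd hi h⟩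
      · exact ⟨0, zero_mem _, fun h => absurd h hi, fun _ => rfl⟩
    choose v hv hvx hv0 using h1
    have h2 : (W.submoduleOf Z).mkQ (∑ i, v i) = 0 := by
      rw [map_sum, ← h0]
      refine (Finset.sum_subset (Finset.subset_univ s) fun i _ hi => ?_).symm.trans
        (Finset.sum_congr rfl fun i hi => hvx i hi)
      rw [hv0 i hi, map_zero]
    rw [mkQ_eq_zero_iff] at h2
    intro i hi
    rw [← hvx i hi, mkQ_eq_zero_iff]
    exact hind (fun i => (v i : M)) hv (by simpa using h2) i
  · rw [eq_top_iff]
    rintro x -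
    obtain ⟨z, rfl⟩ := Submodule.mkQ_surjective _ x
    obtain ⟨v, hv, hz⟩ := hspan z z.2
    have h1 : (W.submoduleOf Z).mkQ z =
        ∑ i, (W.submoduleOf Z).mkQ ⟨v i, hVZ i (hv i)⟩ := by
      rw [← map_sum, ← sub_eq_zero, ← map_sub, mkQ_eq_zero_iff]
      simpa using hz
    rw [h1]
    exact Submodule.sum_mem _ fun i _ => Submodule.mem_iSup_of_mem i
      (mem_classes.2 ⟨⟨v i, hVZ i (hv i)⟩, hv i, rfl⟩)

end

/-! ### Passage from the weights to the whole complex -/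

theorem ext_of_restrict {P Q : Polyvector}
    (h : ∀ M D, restrict (BlockTerm M D) P = restrict (BlockTerm M D) Q) : P = Q := by
  refine ext_of_lc fun i j k I => ?_
  have h1 := congrArg (lc i j k I) (h (i + j + k) (i - j))
  rwa [lc_restrict, lc_restrict, if_pos ⟨rfl, rfl⟩, if_pos ⟨rfl, rfl⟩] at h1

/-- The polyvector field with given parts of weight `(M, D)`. -/
def glue (p : ℤ → ℤ → Polyvector) : Polyvector :=
  ofLc fun i j k I => lc i j k I (p (i + j + k) (i - j))

theorem lc_glue (p : ℤ → ℤ → Polyvector) (i j k : ℤ) (I : Finset (Fin 3)) :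
    lc i j k I (glue p) = lc i j k I (p (i + j + k) (i - j)) :=
  lc_ofLc_of_adm (F := fun i j k I => lc i j k I (p (i + j + k) (i - j)))
    (fun _ _ _ _ h => adm_of_lc_ne_zero h) i j k I

theorem restrict_glue {p : ℤ → ℤ → Polyvector} (hp : ∀ M D, p M D ∈ block M D) (M D : ℤ) :
    restrict (BlockTerm M D) (glue p) = p M D := by
  refine ext_of_lc fun i j k I => ?_
  rw [lc_restrict, lc_glue]
  split_ifs with h
  · rw [h.1, h.2]
  · exact (lc_eq_zero_of_mem (hp M D) h).symm

theorem glue_mem {S : ℤ → ℤ → ℤ → Finset (Fin 3) → Prop} {p : ℤ → ℤ → Polyvector}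
    (hp : ∀ M D, p M D ∈ lcIn S) : glue p ∈ lcIn S := by
  intro i j k I h
  rw [lc_glue] at h
  exact hp _ _ i j k I h

/-- The polyvector fields whose part of weight `(M, D)` is a multiple of `γ M D`. -/
def gradedSpan (γ : ℤ → ℤ → Polyvector) : Submodule ℝ Polyvector where
  carrier := {v | ∀ M D, ∃ c : ℝ, restrict (BlockTerm M D) v = c • γ M D}
  zero_mem' := fun M D => ⟨0, by simp⟩
  add_mem' := by
    intro v w hv hw M D
    obtain ⟨c, hc⟩ := hv M D
    obtain ⟨e, he⟩ := hw M D
    exact ⟨c + e, by rw [map_add, hc, he, add_smul]⟩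
  smul_mem' := by
    intro t v hv M D
    obtain ⟨c, hc⟩ := hv M D
    exact ⟨t * c, by rw [map_smul, hc, mul_smul]⟩

/-- By `BlockRep.unique`, the representatives of a cocycle of cochain degree `d` in a single weight only
involve the generators of this degree. -/
theorem BlockRep.exists_rep_cochain {a b : ℝ} {M D : ℤ} {ι : Type} [Fintype ι]
    {g : ι → Polyvector} (hg : BlockRep a b M D g) {P : Polyvector} (hP : P ∈ block M D)
    (hPc : P ∈ cocycles a b) : ∃ c : ι → ℝ, P - ∑ i, c i • g i ∈ coboundaries a b ∧
      (∀ p, P ∈ filt p → ∀ i, c i • g i ∈ filt p) ∧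
      ∀ d, P ∈ lcIn (CochainTerm d) → ∀ i, c i • g i ∈ lcIn (CochainTerm d) := by
  obtain ⟨c, hc, hf⟩ := hg.exists_rep P hP hPc
  refine ⟨c, hc, hf, fun d hd => ?_⟩
  have h1 : ∀ i, ∃ t : ℝ, restrict (CochainTerm d) (g i) = t • g i := by
    intro i
    obtain ⟨d', hd'⟩ := hg.cochain i
    by_cases h : d' = d
    · subst h
      exact ⟨1, by rw [restrict_of_mem hd', one_smul]⟩
    · refine ⟨0, ?_⟩
      rw [zero_smul]
      exact restrict_of_disjoint hd' fun i j k I h2 h3 => h (h2.symm.trans h3)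
  choose t ht using h1
  have h2 : P - ∑ i, (c i * t i) • g i ∈ coboundaries a b := by
    obtain ⟨Q, hQ⟩ := hc
    refine ⟨restrict (CochainTerm (d - 1)) Q, ?_⟩
    rw [dLambda_restrict_cochain, sub_add_cancel, hQ, map_sub, restrict_of_mem hd, map_sum]
    congr 1
    refine Finset.sum_congr rfl fun i _ => ?_
    rw [map_smul, ht, smul_smul]
  have h3 : ∑ i, (c i - c i * t i) • g i ∈ coboundaries a b := by
    have h4 := sub_mem h2 hc
    rw [sub_sub_sub_cancel_left] at h4
    simpa only [sub_smul, Finset.sum_sub_distrib] using h4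
  intro i
  have h5 := hg.unique _ h3 i
  rw [sub_smul, sub_eq_zero] at h5
  rw [h5, mul_smul, ← ht]
  exact Submodule.smul_mem _ _ (restrict_mem _ _)

section

variable {a b : ℝ} {ι : Type} [Fintype ι] {γ : ι → ℤ → ℤ → Polyvector}

theorem gradedSpan_le_cocycles (h : ∀ M D, BlockRep a b M D fun i => γ i M D) (i : ι) :
    gradedSpan (γ i) ≤ cocycles a b := by
  intro v hv
  rw [mem_cocycles]
  refine ext_of_restrict fun M D => ?_
  obtain ⟨c, hc⟩ := hv M D
  rw [← dLambda_restrict_block, hc, map_smul, mem_cocycles.1 ((h M D).cocycle i), smul_zero,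
    map_zero]

/-- The weightwise representatives of a cocycle, and the weightwise primitives of the differences, are
glued together. The diagonal degree of a term is `M + 3` plus its cochain degree, so that the diagonal
grading is respected as well. -/
theorem exists_gradedSpan_rep (h : ∀ M D, BlockRep a b M D fun i => γ i M D) {P : Polyvector}
    (hP : P ∈ cocycles a b) : ∃ v : ι → Polyvector, (∀ i, v i ∈ gradedSpan (γ i)) ∧
      P - ∑ i, v i ∈ coboundaries a b ∧ (∀ p, P ∈ filt p → ∀ i, v i ∈ filt p) ∧
      ∀ n, P ∈ diag n → ∀ i, v i ∈ diag n := by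
  have hPr : ∀ M D, restrict (BlockTerm M D) P ∈ cocycles a b := by
    intro M D
    rw [mem_cocycles, dLambda_restrict_block, mem_cocycles.1 hP, map_zero]
  choose c hc hf hd using fun M D =>
    (h M D).exists_rep_cochain (restrict_mem (BlockTerm M D) P) (hPr M D)
  have hb : ∀ i M D, c M D i • γ i M D ∈ block M D := fun i M D =>
    Submodule.smul_mem _ _ ((h M D).mem_block i)
  refine ⟨fun i => glue fun M D => c M D i • γ i M D, ?_, ?_, ?_, ?_⟩
  · intro i M D
    exact ⟨c M D i, restrict_glue (hb i) M D⟩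
  · have h1 : ∀ M D, ∃ Q ∈ block M D, dLambda a b Q = restrict (BlockTerm M D) P -
        ∑ i, c M D i • γ i M D := fun M D => exists_block_preimage
      (sub_mem (restrict_mem _ _) (Submodule.sum_mem _ fun i _ => hb i M D)) (hc M D)
    choose Q hQ hQd using h1
    refine ⟨glue Q, ext_of_restrict fun M D => ?_⟩
    rw [← dLambda_restrict_block, restrict_glue hQ, hQd, map_sub, map_sum]
    simp only [restrict_glue (hb _)]
  · intro p hp i
    rw [filt_eq]
    refine glue_mem fun M D => ?_
    rw [← filt_eq]
    refine hf M D p ?_ i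
    rw [filt_eq] at hp ⊢
    exact restrict_mem_of_mem _ hp
  · intro n hn i
    rw [diag_eq] at hn ⊢
    refine glue_mem fun M D => ?_
    have h1 := hd M D (n - M - 3) (by
      intro i j k I hI
      have h2 := restrict_mem _ _ i j k I hI
      have h3 := restrict_mem_of_mem _ hn i j k I hI
      unfold BlockTerm at h2
      unfold CochainTerm
      omega) i
    intro i' j k I hI
    have h2 := hb i M D i' j k I hI
    have h3 := h1 i' j k I hI
    unfold BlockTerm at h2
    unfold CochainTerm at h3
    omega

theorem gradedSpan_unique (h : ∀ M D, BlockRep a b M D fun i => γ i M D) {v : ι → Polyvector}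
    (hv : ∀ i, v i ∈ gradedSpan (γ i)) (hs : ∑ i, v i ∈ coboundaries a b) (i : ι) : v i = 0 := by
  refine ext_of_restrict fun M D => ?_
  choose c hc using fun i => hv i M D
  have h1 : ∑ i, c i • γ i M D ∈ coboundaries a b := by
    obtain ⟨Q, hQ⟩ := hs
    refine ⟨restrict (BlockTerm M D) Q, ?_⟩
    rw [dLambda_restrict_block, hQ, map_sum]
    exact Finset.sum_congr rfl fun i _ => hc i
  rw [hc, (h M D).unique c h1 i, map_zero]

theorem filt_anti (p : ℕ) : filt (p + 1) ≤ filt p := by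
  rw [filt_eq, filt_eq]
  intro P hP i j k I h
  have := hP i j k I h
  push_cast at this
  omega

end

/-- Representatives of the cohomology in every weight make up a system of representatives of the
cohomology, of the limit of the spectral sequence and of the filtered cohomology. -/
theorem isSystemOfRepresentatives_of_blockRep {a b : ℝ} {ι : Type} [Fintype ι] [DecidableEq ι]
    {γ : ι → ℤ → ℤ → Polyvector} (h : ∀ M D, BlockRep a b M D fun i => γ i M D)
    {V : ι → Submodule ℝ Polyvector} (hV : ∀ i, V i = gradedSpan (γ i)) :
    IsSystemOfRepresentatives a b V := by
  have hZ : ∀ i, V i ≤ cocycles a b := fun i => hV i ▸ gradedSpan_le_cocycles h i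
  have hex : ∀ P ∈ cocycles a b, ∃ v : ι → Polyvector, (∀ i, v i ∈ V i) ∧
      P - ∑ i, v i ∈ coboundaries a b ∧ (∀ p, P ∈ filt p → ∀ i, v i ∈ filt p) ∧
      ∀ n, P ∈ diag n → ∀ i, v i ∈ diag n := by
    intro P hP
    obtain ⟨v, hv, h1⟩ := exists_gradedSpan_rep h hP
    exact ⟨v, fun i => hV i ▸ hv i, h1⟩
  have hun : ∀ v : ι → Polyvector, (∀ i, v i ∈ V i) → ∑ i, v i ∈ coboundaries a b →
      ∀ i, v i = 0 := fun v hv => gradedSpan_unique h fun i => hV i ▸ hv i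
  -- the elements of the `V i` that represent a class of filtration degree `p + 1`
  have hfilt : ∀ (p n : ℕ) (v : ι → Polyvector), (∀ i, v i ∈ V i) →
      ∀ z ∈ Zinf a b (p + 1) n, ∑ i, v i - z ∈ coboundaries a b →
      ∀ i, v i ∈ V i ⊓ filt (p + 1) ⊓ diag n := by
    intro p n v hv z hz hvz i
    obtain ⟨w, hw, hwz, hwf, hwd⟩ := hex z hz.1.1
    have h1 := hun (fun i => v i - w i) (fun i => sub_mem (hv i) (hw i)) (by
      rw [Finset.sum_sub_distrib]
      have h2 := add_mem hvz hwz
      rwa [sub_add_sub_cancel] at h2) i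
    rw [sub_eq_zero] at h1
    rw [h1]
    exact ⟨⟨hw i, hwf _ hz.1.2 i⟩, hwd _ hz.2 i⟩
  have hsingle : ∀ (i : ι) (x : Polyvector), x ∈ V i → ∀ j, (Pi.single i x : ι → Polyvector) j ∈ V j := by
    intro i x hx j
    by_cases hj : j = i
    · subst hj
      simpa using hx
    · rw [Pi.single_eq_of_ne hj]
      exact zero_mem _
  have hsum : ∀ (i : ι) (x : Polyvector), ∑ j, (Pi.single i x : ι → Polyvector) j = x := by
    intro i x
    rw [Finset.sum_pi_single']
    simp
  refine ⟨?_, fun p q => ?_, fun p q => ?_⟩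
  · refine decomposesModulo_of hZ ?_ ?_ ?_
    · intro i
      rw [eq_bot_iff]
      rintro x ⟨hx, hxB⟩
      have h1 := hun (Pi.single i x) (hsingle i x hx) (by rwa [hsum]) i
      rw [Pi.single_eq_same] at h1
      exact h1
    · intro P hP
      obtain ⟨v, hv, h1, -⟩ := hex P hP
      exact ⟨v, hv, h1⟩
    · intro v hv hs i
      rw [hun v hv hs i]
      exact zero_mem _
  · have hmem : ∀ (v : ι → Polyvector), (∀ i, v i ∈ V i ⊓ filt p ⊓ diag (p + q)) →
        ∑ i, v i ∈ Zinf a b (p + 1) (p + q) ⊔ Binf a b p (p + q) →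
        ∀ i, v i ∈ V i ⊓ filt (p + 1) ⊓ diag (p + q) := by
      intro v hv hs
      obtain ⟨z, hz, w, hw, hzw⟩ := Submodule.mem_sup.1 hs
      refine hfilt p (p + q) v (fun i => (hv i).1.1) z hz ?_
      rw [← hzw, add_sub_cancel_left]
      exact hw.1.1
    have hle : ∀ i, V i ⊓ filt (p + 1) ⊓ diag (p + q) ≤ Zinf a b (p + 1) (p + q) := fun i x hx =>
      ⟨⟨hZ i hx.1.1, hx.1.2⟩, hx.2⟩
    refine decomposesModulo_of ?_ ?_ ?_ ?_
    · intro i x hx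
      exact ⟨⟨hZ i hx.1.1, hx.1.2⟩, hx.2⟩
    · intro i
      refine le_antisymm ?_ ?_
      · rintro x ⟨hx, hxW⟩
        have h1 := hmem (Pi.single i x) (fun j => ?_) (by rwa [hsum]) i
        · rwa [Pi.single_eq_same] at h1
        · by_cases hj : j = i
          · subst hj
            simpa using hx
          · rw [Pi.single_eq_of_ne hj]
            exact zero_mem _
      · intro x hx
        exact ⟨⟨⟨hx.1.1, filt_anti p hx.1.2⟩, hx.2⟩, Submodule.mem_sup_left (hle i hx)⟩
    · intro P hP
      obtain ⟨v, hv, h1, h2, h3⟩ := hex P hP.1.1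
      refine ⟨v, fun i => ⟨⟨hv i, h2 _ hP.1.2 i⟩, h3 _ hP.2 i⟩, Submodule.mem_sup_right ?_⟩
      exact ⟨⟨h1, sub_mem hP.1.2 (Submodule.sum_mem _ fun i _ => h2 _ hP.1.2 i)⟩,
        sub_mem hP.2 (Submodule.sum_mem _ fun i _ => h3 _ hP.2 i)⟩
    · intro v hv hs i
      exact Submodule.mem_sup_left (hle i (hmem v hv hs i))
  · -- classes in the cohomology, represented by elements of the `V i`
    let mk : cocycles a b →ₗ[ℝ] Cohomology a b := ((coboundaries a b).submoduleOf _).mkQ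
    have hmem : ∀ (v : ι → cocycles a b), (∀ i, (v i : Polyvector) ∈ V i) →
        ∑ i, mk (v i) ∈ Hfilt a b (p + 1) (p + q) →
        ∀ i, (v i : Polyvector) ∈ V i ⊓ filt (p + 1) ⊓ diag (p + q) := by
      intro v hv hs
      obtain ⟨z, hz, hzs⟩ := mem_classes.1 hs
      refine hfilt p (p + q) (fun i => v i) hv z hz ?_
      have h1 : mk (∑ i, v i - z) = 0 := by
        rw [map_sub, map_sum, sub_eq_zero]
        exact hzs.symm
      have h2 := mkQ_eq_zero_iff.1 h1
      simpa using h2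
    have hle : ∀ i, classes (cocycles a b) (coboundaries a b) (V i ⊓ filt (p + 1) ⊓ diag (p + q)) ≤
        Hfilt a b (p + 1) (p + q) := by
      intro i x hx
      obtain ⟨v, hv, rfl⟩ := mem_classes.1 hx
      exact mem_classes.2 ⟨v, ⟨⟨v.2, hv.1.2⟩, hv.2⟩, rfl⟩
    have hle' : ∀ i, classes (cocycles a b) (coboundaries a b) (V i ⊓ filt p ⊓ diag (p + q)) ≤
        Hfilt a b p (p + q) := by
      intro i x hx
      obtain ⟨v, hv, rfl⟩ := mem_classes.1 hx
      exact mem_classes.2 ⟨v, ⟨⟨v.2, hv.1.2⟩, hv.2⟩, rfl⟩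
    have hind : ∀ x : ι → Cohomology a b, (∀ i, x i ∈ classes (cocycles a b) (coboundaries a b)
        (V i ⊓ filt p ⊓ diag (p + q))) → ∑ i, x i ∈ Hfilt a b (p + 1) (p + q) → ∀ i, x i ∈
        classes (cocycles a b) (coboundaries a b) (V i ⊓ filt (p + 1) ⊓ diag (p + q)) := by
      intro x hx hs i
      choose v hv hvx using fun i => mem_classes.1 (hx i)
      have h1 := hmem v (fun i => (hv i).1.1) (by
        convert hs using 1
        exact Finset.sum_congr rfl fun i _ => hvx i) i
      exact mem_classes.2 ⟨v i, h1, hvx i⟩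
    refine decomposesModulo_of hle' ?_ ?_ ?_
    · intro i
      refine le_antisymm ?_ ?_
      · rintro x ⟨hx, hxW⟩
        have h1 := hind (Pi.single i x) (fun j => ?_) (by
          rw [Finset.sum_pi_single']
          simpa using hxW) i
        · rwa [Pi.single_eq_same] at h1
        · by_cases hj : j = i
          · subst hj
            simpa using hx
          · rw [Pi.single_eq_of_ne hj]
            exact zero_mem _
      · intro x hx
        refine ⟨?_, hle i hx⟩
        obtain ⟨v, hv, rfl⟩ := mem_classes.1 hx
        exact mem_classes.2 ⟨v, ⟨⟨hv.1.1, filt_anti p hv.1.2⟩, hv.2⟩, rfl⟩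
    · intro x hx
      obtain ⟨z, hz, rfl⟩ := mem_classes.1 hx
      obtain ⟨v, hv, h1, h2, h3⟩ := hex z z.2
      have hvZ : ∀ i, v i ∈ cocycles a b := fun i => hZ i (hv i)
      refine ⟨fun i => mk ⟨v i, hvZ i⟩, fun i => ?_, ?_⟩
      · exact mem_classes.2 ⟨⟨v i, hvZ i⟩, ⟨⟨hv i, h2 _ hz.1.2 i⟩, h3 _ hz.2 i⟩, rfl⟩
      · have h4 : mk (z - ∑ i, ⟨v i, hvZ i⟩) = 0 := by
          refine mkQ_eq_zero_iff.2 ?_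
          simpa using h1
        rw [map_sub, map_sum] at h4
        change mk z - _ ∈ _
        rw [h4]
        exact zero_mem _
    · intro x hx hs i
      exact hle i (hind x hx hs i)

/-! ### The summands as graded spaces -/

theorem cf_formalSum {u : ℕ → FSeries} (hu : ∀ n m, coeff m (u n) ≠ 0 → n ≤ m.degree)
    (c : ℕ → ℝ) {i j k : ℤ} {n : ℕ} (h : ∀ l, l ≠ n → cf i j k (u l) = 0) :
    cf i j k (formalSum u c) = c n * cf i j k (u n) := by
  by_cases hn : 0 ≤ i ∧ 0 ≤ j ∧ 0 ≤ k
  · obtain ⟨hi, hj, hk⟩ := hn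
    lift i to ℕ using hi
    lift j to ℕ using hj
    lift k to ℕ using hk
    simp only [cf_natCast] at h ⊢
    change ∑ l ∈ Finset.range ((expo i j k).degree + 1), c l * coeff (expo i j k) (u l) = _
    refine Finset.sum_eq_single n (fun l _ hl => by rw [h l hl, mul_zero]) fun hn => ?_
    by_contra h1
    exact hn (Finset.mem_range.2 (Nat.lt_succ_of_le (hu n _ (right_ne_zero_of_mul h1))))
  · rw [cf_eq_zero (by omega), cf_eq_zero (by omega), mul_zero]

open Classical in
/-- The generator `u n ω`, `n ∈ K`, of weight `(M, D)`, where `W n` is the weight of `u n ω`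
(`0`, if there is none). The definition is irreducible, for the sake of unification in families of
generators. -/
@[irreducible]
def gen (u : ℕ → FSeries) (K : Set ℕ) (ω : Polyvector) (W : ℕ → ℤ × ℤ) (M D : ℤ) : Polyvector :=
  if h : ∃ n ∈ K, W n = (M, D) then u h.choose • ω else 0

theorem gen_eq {u : ℕ → FSeries} {K : Set ℕ} {ω : Polyvector} {W : ℕ → ℤ × ℤ}
    (hW : Function.Injective W) {n : ℕ} (hn : n ∈ K) {M D : ℤ} (h : W n = (M, D)) :
    gen u K ω W M D = u n • ω := by
  have h1 : ∃ n ∈ K, W n = (M, D) := ⟨n, hn, h⟩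
  rw [gen, dif_pos h1, hW (h1.choose_spec.2.trans h.symm)]

theorem gen_eq_zero {u : ℕ → FSeries} {K : Set ℕ} {ω : Polyvector} {W : ℕ → ℤ × ℤ} {M D : ℤ}
    (h : ∀ n ∈ K, W n ≠ (M, D)) : gen u K ω W M D = 0 := by
  rw [gen, dif_neg]
  rintro ⟨n, hn, h1⟩
  exact h n hn h1

theorem mem_timesField {U : Submodule ℝ FSeries} {ω P : Polyvector} :
    P ∈ timesField U ω ↔ ∃ f ∈ U, f • ω = P := by
  rw [timesField, Submodule.mem_map]
  rfl

/-- The formal span of a sequence `u`, times `ω`, is graded if every `u n ω` has a single weight `W n`,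
and these weights are distinct. -/
theorem timesField_formalSpan {u : ℕ → FSeries} {K : Set ℕ} {ω : Polyvector} {s t r : ℤ}
    {Ω : Finset (Fin 3) → ℝ} (hω : HasFrame ω s t r Ω) {W : ℕ → ℤ × ℤ}
    (hW : Function.Injective W) (hu : ∀ n m, coeff m (u n) ≠ 0 → n ≤ m.degree)
    (huW : ∀ n i j k, cf (i + s) (j + t) (k + r) (u n) ≠ 0 → W n = (i + j + k, i - j)) :
    timesField (formalSpan u K) ω = gradedSpan (gen u K ω W) := by
  have hz : ∀ n i j k, W n ≠ (i + j + k, i - j) → cf (i + s) (j + t) (k + r) (u n) = 0 := by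
    intro n i j k h
    by_contra h1
    exact h (huW n i j k h1)
  have hcf : ∀ (c : ℕ → ℝ) n i j k, W n = (i + j + k, i - j) →
      cf (i + s) (j + t) (k + r) (formalSum u c) = c n * cf (i + s) (j + t) (k + r) (u n) :=
    fun c n i j k h => cf_formalSum hu c fun l hl => hz l i j k fun h1 =>
      hl (hW (h1.trans h.symm))
  have hcf0 : ∀ (c : ℕ → ℝ) i j k, (∀ n, W n ≠ (i + j + k, i - j)) →
      cf (i + s) (j + t) (k + r) (formalSum u c) = 0 := by
    intro c i j k h
    rw [cf_formalSum hu c (n := 0) fun l _ => hz l i j k (h l), hz 0 i j k (h 0), mul_zero]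
  have hgen : ∀ (c : ℕ → ℝ), (∀ n, n ∉ K → c n = 0) → ∀ (C : ℝ) i j k I,
      (∀ n, W n = (i + j + k, i - j) → n ∈ K → C = c n) →
      lc i j k I (formalSum u c • ω) = lc i j k I (C • gen u K ω W (i + j + k) (i - j)) := by
    intro c hc C i j k I hC
    rw [hω, map_smul]
    by_cases h : ∃ n, W n = (i + j + k, i - j)
    · obtain ⟨n, hn⟩ := h
      rw [hcf c n i j k hn]
      by_cases hK : n ∈ K
      · rw [gen_eq hW hK hn, hω, hC n hn hK, smul_eq_mul, mul_assoc]
      · rw [hc n hK, gen_eq_zero, map_zero, smul_zero, zero_mul, zero_mul]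
        intro l hl hl'
        exact hK (hW (hn.trans hl'.symm) ▸ hl)
    · rw [hcf0 c i j k fun n hn => h ⟨n, hn⟩, zero_mul, gen_eq_zero, map_zero, smul_zero]
      exact fun n _ hn => h ⟨n, hn⟩
  have hgenb : ∀ M D, gen u K ω W M D ∈ block M D := by
    intro M D i j k I h
    by_cases h1 : ∃ n ∈ K, W n = (M, D)
    · obtain ⟨n, hn, hn'⟩ := h1
      rw [gen_eq hW hn hn', hω] at h
      have h2 := (huW n i j k (left_ne_zero_of_mul h)).symm.trans hn'
      exact Prod.mk.inj h2
    · rw [gen_eq_zero fun n hn hn' => h1 ⟨n, hn, hn'⟩, map_zero] at h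
      exact absurd rfl h
  ext P
  rw [mem_timesField]
  constructor
  · rintro ⟨f, ⟨c, hc, rfl⟩, rfl⟩ M D
    have hC : ∃ C : ℝ, ∀ n, W n = (M, D) → n ∈ K → C = c n := by
      by_cases h : ∃ n, W n = (M, D)
      · obtain ⟨n, hn⟩ := h
        exact ⟨c n, fun l hl _ => by rw [hW (hl.trans hn.symm)]⟩
      · exact ⟨0, fun n hn => absurd ⟨n, hn⟩ h⟩
    obtain ⟨C, hC⟩ := hC
    refine ⟨C, ext_of_lc fun i j k I => ?_⟩
    rw [lc_restrict]
    split_ifs with h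
    · obtain ⟨rfl, rfl⟩ := h
      exact hgen c hc C i j k I hC
    · rw [map_smul, lc_eq_zero_of_mem (hgenb M D) h, smul_zero]
  · intro hP
    choose C hC using hP
    classical
    refine ⟨formalSum u fun n => if n ∈ K then C (W n).1 (W n).2 else 0,
      ⟨_, fun n hn => if_neg hn, rfl⟩, ext_of_lc fun i j k I => ?_⟩
    rw [hgen _ (fun n hn => if_neg hn) (C (i + j + k) (i - j)) i j k I, ← hC, lc_restrict,
      if_pos ⟨rfl, rfl⟩]
    intro n hn hK
    rw [if_pos hK, hn]

/-- The family with the only nonzero member `g`, of weight `(M₀, D₀)`. The definition is irreducible for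
the same reason as `gen`. -/
@[irreducible]
def singleGen (M₀ D₀ : ℤ) (g : Polyvector) (M D : ℤ) : Polyvector :=
  if M = M₀ ∧ D = D₀ then g else 0

theorem span_eq_gradedSpan {M₀ D₀ : ℤ} {g : Polyvector} (hg : g ∈ block M₀ D₀) :
    Submodule.span ℝ {g} = gradedSpan (singleGen M₀ D₀ g) := by
  have h0 : ∀ M D, ¬ (M = M₀ ∧ D = D₀) → restrict (BlockTerm M D) g = 0 := by
    intro M D h
    refine restrict_of_disjoint hg fun i j k I h1 h2 => h ?_
    exact ⟨h2.1.symm.trans h1.1, h2.2.symm.trans h1.2⟩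
  ext P
  rw [Submodule.mem_span_singleton]
  constructor
  · rintro ⟨c, rfl⟩ M D
    refine ⟨c, ?_⟩
    rw [map_smul, singleGen]
    split_ifs with h
    · obtain ⟨rfl, rfl⟩ := h
      rw [restrict_of_mem hg]
    · rw [h0 M D h]
  · intro hP
    obtain ⟨c, hc⟩ := hP M₀ D₀
    refine ⟨c, ext_of_restrict fun M D => ?_⟩
    obtain ⟨e, he⟩ := hP M D
    by_cases h : M = M₀ ∧ D = D₀
    · obtain ⟨rfl, rfl⟩ := h
      rw [hc, singleGen, if_pos ⟨rfl, rfl⟩, map_smul, restrict_of_mem hg]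
    · rw [he, singleGen, if_neg h, map_smul, h0 M D h, smul_zero, smul_zero]

theorem timesField_constSeries (ω : Polyvector) :
    timesField constSeries ω = Submodule.span ℝ {(1 : FSeries) • ω} := by
  rw [timesField, constSeries, Submodule.map_span, Set.image_singleton]
  rfl

theorem bot_eq_gradedSpan : (⊥ : Submodule ℝ Polyvector) = gradedSpan fun _ _ => 0 := by
  symm
  rw [eq_bot_iff]
  intro P hP
  refine (Submodule.mem_bot ℝ).2 (ext_of_restrict fun M D => ?_)
  obtain ⟨c, hc⟩ := hP M D
  rw [hc, smul_zero, map_zero]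

/-! ### Resonances -/

theorem le_degree_of_cf {u : ℕ → FSeries}
    (h : ∀ n i j k, cf i j k (u n) ≠ 0 → (n : ℤ) ≤ i + j + k) :
    ∀ n m, coeff m (u n) ≠ 0 → n ≤ m.degree := by
  intro n m h1
  rw [← cf_eq_coeff] at h1
  have h2 := h n _ _ _ h1
  rw [Finsupp.degree_eq_sum, Fin.sum_univ_three]
  exact_mod_cast h2

/-- The resonances for a positive rational `b / a = β / α` are the positions
`(α n, α n, β n)`. -/
theorem resonance_of_pos {a b : ℝ} (ha : a ≠ 0) {α β : ℕ} (hα : 0 < α)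
    (hαβ : Nat.Coprime α β) (hba : b / a = (β : ℝ) / α) {M e : ℤ} (he : 0 ≤ e)
    (hres : b * e = a * (M - 2 * e)) : ∃ n : ℕ, e = α * n ∧ M = (2 * α + β) * n := by
  have hα' : (α : ℝ) ≠ 0 := by exact_mod_cast hα.ne'
  have h1 : (β : ℝ) * e = α * (M - 2 * e) := by
    rw [div_eq_div_iff ha hα'] at hba
    refine mul_left_cancel₀ ha ?_
    linear_combination (-(e : ℝ)) * hba + α * hres
  have h2 : (β : ℤ) * e = α * (M - 2 * e) := by exact_mod_cast h1
  have h3 : (α : ℤ) ∣ e := by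
    have h4 : IsCoprime (α : ℤ) (β : ℤ) := Nat.isCoprime_iff_coprime.2 hαβ
    exact h4.dvd_of_dvd_mul_left ⟨_, h2⟩
  obtain ⟨n, rfl⟩ := h3
  have hαZ : (0 : ℤ) < α := by exact_mod_cast hα
  have hn : 0 ≤ n := nonneg_of_mul_nonneg_right he hαZ
  lift n to ℕ using hn
  refine ⟨n, rfl, ?_⟩
  have h5 : (α : ℤ) * (β * n) = α * (M - 2 * (α * n)) := by linarith
  have h6 := mul_left_cancel₀ hαZ.ne' h5
  linarith

/-- If `b / a` is not a positive rational number, the only resonances are the origin and, for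
`b / a = -1 / e`, the position `(e, e, -1)`. -/
theorem resonance_of_not_pos {a b : ℝ} (ha : a ≠ 0)
    (hba : ¬ ∃ t : ℚ, 0 < t ∧ b / a = (t : ℝ)) (hb : b ≠ 0) {M e : ℤ} (he : 0 ≤ e)
    (hk : -1 ≤ M - 2 * e) (hres : b * e = a * (M - 2 * e)) :
    (e = 0 ∧ M = 0) ∨ (0 < e ∧ M - 2 * e = -1 ∧ b / a = -1 / (e : ℝ)) := by
  obtain ⟨k, hkM⟩ : ∃ k : ℤ, k = M - 2 * e := ⟨_, rfl⟩
  have hres' : b * e = a * k := by rw [hres, hkM]; push_cast; ring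
  rcases he.eq_or_lt with rfl | he
  · left
    have h1 : k = 0 := by
      have : a * (k : ℝ) = 0 := by rw [← hres']; simp
      exact_mod_cast (mul_eq_zero.1 this).resolve_left ha
    omega
  · have he' : (e : ℝ) ≠ 0 := by exact_mod_cast he.ne'
    have h1 : b / a = k / e := by
      rw [div_eq_div_iff ha he', hres', mul_comm]
    right
    rcases lt_trichotomy k 0 with h | rfl | h
    · have h2 : k = -1 := by omega
      refine ⟨he, by omega, ?_⟩
      rw [h1, h2]; simp
    · have : b * (e : ℝ) = 0 := by rw [hres']; simp
      exact absurd this (mul_ne_zero hb he')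
    · refine absurd ⟨(k : ℚ) / e, ?_, by rw [h1]; push_cast; rfl⟩ hba
      have h3 : (0 : ℚ) < k := by exact_mod_cast h
      have h4 : (0 : ℚ) < e := by exact_mod_cast he
      positivity

/-! ### The weights of the generators -/

theorem gen_pd12_eq_bottom2 {K : Set ℕ} {M : ℤ} (hK : ∀ n : ℕ, (n : ℤ) - 2 = M → n ∈ K) :
    gen (fun k => X 2 ^ k) K pd12 (fun k => ((k : ℤ) - 2, 0)) M 0 = bottom2 M := by
  by_cases h : 0 ≤ M + 2
  · obtain ⟨n, hn⟩ := Int.eq_ofNat_of_zero_le h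
    have hn' : (n : ℤ) - 2 = M := by omega
    rw [gen_eq (fun x y h => by have := (Prod.mk.inj h).1; omega) (hK n hn') (by rw [hn']),
      bottom2_eq, hn']
  · rw [bottom2_eq_zero (by omega), gen_eq_zero]
    intro n _ h1
    have := (Prod.mk.inj h1).1
    omega

theorem gen_pd123_eq_bottom3 {K : Set ℕ} {M : ℤ} (hK : ∀ n : ℕ, (n : ℤ) - 3 = M → n ∈ K) :
    gen (fun k => X 2 ^ k) K pd123 (fun k => ((k : ℤ) - 3, 0)) M 0 = bottom3 M := by
  by_cases h : 0 ≤ M + 3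
  · obtain ⟨n, hn⟩ := Int.eq_ofNat_of_zero_le h
    have hn' : (n : ℤ) - 3 = M := by omega
    rw [gen_eq (fun x y h => by have := (Prod.mk.inj h).1; omega) (hK n hn') (by rw [hn']),
      bottom3_eq, hn']
  · rw [bottom3_eq_zero (by omega), gen_eq_zero]
    intro n _ h1
    have := (Prod.mk.inj h1).1
    omega

theorem coordPowers2_pd12 (K : Set ℕ) : timesField (coordPowers 2 K) pd12 =
    gradedSpan (gen (fun k => X 2 ^ k) K pd12 (fun k => ((k : ℤ) - 2, 0))) := by
  refine timesField_formalSpan hasFrame_pd12 (fun x y h => by have := (Prod.mk.inj h).1; omega)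
    (le_degree_of_cf fun n i j k h => ?_) fun n i j k h => ?_ <;>
  rw [cf_X2_pow] at h <;> split_ifs at h with h1
  · omega
  · exact absurd rfl h
  · exact Prod.ext (by dsimp only; omega) (by dsimp only; omega)
  · exact absurd rfl h

theorem coordPowers2_pd123 (K : Set ℕ) : timesField (coordPowers 2 K) pd123 =
    gradedSpan (gen (fun k => X 2 ^ k) K pd123 (fun k => ((k : ℤ) - 3, 0))) := by
  refine timesField_formalSpan hasFrame_pd123 (fun x y h => by have := (Prod.mk.inj h).1; omega)
    (le_degree_of_cf fun n i j k h => ?_) fun n i j k h => ?_ <;>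
  rw [cf_X2_pow] at h <;> split_ifs at h with h1
  · omega
  · exact absurd rfl h
  · exact Prod.ext (by dsimp only; omega) (by dsimp only; omega)
  · exact absurd rfl h

theorem coordPowers0_pd23 (K : Set ℕ) : timesField (coordPowers 0 K) pd23 =
    gradedSpan (gen (fun k => X 0 ^ k) K pd23 (fun k => ((k : ℤ) - 2, (k : ℤ) + 1))) := by
  refine timesField_formalSpan hasFrame_pd23 (fun x y h => by have := (Prod.mk.inj h).1; omega)
    (le_degree_of_cf fun n i j k h => ?_) fun n i j k h => ?_ <;>
  rw [cf_X0_pow] at h <;> split_ifs at h with h1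
  · omega
  · exact absurd rfl h
  · exact Prod.ext (by dsimp only; omega) (by dsimp only; omega)
  · exact absurd rfl h

theorem coordPowers1_pd31 (K : Set ℕ) : timesField (coordPowers 1 K) pd31 =
    gradedSpan (gen (fun k => X 1 ^ k) K pd31 (fun k => ((k : ℤ) - 2, -((k : ℤ) + 1)))) := by
  refine timesField_formalSpan hasFrame_pd31 (fun x y h => by have := (Prod.mk.inj h).1; omega)
    (le_degree_of_cf fun n i j k h => ?_) fun n i j k h => ?_ <;>
  rw [cf_X1_pow] at h <;> split_ifs at h with h1
  · omega
  · exact absurd rfl h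
  · exact Prod.ext (by dsimp only; omega) (by dsimp only; omega)
  · exact absurd rfl h

theorem coordPowers0_pd123 (K : Set ℕ) : timesField (coordPowers 0 K) pd123 =
    gradedSpan (gen (fun k => X 0 ^ k) K pd123 (fun k => ((k : ℤ) - 3, (k : ℤ)))) := by
  refine timesField_formalSpan hasFrame_pd123 (fun x y h => by have := (Prod.mk.inj h).1; omega)
    (le_degree_of_cf fun n i j k h => ?_) fun n i j k h => ?_ <;>
  rw [cf_X0_pow] at h <;> split_ifs at h with h1
  · omega
  · exact absurd rfl h
  · exact Prod.ext (by dsimp only; omega) (by dsimp only; omega)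
  · exact absurd rfl h

theorem coordPowers1_pd123 (K : Set ℕ) : timesField (coordPowers 1 K) pd123 =
    gradedSpan (gen (fun k => X 1 ^ k) K pd123 (fun k => ((k : ℤ) - 3, -(k : ℤ)))) := by
  refine timesField_formalSpan hasFrame_pd123 (fun x y h => by have := (Prod.mk.inj h).1; omega)
    (le_degree_of_cf fun n i j k h => ?_) fun n i j k h => ?_ <;>
  rw [cf_X1_pow] at h <;> split_ifs at h with h1
  · omega
  · exact absurd rfl h
  · exact Prod.ext (by dsimp only; omega) (by dsimp only; omega)
  · exact absurd rfl h

/-- The weights of the generators of the spaces of Casimirs. -/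
def casWeight (α β : ℕ) (n : ℕ) : ℤ × ℤ := ((2 * α + β) * n, 0)

theorem casWeight_injective {α β : ℕ} (hβ : 0 < β) : Function.Injective (casWeight α β) := by
  intro x y h
  have h1 := (Prod.mk.inj h).1
  have h2 : ((2 * α + β : ℕ) : ℤ) ≠ 0 := by omega
  push_cast at h2
  exact_mod_cast mul_left_cancel₀ h2 h1

theorem Cas4_eq (a b : ℝ) {α β : ℕ} (hβ : 0 < β) {ω : Polyvector} {Ω : Finset (Fin 3) → ℝ}
    (hω : HasFrame ω 0 0 0 Ω) : timesField (Cas4 a b α β) ω =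
      gradedSpan (gen (fun i => casFactor a b ^ (α * i) * X 2 ^ (β * i)) Set.univ ω
        (casWeight α β)) := by
  refine timesField_formalSpan hω (casWeight_injective hβ)
    (le_degree_of_cf fun n i j k h => ?_) fun n i j k h => ?_
  · have h1 := cf_casFactor_pow_mul_ne_zero _ _ h
    have h2 : n ≤ β * n := Nat.le_mul_of_pos_left n hβ
    have h3 : (n : ℤ) ≤ ((β * n : ℕ) : ℤ) := by exact_mod_cast h2
    omega
  · simp only [add_zero] at h
    have h1 := cf_casFactor_pow_mul_ne_zero _ _ h
    refine Prod.ext ?_ (by simp only [casWeight]; omega)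
    simp only [casWeight]
    obtain ⟨rfl, h2, -⟩ := h1
    rw [h2]; push_cast; ring

theorem Cas4I_eq {α β : ℕ} (hβ : 0 < β) {ω : Polyvector} {Ω : Finset (Fin 3) → ℝ}
    (hω : HasFrame ω 0 0 0 Ω) : timesField (Cas4I α β) ω =
      gradedSpan (gen (fun i => (X 0 * X 1) ^ (α * i) * X 2 ^ (β * i)) Set.univ ω
        (casWeight α β)) := by
  refine timesField_formalSpan hω (casWeight_injective hβ)
    (le_degree_of_cf fun n i j k h => ?_) fun n i j k h => ?_ <;>
  (try simp only [add_zero] at h) <;>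
  rw [cf_XY_pow_mul] at h <;> split_ifs at h with h1
  · have h2 : n ≤ β * n := Nat.le_mul_of_pos_left n hβ
    have h3 : (n : ℤ) ≤ ((β * n : ℕ) : ℤ) := by exact_mod_cast h2
    omega
  · exact absurd rfl h
  · obtain ⟨rfl, rfl, rfl⟩ := h1
    refine Prod.ext ?_ (by simp [casWeight])
    simp only [casWeight]
    push_cast; ring
  · exact absurd rfl h

theorem lc_accidental2 (α : ℕ) (i j k : ℤ) (I : Finset (Fin 3)) :
    lc i j k I (((X 0 * X 1) ^ α * X 1 : FSeries) • pd23 +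
      ((X 0 * X 1) ^ α * X 0 : FSeries) • pd31) =
    (if i = α ∧ j = α ∧ k = -1 then 1 else 0) * ext8 0 0 0 0 0 (-1) 1 0 I := by
  have h1 : ∀ i j k : ℤ, cf i j k ((X 0 * X 1) ^ α * X 1 : FSeries) =
      if i = α ∧ j = α + 1 ∧ k = 0 then 1 else 0 := by
    intro i j k
    rw [mul_comm, cf_X1_mul, ← mul_one ((X 0 * X 1) ^ α), ← pow_zero (X 2), cf_XY_pow_mul]
    exact if_congr (by push_cast; omega) rfl rfl
  have h2 : ∀ i j k : ℤ, cf i j k ((X 0 * X 1) ^ α * X 0 : FSeries) =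
      if i = α + 1 ∧ j = α ∧ k = 0 then 1 else 0 := by
    intro i j k
    rw [mul_comm, cf_X0_mul, ← mul_one ((X 0 * X 1) ^ α), ← pow_zero (X 2), cf_XY_pow_mul]
    exact if_congr (by push_cast; omega) rfl rfl
  have h3 : ∀ i j k : ℤ, (i + 0 = α ∧ j + 1 = α + 1 ∧ k + 1 = 0) ↔ (i = α ∧ j = α ∧ k = -1) := by
    omega
  have h4 : ∀ i j k : ℤ, (i + 1 = α + 1 ∧ j + 0 = α ∧ k + 1 = 0) ↔ (i = α ∧ j = α ∧ k = -1) := by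
    omega
  rw [map_add, hasFrame_pd23, hasFrame_pd31, h1, h2]
  simp only [h3, h4]
  rcases finset_fin_three_cases I with rfl | rfl | rfl | rfl | rfl | rfl | rfl | rfl <;>
  simp only [ext8_values] <;> ring

theorem lc_accidental3 (α : ℕ) (i j k : ℤ) (I : Finset (Fin 3)) :
    lc i j k I (((X 0 * X 1) ^ (α + 1) : FSeries) • pd123) =
    (if i = α ∧ j = α ∧ k = -1 then 1 else 0) * ext8 0 0 0 0 0 0 0 1 I := by
  rw [hasFrame_pd123, ← mul_one ((X 0 * X 1) ^ (α + 1)), ← pow_zero (X 2), cf_XY_pow_mul]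
  congr 1
  exact if_congr (by push_cast; omega) rfl rfl

theorem mem_block_of_lc {e M : ℤ} (hM : M = 2 * e - 1) {g : Polyvector}
    {Ω : Finset (Fin 3) → ℝ} (hg : ∀ i j k I, lc i j k I g =
      (if i = e ∧ j = e ∧ k = -1 then 1 else 0) * Ω I) : g ∈ block M 0 := by
  intro i j k I h
  rw [hg] at h
  by_cases h1 : i = e ∧ j = e ∧ k = -1
  · constructor <;> omega
  · simp [h1] at h

theorem one_smul_mem_block {ω : Polyvector} {Ω : Finset (Fin 3) → ℝ} (hω : HasFrame ω 0 0 0 Ω) :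
    (1 : FSeries) • ω ∈ block 0 0 := by
  intro i j k I h
  rw [hω, cf_one] at h
  split_ifs at h with h1
  · constructor <;> omega
  · simp at h

theorem constSeries_eq {ω : Polyvector} {Ω : Finset (Fin 3) → ℝ} (hω : HasFrame ω 0 0 0 Ω) :
    timesField constSeries ω = gradedSpan (singleGen 0 0 ((1 : FSeries) • ω)) := by
  rw [timesField_constSeries, span_eq_gradedSpan (one_smul_mem_block hω)]

theorem blockRep_zero {a b : ℝ}
    (hreg : ∀ e' : ℤ, 0 ≤ e' → -1 ≤ 0 - 2 * e' → e' ≠ 0 → b * e' ≠ a * (((0 : ℤ) : ℝ) - 2 * e')) :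
    BlockRep a b 0 0 (resonantGens 1 1) := by
  have h : ∀ i j k, cf i j k (1 : FSeries) ≠ 0 → i = j ∧ k = 0 - 2 * j ∧ j ≤ 0 := by
    intro i j k h
    rw [cf_one] at h
    split_ifs at h with h1
    · omega
    · exact absurd rfl h
  exact blockRep_resonantGens le_rfl (by simp) (by simp) hreg h h (by rw [cf_one]; simp)
    (by rw [cf_one]; simp) (dLambda_one a b)

/-! ### The representatives in every weight -/

theorem gen_diag_eq_zero {u : ℕ → FSeries} {K : Set ℕ} {ω : Polyvector} {w : ℕ → ℤ} {M D : ℤ}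
    (hD : D ≠ 0) : gen u K ω (fun k => (w k, 0)) M D = 0 :=
  gen_eq_zero fun _ _ h => hD (Prod.mk.inj h).2.symm

theorem singleGen_self {M D : ℤ} {g : Polyvector} : singleGen M D g M D = g := by
  rw [singleGen, if_pos ⟨rfl, rfl⟩]

theorem singleGen_of_ne {M₀ D₀ M D : ℤ} {g : Polyvector} (h : ¬ (M = M₀ ∧ D = D₀)) :
    singleGen M₀ D₀ g M D = 0 := by
  rw [singleGen, if_neg h]

theorem ne_of_not_pos {a b : ℝ} (ha : a ≠ 0)
    (hba : ¬ ∃ t : ℚ, 0 < t ∧ b / a = (t : ℝ)) : b ≠ a := by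
  rintro rfl
  exact hba ⟨1, one_pos, by rw [div_self ha]; simp⟩

theorem isSystemOfRepresentatives_generic {a b : ℝ} (ha : a ≠ 0) (hb : b ≠ 0)
    (hba : ¬ ∃ t : ℚ, 0 < t ∧ b / a = (t : ℝ))
    (hα : ¬ ∃ α : ℕ, 0 < α ∧ b / a = -1 / (α : ℝ)) :
    IsSystemOfRepresentatives a b
      ![timesField constSeries unit,
        timesField constSeries (Y1 + (1 / 2 : ℝ) • Y3),
        timesField constSeries (Y2 + (1 / 2 : ℝ) • Y3),
        timesField constSeries (Y23 + Y31),
        timesField constSeries Y12,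
        timesField constSeries Y123,
        timesField (coordPowers 2 {k | k ≠ 2}) pd12,
        timesField (coordPowers 2 {k | k ≠ 3}) pd123] := by
  have hres : ∀ M e : ℤ, 0 ≤ e → -1 ≤ M - 2 * e → b * e = a * (M - 2 * e) → e = 0 ∧ M = 0 := by
    intro M e he hk h
    rcases resonance_of_not_pos ha hba hb he hk h with h1 | ⟨h1, -, h2⟩
    · exact h1
    · lift e to ℕ using he
      exact absurd ⟨e, by exact_mod_cast h1, by exact_mod_cast h2⟩ hα
  refine isSystemOfRepresentatives_of_blockRep (γ := ![
    singleGen 0 0 ((1 : FSeries) • unit),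
    singleGen 0 0 ((1 : FSeries) • (Y1 + (1 / 2 : ℝ) • Y3)),
    singleGen 0 0 ((1 : FSeries) • (Y2 + (1 / 2 : ℝ) • Y3)),
    singleGen 0 0 ((1 : FSeries) • (Y23 + Y31)),
    singleGen 0 0 ((1 : FSeries) • Y12),
    singleGen 0 0 ((1 : FSeries) • Y123),
    gen (fun k => X 2 ^ k) {k | k ≠ 2} pd12 (fun k => ((k : ℤ) - 2, 0)),
    gen (fun k => X 2 ^ k) {k | k ≠ 3} pd123 (fun k => ((k : ℤ) - 3, 0))]) ?_ ?_
  · intro M D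
    by_cases hD : D = 0
    · subst hD
      by_cases hM : M = 0
      · subst hM
        refine (blockRep_zero fun e' h1 h2 h3 h4 => h3 (hres 0 e' h1 h2 h4).1).extend
          ![0, 1, 2, 3, 4, 5] (by decide) ?_ ?_
        · intro i
          fin_cases i <;> exact singleGen_self
        · intro j hj
          fin_cases j
          · exact absurd rfl (hj 0)
          · exact absurd rfl (hj 1)
          · exact absurd rfl (hj 2)
          · exact absurd rfl (hj 3)
          · exact absurd rfl (hj 4)
          · exact absurd rfl (hj 5)
          · exact gen_eq_zero fun n hn h => hn (by have := (Prod.mk.inj h).1; omega)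
          · exact gen_eq_zero fun n hn h => hn (by have := (Prod.mk.inj h).1; omega)
      · refine (blockRep_nonresonant fun e h1 h2 h3 => hM (hres M e h1 h2 h3).2).extend
          ![6, 7] (by decide) ?_ ?_
        · intro i
          fin_cases i
          · exact gen_pd12_eq_bottom2 fun n hn h => hM (by omega)
          · exact gen_pd123_eq_bottom3 fun n hn h => hM (by omega)
        · intro j hj
          fin_cases j
          · exact singleGen_of_ne fun h => hM h.1
          · exact singleGen_of_ne fun h => hM h.1
          · exact singleGen_of_ne fun h => hM h.1
          · exact singleGen_of_ne fun h => hM h.1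
          · exact singleGen_of_ne fun h => hM h.1
          · exact singleGen_of_ne fun h => hM h.1
          · exact absurd rfl (hj 0)
          · exact absurd rfl (hj 1)
    · refine (blockRep_offDiagonal ha hb hD fun h => absurd h (ne_of_not_pos ha hba)).extend
        (fun i => i.elim0) (fun i => i.elim0) (fun i => i.elim0) ?_
      intro j _
      fin_cases j
      · exact singleGen_of_ne fun h => hD h.2
      · exact singleGen_of_ne fun h => hD h.2
      · exact singleGen_of_ne fun h => hD h.2
      · exact singleGen_of_ne fun h => hD h.2
      · exact singleGen_of_ne fun h => hD h.2
      · exact singleGen_of_ne fun h => hD h.2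
      · exact gen_diag_eq_zero hD
      · exact gen_diag_eq_zero hD
  · intro i
    fin_cases i
    · exact constSeries_eq hasFrame_unit
    · exact constSeries_eq hasFrame_Y1Y3
    · exact constSeries_eq hasFrame_Y2Y3
    · exact constSeries_eq hasFrame_Y23Y31
    · exact constSeries_eq hasFrame_Y12
    · exact constSeries_eq hasFrame_Y123
    · exact coordPowers2_pd12 _
    · exact coordPowers2_pd123 _

theorem isSystemOfRepresentatives_accidental {a b : ℝ} (ha : a ≠ 0) (hb : b ≠ 0)
    (hba : ¬ ∃ t : ℚ, 0 < t ∧ b / a = (t : ℝ)) {α : ℕ} (hα : 0 < α)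
    (hbα : b / a = -1 / (α : ℝ)) :
    IsSystemOfRepresentatives a b
      ![timesField constSeries unit,
        timesField constSeries (Y1 + (1 / 2 : ℝ) • Y3),
        timesField constSeries (Y2 + (1 / 2 : ℝ) • Y3),
        timesField constSeries (Y23 + Y31),
        timesField constSeries Y12,
        timesField constSeries Y123,
        accidental2 α,
        accidental3 α,
        timesField (coordPowers 2 {k | k ≠ 2 ∧ k ≠ 2 * α + 1}) pd12,
        timesField (coordPowers 2 {k | k ≠ 3 ∧ k ≠ 2 * α + 2}) pd123] := by
  have hα' : (α : ℝ) ≠ 0 := by exact_mod_cast hα.ne'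
  have hab : b * α = -a := by
    rw [div_eq_div_iff ha hα'] at hbα
    linarith
  have hres : ∀ M e : ℤ, 0 ≤ e → -1 ≤ M - 2 * e → b * e = a * (M - 2 * e) →
      (e = 0 ∧ M = 0) ∨ (e = α ∧ M = 2 * α - 1) := by
    intro M e he hk h
    rcases resonance_of_not_pos ha hba hb he hk h with h1 | ⟨h1, h2, h3⟩
    · exact Or.inl h1
    · have he' : (e : ℝ) ≠ 0 := by exact_mod_cast h1.ne'
      rw [hbα, div_eq_div_iff hα' he'] at h3
      have h4 : (e : ℝ) = α := by linarith
      have h5 : e = α := by exact_mod_cast h4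
      exact Or.inr ⟨h5, by omega⟩
  refine isSystemOfRepresentatives_of_blockRep (γ := ![
    singleGen 0 0 ((1 : FSeries) • unit),
    singleGen 0 0 ((1 : FSeries) • (Y1 + (1 / 2 : ℝ) • Y3)),
    singleGen 0 0 ((1 : FSeries) • (Y2 + (1 / 2 : ℝ) • Y3)),
    singleGen 0 0 ((1 : FSeries) • (Y23 + Y31)),
    singleGen 0 0 ((1 : FSeries) • Y12),
    singleGen 0 0 ((1 : FSeries) • Y123),
    singleGen (2 * α - 1) 0 (((X 0 * X 1) ^ α * X 1 : FSeries) • pd23 +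
      ((X 0 * X 1) ^ α * X 0 : FSeries) • pd31),
    singleGen (2 * α - 1) 0 (((X 0 * X 1) ^ (α + 1) : FSeries) • pd123),
    gen (fun k => X 2 ^ k) {k | k ≠ 2 ∧ k ≠ 2 * α + 1} pd12 (fun k => ((k : ℤ) - 2, 0)),
    gen (fun k => X 2 ^ k) {k | k ≠ 3 ∧ k ≠ 2 * α + 2} pd123 (fun k => ((k : ℤ) - 3, 0))]) ?_ ?_
  · intro M D
    by_cases hD : D = 0
    · subst hD
      by_cases hM : M = 0
      · subst hM
        refine (blockRep_zero fun e' h1 h2 h3 h4 => ?_).extend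
          ![0, 1, 2, 3, 4, 5] (by decide) ?_ ?_
        · rcases hres 0 e' h1 h2 h4 with h5 | h5 <;> omega
        · intro i
          fin_cases i <;> exact singleGen_self
        · intro j hj
          fin_cases j
          · exact absurd rfl (hj 0)
          · exact absurd rfl (hj 1)
          · exact absurd rfl (hj 2)
          · exact absurd rfl (hj 3)
          · exact absurd rfl (hj 4)
          · exact absurd rfl (hj 5)
          · exact singleGen_of_ne fun h => by omega
          · exact singleGen_of_ne fun h => by omega
          · exact gen_eq_zero fun n hn h => hn.1 (by have := (Prod.mk.inj h).1; omega)
          · exact gen_eq_zero fun n hn h => hn.1 (by have := (Prod.mk.inj h).1; omega)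
      · by_cases hM' : M = 2 * α - 1
        · subst hM'
          refine (blockRep_boundary (e := α) (by omega) (by ring) ?_ ?_ (lc_accidental2 α)
            (lc_accidental3 α)).extend ![6, 7] (by decide) ?_ ?_
          · push_cast
            linear_combination hab
          · intro e' h1 h2 h3 h4
            rcases hres _ e' h1 h2 h4 with h5 | h5
            · exact hM h5.2
            · exact h3 h5.1
          · intro i
            fin_cases i <;> exact singleGen_self
          · intro j hj
            fin_cases j
            · exact singleGen_of_ne fun h => hM h.1
            · exact singleGen_of_ne fun h => hM h.1
            · exact singleGen_of_ne fun h => hM h.1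
            · exact singleGen_of_ne fun h => hM h.1
            · exact singleGen_of_ne fun h => hM h.1
            · exact singleGen_of_ne fun h => hM h.1
            · exact absurd rfl (hj 0)
            · exact absurd rfl (hj 1)
            · exact gen_eq_zero fun n hn h =>
                hn.2 (by have := (Prod.mk.inj h).1; omega)
            · exact gen_eq_zero fun n hn h =>
                hn.2 (by have := (Prod.mk.inj h).1; omega)
        · refine (blockRep_nonresonant fun e h1 h2 h3 => ?_).extend ![8, 9] (by decide) ?_ ?_
          · rcases hres M e h1 h2 h3 with h5 | h5
            · exact hM h5.2
            · exact hM' h5.2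
          · intro i
            fin_cases i
            · exact gen_pd12_eq_bottom2 fun n hn =>
                ⟨fun h => hM (by omega), fun h => hM' (by omega)⟩
            · exact gen_pd123_eq_bottom3 fun n hn =>
                ⟨fun h => hM (by omega), fun h => hM' (by omega)⟩
          · intro j hj
            fin_cases j
            · exact singleGen_of_ne fun h => hM h.1
            · exact singleGen_of_ne fun h => hM h.1
            · exact singleGen_of_ne fun h => hM h.1
            · exact singleGen_of_ne fun h => hM h.1
            · exact singleGen_of_ne fun h => hM h.1
            · exact singleGen_of_ne fun h => hM h.1
            · exact singleGen_of_ne fun h => hM' h.1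
            · exact singleGen_of_ne fun h => hM' h.1
            · exact absurd rfl (hj 0)
            · exact absurd rfl (hj 1)
    · refine (blockRep_offDiagonal ha hb hD fun h => absurd h (ne_of_not_pos ha hba)).extend
        (fun i => i.elim0) (fun i => i.elim0) (fun i => i.elim0) ?_
      intro j _
      fin_cases j
      · exact singleGen_of_ne fun h => hD h.2
      · exact singleGen_of_ne fun h => hD h.2
      · exact singleGen_of_ne fun h => hD h.2
      · exact singleGen_of_ne fun h => hD h.2
      · exact singleGen_of_ne fun h => hD h.2
      · exact singleGen_of_ne fun h => hD h.2
      · exact singleGen_of_ne fun h => hD h.2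
      · exact singleGen_of_ne fun h => hD h.2
      · exact gen_diag_eq_zero hD
      · exact gen_diag_eq_zero hD
  · intro i
    fin_cases i
    · exact constSeries_eq hasFrame_unit
    · exact constSeries_eq hasFrame_Y1Y3
    · exact constSeries_eq hasFrame_Y2Y3
    · exact constSeries_eq hasFrame_Y23Y31
    · exact constSeries_eq hasFrame_Y12
    · exact constSeries_eq hasFrame_Y123
    · exact span_eq_gradedSpan (mem_block_of_lc rfl (lc_accidental2 α))
    · exact span_eq_gradedSpan (mem_block_of_lc rfl (lc_accidental3 α))
    · exact coordPowers2_pd12 _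
    · exact coordPowers2_pd123 _

/-- The part of the representatives that lies on the diagonal `D = 0`, for `b / a = β / α`; the
function `r` gives the generators of the four remaining summands, which lie off the diagonal. -/
theorem blockRep_diagonal_of_pos {a b : ℝ} (ha : a ≠ 0) {α β : ℕ} (hα : 0 < α) (hβ : 0 < β)
    (hαβ : Nat.Coprime α β) (hba : b / a = (β : ℝ) / α) (r : Fin 4 → ℤ → ℤ → Polyvector)
    (hr : ∀ j M, r j M 0 = 0) (M : ℤ) :
    BlockRep a b M 0 fun i => (![
      gen (fun i => casFactor a b ^ (α * i) * X 2 ^ (β * i)) Set.univ unit (casWeight α β),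
      gen (fun i => casFactor a b ^ (α * i) * X 2 ^ (β * i)) Set.univ (Y1 + (1 / 2 : ℝ) • Y3)
        (casWeight α β),
      gen (fun i => casFactor a b ^ (α * i) * X 2 ^ (β * i)) Set.univ (Y2 + (1 / 2 : ℝ) • Y3)
        (casWeight α β),
      gen (fun i => (X 0 * X 1) ^ (α * i) * X 2 ^ (β * i)) Set.univ (Y23 + Y31) (casWeight α β),
      gen (fun i => (X 0 * X 1) ^ (α * i) * X 2 ^ (β * i)) Set.univ Y12 (casWeight α β),
      gen (fun i => (X 0 * X 1) ^ (α * i) * X 2 ^ (β * i)) Set.univ Y123 (casWeight α β),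
      gen (fun k => X 2 ^ k) {k | ¬ ∃ i : ℕ, k = i * (2 * α + β) + 2} pd12
        (fun k => ((k : ℤ) - 2, 0)),
      gen (fun k => X 2 ^ k) {k | ¬ ∃ i : ℕ, k = i * (2 * α + β) + 3} pd123
        (fun k => ((k : ℤ) - 3, 0)),
      r 0, r 1, r 2, r 3] : Fin 12 → ℤ → ℤ → Polyvector) i M 0 := by
  have hα' : (α : ℝ) ≠ 0 := by exact_mod_cast hα.ne'
  have hab : b * α = a * β := by
    rw [div_eq_div_iff ha hα'] at hba
    linarith
  by_cases h : ∃ n : ℕ, M = (2 * α + β) * n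
  · obtain ⟨n, rfl⟩ := h
    have hM : ((2 * α + β) * n : ℤ) - 2 * (α * n : ℕ) = (β * n : ℕ) := by push_cast; ring
    have hF : dLambda a b ((casFactor a b ^ (α * n) * X 2 ^ (β * n)) • unit) = 0 := by
      rcases Nat.eq_zero_or_pos n with rfl | hn
      · simpa using dLambda_one a b
      · refine dLambda_cas ?_ (Nat.mul_pos hα hn) (Nat.mul_pos hβ hn) ?_
        · -- `2 a + b = a (2 + β / α)`
          intro h0
          have h1 : a * (2 * α + β) = 0 := by linear_combination (α : ℝ) * h0 - hab
          have h2 : (0 : ℝ) < 2 * α + β := by positivity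
          exact mul_ne_zero ha h2.ne' h1
        · push_cast
          linear_combination (n : ℝ) * hab
    refine (blockRep_resonantGens (M := (2 * α + β) * n) (e := (α * n : ℕ))
      (F := casFactor a b ^ (α * n) * X 2 ^ (β * n)) (G := (X 0 * X 1) ^ (α * n) * X 2 ^ (β * n))
      (by positivity) (by rw [hM]; positivity) ?_ ?_ ?_ ?_ ?_ ?_ hF).extend
      ![0, 1, 2, 3, 4, 5] (by decide) ?_ ?_
    · push_cast
      linear_combination (n : ℝ) * hab
    · intro e' h1 h2 h3 h4
      obtain ⟨m, h5, h6⟩ := resonance_of_pos ha hα hαβ hba h1 h4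
      have h7 : ((2 * α + β : ℕ) : ℤ) ≠ 0 := by omega
      have h8 : (n : ℤ) = m := mul_left_cancel₀ h7 (by push_cast; exact h6)
      exact h3 (by rw [h5, ← h8]; push_cast; rfl)
    · intro i j k h
      obtain ⟨h1, h2, h3⟩ := cf_casFactor_pow_mul_ne_zero _ _ h
      exact ⟨h1, by omega, h3⟩
    · intro i j k h
      rw [cf_XY_pow_mul] at h
      split_ifs at h with h1
      · omega
      · exact absurd rfl h
    · rw [hM]
      exact cf_casFactor_pow_mul_lead _ _ _ _
    · rw [hM, cf_XY_pow_mul, if_pos ⟨rfl, rfl, rfl⟩]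
    · intro i
      fin_cases i <;> exact gen_eq (casWeight_injective hβ) (Set.mem_univ n) rfl
    · intro j hj
      fin_cases j
      · exact absurd rfl (hj 0)
      · exact absurd rfl (hj 1)
      · exact absurd rfl (hj 2)
      · exact absurd rfl (hj 3)
      · exact absurd rfl (hj 4)
      · exact absurd rfl (hj 5)
      · refine gen_eq_zero fun k hk h => hk ⟨n, ?_⟩
        have h1 := (Prod.mk.inj h).1
        have h2 : (k : ℤ) = n * (2 * α + β) + 2 := by linear_combination h1
        exact_mod_cast h2
      · refine gen_eq_zero fun k hk h => hk ⟨n, ?_⟩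
        have h1 := (Prod.mk.inj h).1
        have h2 : (k : ℤ) = n * (2 * α + β) + 3 := by linear_combination h1
        exact_mod_cast h2
      · exact hr 0 _
      · exact hr 1 _
      · exact hr 2 _
      · exact hr 3 _
  · refine (blockRep_nonresonant fun e h1 _ h3 => ?_).extend ![6, 7] (by decide) ?_ ?_
    · obtain ⟨n, -, hn⟩ := resonance_of_pos ha hα hαβ hba h1 h3
      exact h ⟨n, hn⟩
    · intro i
      fin_cases i
      · refine gen_pd12_eq_bottom2 fun n hn => ?_
        rintro ⟨m, rfl⟩
        exact h ⟨m, by rw [← hn]; push_cast; ring⟩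
      · refine gen_pd123_eq_bottom3 fun n hn => ?_
        rintro ⟨m, rfl⟩
        exact h ⟨m, by rw [← hn]; push_cast; ring⟩
    · have h0 : ∀ (u : ℕ → FSeries) (ω : Polyvector),
          gen u Set.univ ω (casWeight α β) M 0 = 0 := fun u ω =>
        gen_eq_zero fun n _ h1 => h ⟨n, (Prod.mk.inj h1).1.symm⟩
      intro j hj
      fin_cases j
      · exact h0 _ _
      · exact h0 _ _
      · exact h0 _ _
      · exact h0 _ _
      · exact h0 _ _
      · exact h0 _ _
      · exact absurd rfl (hj 0)
      · exact absurd rfl (hj 1)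
      · exact hr 0 _
      · exact hr 1 _
      · exact hr 2 _
      · exact hr 3 _

theorem isSystemOfRepresentatives_casimir {a b : ℝ} (ha : a ≠ 0) (hb : b ≠ 0) {α β : ℕ}
    (hα : 0 < α) (hβ : 0 < β) (hαβ : Nat.Coprime α β) (hba : b / a = (β : ℝ) / α) :
    IsSystemOfRepresentatives a b
      ![timesField (Cas4 a b α β) unit,
        timesField (Cas4 a b α β) (Y1 + (1 / 2 : ℝ) • Y3),
        timesField (Cas4 a b α β) (Y2 + (1 / 2 : ℝ) • Y3),
        timesField (Cas4I α β) (Y23 + Y31),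
        timesField (Cas4I α β) Y12,
        timesField (Cas4I α β) Y123,
        timesField (coordPowers 2 {k | ¬ ∃ i : ℕ, k = i * (2 * α + β) + 2}) pd12,
        timesField (coordPowers 2 {k | ¬ ∃ i : ℕ, k = i * (2 * α + β) + 3}) pd123,
        if b = a then timesField (coordPowers 0 Set.univ) pd23 else ⊥,
        if b = a then timesField (coordPowers 1 Set.univ) pd31 else ⊥,
        if b = a then timesField (coordPowers 0 {k | k ≠ 0}) pd123 else ⊥,
        if b = a then timesField (coordPowers 1 {k | k ≠ 0}) pd123 else ⊥] := by
  by_cases hab : b = a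
  · subst hab
    simp only [if_true]
    refine isSystemOfRepresentatives_of_blockRep (γ := ![
      gen (fun i => casFactor b b ^ (α * i) * X 2 ^ (β * i)) Set.univ unit (casWeight α β),
      gen (fun i => casFactor b b ^ (α * i) * X 2 ^ (β * i)) Set.univ (Y1 + (1 / 2 : ℝ) • Y3)
        (casWeight α β),
      gen (fun i => casFactor b b ^ (α * i) * X 2 ^ (β * i)) Set.univ (Y2 + (1 / 2 : ℝ) • Y3)
        (casWeight α β),
      gen (fun i => (X 0 * X 1) ^ (α * i) * X 2 ^ (β * i)) Set.univ (Y23 + Y31) (casWeight α β),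
      gen (fun i => (X 0 * X 1) ^ (α * i) * X 2 ^ (β * i)) Set.univ Y12 (casWeight α β),
      gen (fun i => (X 0 * X 1) ^ (α * i) * X 2 ^ (β * i)) Set.univ Y123 (casWeight α β),
      gen (fun k => X 2 ^ k) {k | ¬ ∃ i : ℕ, k = i * (2 * α + β) + 2} pd12
        (fun k => ((k : ℤ) - 2, 0)),
      gen (fun k => X 2 ^ k) {k | ¬ ∃ i : ℕ, k = i * (2 * α + β) + 3} pd123
        (fun k => ((k : ℤ) - 3, 0)),
      gen (fun k => X 0 ^ k) Set.univ pd23 (fun k => ((k : ℤ) - 2, (k : ℤ) + 1)),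
      gen (fun k => X 1 ^ k) Set.univ pd31 (fun k => ((k : ℤ) - 2, -((k : ℤ) + 1))),
      gen (fun k => X 0 ^ k) {k | k ≠ 0} pd123 (fun k => ((k : ℤ) - 3, (k : ℤ))),
      gen (fun k => X 1 ^ k) {k | k ≠ 0} pd123 (fun k => ((k : ℤ) - 3, -(k : ℤ)))]) ?_ ?_
    · intro M D
      by_cases hD : D = 0
      · subst hD
        refine blockRep_diagonal_of_pos ha hα hβ hαβ hba ![
          gen (fun k => X 0 ^ k) Set.univ pd23 (fun k => ((k : ℤ) - 2, (k : ℤ) + 1)),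
          gen (fun k => X 1 ^ k) Set.univ pd31 (fun k => ((k : ℤ) - 2, -((k : ℤ) + 1))),
          gen (fun k => X 0 ^ k) {k | k ≠ 0} pd123 (fun k => ((k : ℤ) - 3, (k : ℤ))),
          gen (fun k => X 1 ^ k) {k | k ≠ 0} pd123 (fun k => ((k : ℤ) - 3, -(k : ℤ)))] ?_ M
        intro j M
        fin_cases j
        · exact gen_eq_zero fun k _ h => by have := (Prod.mk.inj h).2; omega
        · exact gen_eq_zero fun k _ h => by have := (Prod.mk.inj h).2; omega
        · exact gen_eq_zero fun k hk h => hk (by have := (Prod.mk.inj h).2; omega)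
        · exact gen_eq_zero fun k hk h => hk (by have := (Prod.mk.inj h).2; omega)
      · -- the weights of `x^n ∂₂₃` and `x^(n+1) ∂₁₂₃`
        by_cases h1 : 0 < D ∧ M + 3 = D
        · obtain ⟨n, hn⟩ := Int.eq_ofNat_of_zero_le (show 0 ≤ D - 1 by omega)
          obtain rfl : D = n + 1 := by omega
          obtain rfl : M = (n : ℤ) - 2 := by omega
          refine (blockRep_X0 b n).extend ![8, 10] (by decide) ?_ ?_
          · intro i
            fin_cases i
            · exact gen_eq (fun x y h => by have := (Prod.mk.inj h).1; omega) (Set.mem_univ n) rfl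
            · exact gen_eq (n := n + 1) (fun x y h => by have := (Prod.mk.inj h).1; omega)
                (Nat.succ_ne_zero n) (Prod.ext (by push_cast; ring) (by push_cast; ring))
          · intro j hj
            fin_cases j
            · exact gen_diag_eq_zero hD
            · exact gen_diag_eq_zero hD
            · exact gen_diag_eq_zero hD
            · exact gen_diag_eq_zero hD
            · exact gen_diag_eq_zero hD
            · exact gen_diag_eq_zero hD
            · exact gen_diag_eq_zero hD
            · exact gen_diag_eq_zero hD
            · exact absurd rfl (hj 0)
            · exact gen_eq_zero fun k _ h => by have := (Prod.mk.inj h).2; omega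
            · exact absurd rfl (hj 1)
            · exact gen_eq_zero fun k _ h => by have := (Prod.mk.inj h).2; omega
        -- the weights of `y^n ∂₃₁` and `y^(n+1) ∂₁₂₃`
        · by_cases h2 : D < 0 ∧ M + 3 = -D
          · obtain ⟨n, hn⟩ := Int.eq_ofNat_of_zero_le (show 0 ≤ -D - 1 by omega)
            obtain rfl : D = -((n : ℤ) + 1) := by omega
            obtain rfl : M = (n : ℤ) - 2 := by omega
            refine (blockRep_X1 b n).extend ![9, 11] (by decide) ?_ ?_
            · intro i
              fin_cases i
              · exact gen_eq (fun x y h => by have := (Prod.mk.inj h).1; omega) (Set.mem_univ n)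
                  rfl
              · exact gen_eq (n := n + 1) (fun x y h => by have := (Prod.mk.inj h).1; omega)
                  (Nat.succ_ne_zero n) (Prod.ext (by push_cast; ring) (by push_cast; ring))
            · intro j hj
              fin_cases j
              · exact gen_diag_eq_zero hD
              · exact gen_diag_eq_zero hD
              · exact gen_diag_eq_zero hD
              · exact gen_diag_eq_zero hD
              · exact gen_diag_eq_zero hD
              · exact gen_diag_eq_zero hD
              · exact gen_diag_eq_zero hD
              · exact gen_diag_eq_zero hD
              · exact gen_eq_zero fun k _ h => by have := (Prod.mk.inj h).2; omega
              · exact absurd rfl (hj 0)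
              · exact gen_eq_zero fun k _ h => by have := (Prod.mk.inj h).2; omega
              · exact absurd rfl (hj 1)
          · refine (blockRep_offDiagonal ha hb hD fun _ => ⟨fun h3 h4 => h1 ⟨h3, h4⟩,
              fun h3 h4 => h2 ⟨h3, h4⟩⟩).extend
              (fun i => i.elim0) (fun i => i.elim0) (fun i => i.elim0) ?_
            intro j _
            fin_cases j
            · exact gen_diag_eq_zero hD
            · exact gen_diag_eq_zero hD
            · exact gen_diag_eq_zero hD
            · exact gen_diag_eq_zero hD
            · exact gen_diag_eq_zero hD
            · exact gen_diag_eq_zero hD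
            · exact gen_diag_eq_zero hD
            · exact gen_diag_eq_zero hD
            · exact gen_eq_zero fun k _ h => by
                have h3 := (Prod.mk.inj h).1
                have h4 := (Prod.mk.inj h).2
                omega
            · exact gen_eq_zero fun k _ h => by
                have h3 := (Prod.mk.inj h).1
                have h4 := (Prod.mk.inj h).2
                omega
            · exact gen_eq_zero fun k hk h => by
                have h3 := (Prod.mk.inj h).1
                have h4 := (Prod.mk.inj h).2
                have h5 : k ≠ 0 := hk
                omega
            · exact gen_eq_zero fun k hk h => by
                have h3 := (Prod.mk.inj h).1
                have h4 := (Prod.mk.inj h).2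
                have h5 : k ≠ 0 := hk
                omega
    · intro i
      fin_cases i
      · exact Cas4_eq b b hβ hasFrame_unit
      · exact Cas4_eq b b hβ hasFrame_Y1Y3
      · exact Cas4_eq b b hβ hasFrame_Y2Y3
      · exact Cas4I_eq hβ hasFrame_Y23Y31
      · exact Cas4I_eq hβ hasFrame_Y12
      · exact Cas4I_eq hβ hasFrame_Y123
      · exact coordPowers2_pd12 _
      · exact coordPowers2_pd123 _
      · exact coordPowers0_pd23 _
      · exact coordPowers1_pd31 _
      · exact coordPowers0_pd123 _
      · exact coordPowers1_pd123 _
  · simp only [if_neg hab]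
    refine isSystemOfRepresentatives_of_blockRep (γ := ![
      gen (fun i => casFactor a b ^ (α * i) * X 2 ^ (β * i)) Set.univ unit (casWeight α β),
      gen (fun i => casFactor a b ^ (α * i) * X 2 ^ (β * i)) Set.univ (Y1 + (1 / 2 : ℝ) • Y3)
        (casWeight α β),
      gen (fun i => casFactor a b ^ (α * i) * X 2 ^ (β * i)) Set.univ (Y2 + (1 / 2 : ℝ) • Y3)
        (casWeight α β),
      gen (fun i => (X 0 * X 1) ^ (α * i) * X 2 ^ (β * i)) Set.univ (Y23 + Y31) (casWeight α β),
      gen (fun i => (X 0 * X 1) ^ (α * i) * X 2 ^ (β * i)) Set.univ Y12 (casWeight α β),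
      gen (fun i => (X 0 * X 1) ^ (α * i) * X 2 ^ (β * i)) Set.univ Y123 (casWeight α β),
      gen (fun k => X 2 ^ k) {k | ¬ ∃ i : ℕ, k = i * (2 * α + β) + 2} pd12
        (fun k => ((k : ℤ) - 2, 0)),
      gen (fun k => X 2 ^ k) {k | ¬ ∃ i : ℕ, k = i * (2 * α + β) + 3} pd123
        (fun k => ((k : ℤ) - 3, 0)),
      0, 0, 0, 0]) ?_ ?_
    · intro M D
      by_cases hD : D = 0
      · subst hD
        exact blockRep_diagonal_of_pos ha hα hβ hαβ hba 0 (fun _ _ => rfl) M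
      · refine (blockRep_offDiagonal ha hb hD fun h => absurd h hab).extend
          (fun i => i.elim0) (fun i => i.elim0) (fun i => i.elim0) ?_
        intro j _
        fin_cases j
        · exact gen_diag_eq_zero hD
        · exact gen_diag_eq_zero hD
        · exact gen_diag_eq_zero hD
        · exact gen_diag_eq_zero hD
        · exact gen_diag_eq_zero hD
        · exact gen_diag_eq_zero hD
        · exact gen_diag_eq_zero hD
        · exact gen_diag_eq_zero hD
        · rfl
        · rfl
        · rfl
        · rfl
    · intro i
      fin_cases i
      · exact Cas4_eq a b hβ hasFrame_unit
      · exact Cas4_eq a b hβ hasFrame_Y1Y3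
      · exact Cas4_eq a b hβ hasFrame_Y2Y3
      · exact Cas4I_eq hβ hasFrame_Y23Y31
      · exact Cas4I_eq hβ hasFrame_Y12
      · exact Cas4I_eq hβ hasFrame_Y123
      · exact coordPowers2_pd12 _
      · exact coordPowers2_pd123 _
      · exact bot_eq_gradedSpan
      · exact bot_eq_gradedSpan
      · exact bot_eq_gradedSpan
      · exact bot_eq_gradedSpan

end

theorem theorem2 (a b : ℝ) (ha : a ≠ 0) (hb : b ≠ 0) :
    -- `b / a` is a positive rational number, with irreducible representative `β / α`
    (∀ α β : ℕ, 0 < α → 0 < β → Nat.Coprime α β → b / a = (β : ℝ) / (α : ℝ) →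
      IsSystemOfRepresentatives a b
        ![timesField (Cas4 a b α β) unit,
          timesField (Cas4 a b α β) (Y1 + (1 / 2 : ℝ) • Y3),
          timesField (Cas4 a b α β) (Y2 + (1 / 2 : ℝ) • Y3),
          timesField (Cas4I α β) (Y23 + Y31),
          timesField (Cas4I α β) Y12,
          timesField (Cas4I α β) Y123,
          timesField (coordPowers 2 {k | ¬ ∃ i : ℕ, k = i * (2 * α + β) + 2}) pd12,
          timesField (coordPowers 2 {k | ¬ ∃ i : ℕ, k = i * (2 * α + β) + 3}) pd123,
          if b = a then timesField (coordPowers 0 Set.univ) pd23 else ⊥,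
          if b = a then timesField (coordPowers 1 Set.univ) pd31 else ⊥,
          if b = a then timesField (coordPowers 0 {k | k ≠ 0}) pd123 else ⊥,
          if b = a then timesField (coordPowers 1 {k | k ≠ 0}) pd123 else ⊥]) ∧
    -- `b / a` is not a positive rational number
    ((¬ ∃ t : ℚ, 0 < t ∧ b / a = (t : ℝ)) →
      (∀ α : ℕ, 0 < α → b / a = -1 / (α : ℝ) →
        IsSystemOfRepresentatives a b
          ![timesField constSeries unit,
            timesField constSeries (Y1 + (1 / 2 : ℝ) • Y3),
            timesField constSeries (Y2 + (1 / 2 : ℝ) • Y3),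
            timesField constSeries (Y23 + Y31),
            timesField constSeries Y12,
            timesField constSeries Y123,
            accidental2 α,
            accidental3 α,
            timesField (coordPowers 2 {k | k ≠ 2 ∧ k ≠ 2 * α + 1}) pd12,
            timesField (coordPowers 2 {k | k ≠ 3 ∧ k ≠ 2 * α + 2}) pd123]) ∧
      ((¬ ∃ α : ℕ, 0 < α ∧ b / a = -1 / (α : ℝ)) →
        IsSystemOfRepresentatives a b
          ![timesField constSeries unit,
            timesField constSeries (Y1 + (1 / 2 : ℝ) • Y3),
            timesField constSeries (Y2 + (1 / 2 : ℝ) • Y3),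
            timesField constSeries (Y23 + Y31),
            timesField constSeries Y12,
            timesField constSeries Y123,
            timesField (coordPowers 2 {k | k ≠ 2}) pd12,
            timesField (coordPowers 2 {k | k ≠ 3}) pd123])) := by
  refine ⟨fun α β hα hβ hαβ hba => ?_, fun hba => ⟨fun α hα hbα => ?_, fun hα => ?_⟩⟩
  · exact isSystemOfRepresentatives_casimir ha hb hα hβ hαβ hba
  · exact isSystemOfRepresentatives_accidental ha hb hba hα hbα
  · exact isSystemOfRepresentatives_generic ha hb hba hα
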